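/- **Theorem 2.** Let $n\ge 3$ and let $\mathbf X=((x_{1k},x_{2k}))_{k=1}^n$ be an independent sample from the bivariate normal distribution with means $\mu_1,\mu_2\in\mathbb R$, standard deviations $\sigma_1,\sigma_2>0$ and correlation $\rho\in(-1,1)$. Put $\bar x_i=\frac1n\sum_k x_{ik}$, $s_{ij}=\sum_k(x_{ik}-\bar x_i)(x_{jk}-\bar x_j)$ and $r=s_{12}/\sqrt{s_{11}s_{22}}$. Let $a,b<n$ be real numbers and let $\pi_{ab}$ be the prior with density $$\pi_{ab}(\mu_1,\mu_2,\sigma_1,\sigma_2,\rho)=\frac{1}{\sigma_1^{3-a}\,\sigma_2^{2-b}\,(1-\rho^2)^{2-b/2}}$$ with respect to $d\mu_1\,d\mu_2\,d\sigma_1\,d\sigma_2\,d\rho$ on $\mathbb R^2\times(0,\infty)^2\times(-1,1)$. Let $\psi(y)=y/\sqrt{1+y^2}$. Let $Z_3,\chi^2_{n-1},\chi^2_{n-2}$ be independent, $Z_3$ standard normal and the other two chi-squared with the indicated degrees of freedom, and likewise let $Z_3^*,\chi^{2*}_{n-a},\chi^{2*}_{n-b}$ be independent. A subscript $p\in(0,1)$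 on a random variable denotes the $p$-quantile of its distribution. (a) For every sample with $s_{11},s_{22}>0$ and $|r|<1$ the posterior under $\pi_{ab}$ is proper. For every $\alpha\in(0,1)$ the posterior $1-\alpha$ quantile of $\rho$, that is, the number $\rho^*_{1-\alpha}=\rho^*_{1-\alpha}(\mathbf X)$ with $P(\rho<\rho^*_{1-\alpha}\mid\mathbf X)=1-\alpha$, is $\rho^*_{1-\alpha}=\psi(Y^*_{1-\alpha})$, where, with $r$ held fixed, $$Y^*=-\frac{Z_3^*}{\sqrt{\chi^{2*}_{n-a}}}+\frac{\sqrt{\chi^{2*}_{n-b}}}{\sqrt{\chi^{2*}_{n-a}}}\,\frac{r}{\sqrt{1-r^2}}.$$ (b) For all $\alpha\in(0,1)$, $\boldsymbol\xi=(\mu_1,\mu_2,\sigma_1,\sigma_2)$ with $\sigma_1,\sigma_2>0$, and $\rho\in(-1,1)$, the frequentist coverage of the credible interval $(-1,\rho^*_{1-\alpha}(\mathbf X))$ is $$P(\rho<\rho^*_{1-\alpha}(\mathbf X)\mid\boldsymbol\xi,\rho)=P\left(\frac{\sqrt{1-\rho^2}\,Z_3+\rho\sqrt{\chi^2_{n-1}}}{\sqrt{\chi^2_{n-2}}}>\left(\frac{\sqrt{1-\rho^2}\,Z_3^*+\rho\sqrt{\chi^{2*}_{n-a}}}{\sqrt{\chi^{2*}_{n-b}}}\right)_{\alpha}\right).$$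 (c) For every $\alpha\in(0,1)$ and every $\boldsymbol\xi$, this coverage equals $1-\alpha$ for all $\rho\in(-1,1)$ if and only if $(a,b)=(1,2)$, that is, $\pi_{ab}$ is the right-Haar prior. (d) Under $\pi_{12}$ the posterior of $\rho$ is its fiducial distribution: for every sample with $s_{11},s_{22}>0$ and $|r|<1$, the posterior distribution function of $\rho$ at any $\rho_0\in(-1,1)$ is $1-F(r\mid\rho_0)$, where $F(\cdot\mid\rho_0)$ is the sampling distribution function of the sample correlation coefficient of $n$ independent observations with true correlation $\rho_0$ (and any means and standard deviations). -/

import Mathlib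

open MeasureTheory ProbabilityTheory

noncomputable section

namespace BivariateNormal

/-- Density at `x` of the bivariate normal distribution with means `μ₁, μ₂`, standard deviations
`σ₁, σ₂` and correlation `ρ`. -/
def normalPDF (μ₁ μ₂ σ₁ σ₂ ρ : ℝ) (x : ℝ × ℝ) : ℝ :=
  1 / (2 * Real.pi * σ₁ * σ₂ * √(1 - ρ ^ 2)) *
    Real.exp (-(σ₂ ^ 2 * (x.1 - μ₁) ^ 2 + σ₁ ^ 2 * (x.2 - μ₂) ^ 2
        - 2 * ρ * σ₁ * σ₂ * (x.1 - μ₁) * (x.2 - μ₂))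
      / (2 * σ₁ ^ 2 * σ₂ ^ 2 * (1 - ρ ^ 2)))

/-- The bivariate normal distribution. -/
def normalLaw (μ₁ μ₂ σ₁ σ₂ ρ : ℝ) : Measure (ℝ × ℝ) :=
  volume.withDensity fun x => ENNReal.ofReal (normalPDF μ₁ μ₂ σ₁ σ₂ ρ x)

/-- The sampling distribution of `n` independent bivariate normal observations. -/
def sampleLaw (n : ℕ) (μ₁ μ₂ σ₁ σ₂ ρ : ℝ) : Measure (Fin n → ℝ × ℝ) :=
  Measure.pi fun _ => normalLaw μ₁ μ₂ σ₁ σ₂ ρ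

/-! Sufficient statistics of a sample. -/

/-- The sample mean of the first coordinate. -/
def mean₁ {n : ℕ} (x : Fin n → ℝ × ℝ) : ℝ := (∑ k, (x k).1) / n

/-- The sample mean of the second coordinate. -/
def mean₂ {n : ℕ} (x : Fin n → ℝ × ℝ) : ℝ := (∑ k, (x k).2) / n

/-- The sum of squares `s₁₁`. -/
def s₁₁ {n : ℕ} (x : Fin n → ℝ × ℝ) : ℝ := ∑ k, ((x k).1 - mean₁ x) ^ 2

/-- The sum of squares `s₂₂`. -/
def s₂₂ {n : ℕ} (x : Fin n → ℝ × ℝ) : ℝ := ∑ k, ((x k).2 - mean₂ x) ^ 2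

/-- The sum of products `s₁₂`. -/
def s₁₂ {n : ℕ} (x : Fin n → ℝ × ℝ) : ℝ := ∑ k, ((x k).1 - mean₁ x) * ((x k).2 - mean₂ x)

/-- The sample correlation coefficient. -/
def sampleCorr {n : ℕ} (x : Fin n → ℝ × ℝ) : ℝ := s₁₂ x / √(s₁₁ x * s₂₂ x)

/-- A sample whose correlation coefficient is defined and satisfies `|r| < 1`. -/
def Nondegenerate {n : ℕ} (x : Fin n → ℝ × ℝ) : Prop :=
  0 < s₁₁ x ∧ 0 < s₂₂ x ∧ |sampleCorr x| < 1

/-! Prior and posterior. A parameter `(μ₁, μ₂, σ₁, σ₂, ρ)` is an element of `ℝ × ℝ × ℝ × ℝ × ℝ`. -/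

/-- The parameter space: `σ₁ > 0`, `σ₂ > 0`, `-1 < ρ < 1`. -/
def paramSpace : Set (ℝ × ℝ × ℝ × ℝ × ℝ) :=
  {(_, _, σ₁, σ₂, ρ) | 0 < σ₁ ∧ 0 < σ₂ ∧ -1 < ρ ∧ ρ < 1}

/-- The (improper) prior density `π_ab`, with respect to `dμ₁ dμ₂ dσ₁ dσ₂ dρ`. -/
def prior (a b : ℝ) : ℝ × ℝ × ℝ × ℝ × ℝ → ℝ :=
  fun (_, _, σ₁, σ₂, ρ) => 1 / (σ₁ ^ (3 - a) * σ₂ ^ (2 - b) * (1 - ρ ^ 2) ^ (2 - b / 2))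

/-- The likelihood of a parameter given the sample `x`. -/
def likelihood {n : ℕ} (x : Fin n → ℝ × ℝ) : ℝ × ℝ × ℝ × ℝ × ℝ → ℝ :=
  fun (μ₁, μ₂, σ₁, σ₂, ρ) => ∏ k, normalPDF μ₁ μ₂ σ₁ σ₂ ρ (x k)

/-- The measure on the parameter space with density prior times likelihood. -/
def unnormalizedPosterior {n : ℕ} (a b : ℝ) (x : Fin n → ℝ × ℝ) :
    Measure (ℝ × ℝ × ℝ × ℝ × ℝ) :=
  (volume.restrict paramSpace).withDensity
    fun θ => ENNReal.ofReal (prior a b θ * likelihood x θ)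

/-- The posterior distribution of the parameter under the prior `π_ab`, given the sample `x`. -/
def posteriorLaw {n : ℕ} (a b : ℝ) (x : Fin n → ℝ × ℝ) : Measure (ℝ × ℝ × ℝ × ℝ × ℝ) :=
  (unnormalizedPosterior a b x Set.univ)⁻¹ • unnormalizedPosterior a b x

/-- The marginal posterior distribution of the correlation `ρ`. -/
def posteriorRho {n : ℕ} (a b : ℝ) (x : Fin n → ℝ × ℝ) : Measure ℝ :=
  (posteriorLaw a b x).map fun θ => θ.2.2.2.2

/-! Quantiles, chi-squared variables and the random variables built from them. -/

/-- The `p`-quantile of a distribution on `ℝ`. -/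
def quantile (ν : Measure ℝ) (p : ℝ) : ℝ := sInf {t : ℝ | ENNReal.ofReal p ≤ ν (Set.Iic t)}

/-- The chi-squared distribution with `k > 0` (real) degrees of freedom. -/
def chiSquared (k : ℝ) : Measure ℝ := gammaMeasure (k / 2) (1 / 2)

/-- The joint law of independent `Z`, `χ²_k`, `χ²_l` with `Z` standard normal. -/
def normalChiChi (k l : ℝ) : Measure (ℝ × ℝ × ℝ) :=
  (gaussianReal 0 1).prod ((chiSquared k).prod (chiSquared l))

/-- `ψ(y) = y / √(1 + y²)`. -/
def psi (y : ℝ) : ℝ := y / √(1 + y ^ 2)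

/-- The law of `Y* = -Z / √χ²_{n-a} + (√χ²_{n-b} / √χ²_{n-a}) (r / √(1 - r²))`, for `r` fixed. -/
def yStarLaw (n : ℕ) (a b r : ℝ) : Measure ℝ :=
  (normalChiChi (n - a) (n - b)).map
    fun (z, u, v) => -z / √u + √v / √u * (r / √(1 - r ^ 2))

/-- The law of `(√(1 - ρ²) Z + ρ √χ²_k) / √χ²_l`. -/
def ratioLaw (ρ k l : ℝ) : Measure ℝ :=
  (normalChiChi k l).map fun (z, u, v) => (√(1 - ρ ^ 2) * z + ρ * √u) / √v

/-- The frequentist coverage, at the true parameter `(μ₁, μ₂, σ₁, σ₂, ρ)`, of the one-sided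
`1 - α` credible interval `(-1, ρ_{1-α}(X))` for `ρ` under the prior `π_ab`. -/
def coverage (n : ℕ) (a b α μ₁ μ₂ σ₁ σ₂ ρ : ℝ) : ℝ :=
  (sampleLaw n μ₁ μ₂ σ₁ σ₂ ρ).real {x | ρ ∈ Set.Ioo (-1) (quantile (posteriorRho a b x) (1 - α))}

/-- Fisher's fiducial distribution function of `ρ`, given the observed sample correlation `r`:
`ρ ↦ 1 - F(r | ρ)`, where `F(· | ρ)` is the sampling distribution function of the sample correlation
coefficient when the parameter is `(μ₁, μ₂, σ₁, σ₂, ρ)`. -/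
def fiducialCDF (n : ℕ) (μ₁ μ₂ σ₁ σ₂ r ρ : ℝ) : ℝ :=
  1 - (sampleLaw n μ₁ μ₂ σ₁ σ₂ ρ).real {x | sampleCorr x ≤ r}

end BivariateNormal

end

open BivariateNormal

/-!
Everything is expressed through one function of two variables,
`mixture k l c t = E Φ(c √χ²_k - t √χ²_l)`, strictly increasing in `c` and decreasing in `t`.

*Posterior.* In the variables `c = ρ / √(1 - ρ²)` and `t = r / √(1 - r²)`, completing the squares in
both means (`likelihood_eq`) and substituting `s₁₁ / σ₁²` and `s₂₂ (1 - r²) / ((1 - ρ²) σ₂²)` for the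
standard deviations turns prior times likelihood into a multiple of the joint density of `Y*` and
two independent chi-squared variables (`exists_lintegral_unnormalizedPosterior`). So the posterior of
`ρ` is the law of `ψ(Y*)` (`posteriorRho_eq`), with distribution function `mixture (n-a) (n-b) c t`.

*Sampling distribution.* A bivariate normal sample is an affine image of a standard one, for which
`s₁₂ / √s₁₁`, `s₁₁` and `s₂₂ - s₁₂² / s₁₁` are independent, standard normal and chi-squared with
`n - 1` and `n - 2` degrees of freedom (`map_bartlett`). Hence `√(1 - ρ²) r / √(1 - r²)` is
distributed as `(√(1 - ρ²) Z + ρ √χ²_{n-1}) / √χ²_{n-2}` (`sampleLaw_apply`), with survival function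
`mixture (n-1) (n-2)`. This gives the coverage (`coverage_eq`) and the fiducial distribution
(`posteriorRho_eq_fiducialCDF`), and exact matching for `a = 1`, `b = 2`.

*Uniqueness.* Exact matching says that, for every `c`, the equation `mixture k l c t = 1 - α` has the
same root `t` for `(k, l) = (n - a, n - b)` and for `(k', l') = (n - 1, n - 2)`. If `α ≠ 1/2`, the
root at `c = 0` is not zero and determines `l`, since chi-squared variables are stochastically
increasing in the degrees of freedom; then any `c > 0` determines `k`
(`eq_of_mixture_eq_of_ne_half`). If `α = 1/2`, the root at `c = 0` is zero and says nothing. Then the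
root is expanded as `c → 0`, by the Taylor polynomial of `Φ` and the moments of `√χ²_k`: the first
order fixes `q = E √χ²_k / E √χ²_l`, the third gives `k - k' = q² (l - l')`, and the fifth gives
`(l - l') (q² (2 l' - 1) - (2 k' - 1)) = 0` (`eq_of_mixture_eq_half`). For `k' = l' + 1` the second
factor does not vanish (`chiMean_ratio_ne`): `(E √χ²_l)⁴ (2 l + 1) / ((2 l - 1) l²)` decreases
strictly under `l ↦ l + 2` and tends to `1`, so it is greater than `1`.
-/


noncomputable section

namespace BivariateNormal

open Filter Topology Set

/-! ### The standard normal distribution function -/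

/-- The standard normal distribution function. -/
def Phi (x : ℝ) : ℝ := (gaussianReal 0 1).real (Iic x)

lemma measurable_Phi : Measurable Phi := by
  apply Monotone.measurable
  intro x y h
  exact measureReal_mono (Iic_subset_Iic.2 h)

lemma Phi_nonneg (x : ℝ) : 0 ≤ Phi x := measureReal_nonneg

lemma Phi_le_one (x : ℝ) : Phi x ≤ 1 := measureReal_le_one

lemma Phi_sub_Phi (x y : ℝ) : Phi y - Phi x = ∫ t in x..y, gaussianPDFReal 0 1 t := by
  have h (z : ℝ) : Phi z = ∫ t in Iic z, gaussianPDFReal 0 1 t := by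
    rw [Phi, measureReal_def, gaussianReal_apply_eq_integral _ one_ne_zero,
      ENNReal.toReal_ofReal (integral_nonneg fun t => gaussianPDFReal_nonneg _ _ _)]
  have hi := integrable_gaussianPDFReal 0 1
  rw [h, h, intervalIntegral.integral_Iic_sub_Iic hi.integrableOn hi.integrableOn]

lemma strictMono_Phi : StrictMono Phi := by
  intro x y h
  have : 0 < Phi y - Phi x := by
    rw [Phi_sub_Phi]
    exact intervalIntegral.intervalIntegral_pos_of_pos
      ((integrable_gaussianPDFReal 0 1).intervalIntegrable)
      (fun t => gaussianPDFReal_pos _ _ _ one_ne_zero) h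
  linarith

lemma continuous_Phi : Continuous Phi := by
  have h : Phi = fun x => Phi 0 + ∫ t in (0 : ℝ)..x, gaussianPDFReal 0 1 t := by
    funext x
    rw [← Phi_sub_Phi]
    ring
  rw [h]
  exact continuous_const.add (intervalIntegral.continuous_primitive
    (fun a b => (integrable_gaussianPDFReal 0 1).intervalIntegrable) 0)

lemma tendsto_Phi_atTop : Tendsto Phi atTop (𝓝 1) := by
  have h := tendsto_cdf_atTop (gaussianReal 0 1)
  refine h.congr fun x => ?_
  rw [cdf_eq_real]
  rfl

lemma tendsto_Phi_atBot : Tendsto Phi atBot (𝓝 0) := by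
  have h := tendsto_cdf_atBot (gaussianReal 0 1)
  refine h.congr fun x => ?_
  rw [cdf_eq_real]
  rfl

lemma gaussianReal_Ici (x : ℝ) : (gaussianReal 0 1) (Ici x) = ENNReal.ofReal (Phi (-x)) := by
  have h : (gaussianReal 0 1).map (fun x => -x) = gaussianReal 0 1 := by
    rw [gaussianReal_map_neg, neg_zero]
  conv_lhs => rw [← h]
  rw [Measure.map_apply measurable_neg measurableSet_Ici, Phi, ofReal_measureReal]
  congr 1
  ext y
  simp

lemma gaussianReal_Iic (x : ℝ) : (gaussianReal 0 1) (Iic x) = ENNReal.ofReal (Phi x) := by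
  rw [Phi, ofReal_measureReal]

lemma Phi_neg (x : ℝ) : Phi (-x) = 1 - Phi x := by
  have := nullSingletonClass_gaussianReal (μ := 0) (v := 1) one_ne_zero
  have h1 : (gaussianReal 0 1).real (Ici x) = Phi (-x) := by
    rw [measureReal_def, gaussianReal_Ici, ENNReal.toReal_ofReal (Phi_nonneg _)]
  have h2 : (gaussianReal 0 1).real (Ici x) = (gaussianReal 0 1).real (Ioi x) :=
    measureReal_congr Ioi_ae_eq_Ici.symm
  rw [← h1, h2, ← compl_Iic, probReal_compl_eq_one_sub measurableSet_Iic, Phi]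

lemma Phi_zero : Phi 0 = 1 / 2 := by
  have := Phi_neg 0
  rw [neg_zero] at this
  linarith

lemma exp_neg_bound {y : ℝ} (hy : 0 ≤ y) :
    |Real.exp (-y) - (1 - y + y ^ 2 / 2)| ≤ y ^ 3 / 6 := by
  have hd : ∀ t : ℝ, HasDerivAt (fun t => Real.exp (-t)) (-Real.exp (-t)) t := fun t => by
    simpa using (hasDerivAt_neg t).exp
  have e1 : ∀ y : ℝ, 0 ≤ y → 1 - y ≤ Real.exp (-y) := fun y _ => by
    linarith [Real.add_one_le_exp (-y)]
  have mono : ∀ f f' : ℝ → ℝ, (∀ t, HasDerivAt f (f' t) t) → (∀ t, 0 ≤ t → 0 ≤ f' t) →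
      ∀ y, 0 ≤ y → f 0 ≤ f y := by
    intro f f' hf hf' y hy
    refine monotoneOn_of_deriv_nonneg (convex_Ici 0)
      (fun t _ => (hf t).continuousAt.continuousWithinAt)
      (fun t _ => (hf t).differentiableAt.differentiableWithinAt) ?_ self_mem_Ici hy hy
    intro t ht
    rw [(hf t).deriv]
    rw [interior_Ici] at ht
    exact hf' t ht.le
  have e2 : ∀ y : ℝ, 0 ≤ y → Real.exp (-y) ≤ 1 - y + y ^ 2 / 2 := fun y hy => by
    have := mono (fun t => 1 - t + t ^ 2 / 2 - Real.exp (-t)) (fun t => -1 + t + Real.exp (-t))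
      (fun t => by
        have h1 := (((hasDerivAt_const t (1 : ℝ)).sub (hasDerivAt_id t)).add
          ((hasDerivAt_pow 2 t).div_const 2)).sub (hd t)
        exact h1.congr_deriv (by push_cast; ring)) (fun t ht => by linarith [e1 t ht]) y hy
    simp at this
    linarith
  have e3 : ∀ y : ℝ, 0 ≤ y → 1 - y + y ^ 2 / 2 - y ^ 3 / 6 ≤ Real.exp (-y) := fun y hy => by
    have := mono (fun t => Real.exp (-t) - (1 - t + t ^ 2 / 2 - t ^ 3 / 6))
      (fun t => 1 - t + t ^ 2 / 2 - Real.exp (-t))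
      (fun t => by
        have h1 := (hd t).sub ((((hasDerivAt_const t (1 : ℝ)).sub (hasDerivAt_id t)).add
          ((hasDerivAt_pow 2 t).div_const 2)).sub ((hasDerivAt_pow 3 t).div_const 6))
        exact h1.congr_deriv (by push_cast; ring)) (fun t ht => by linarith [e2 t ht]) y hy
    simp at this
    linarith
  rw [abs_le]
  have h3 : 0 ≤ y ^ 3 := by positivity
  constructor <;> linarith [e2 y hy, e3 y hy]

/-- Taylor expansion of order five of the standard normal distribution function at `0`. -/
lemma Phi_taylor (x : ℝ) :
    |√(2 * Real.pi) * (Phi x - 1 / 2) - (x - x ^ 3 / 6 + x ^ 5 / 40)| ≤ |x| ^ 7 / 336 := by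
  have hpi : 0 < √(2 * Real.pi) := by positivity
  have key : ∀ x : ℝ, 0 ≤ x →
      |√(2 * Real.pi) * (Phi x - 1 / 2) - (x - x ^ 3 / 6 + x ^ 5 / 40)| ≤ x ^ 7 / 336 := by
    intro x hx
    have h1 : √(2 * Real.pi) * (Phi x - 1 / 2) = ∫ t in (0 : ℝ)..x, Real.exp (-(t ^ 2 / 2)) := by
      rw [← Phi_zero, Phi_sub_Phi, ← intervalIntegral.integral_const_mul]
      congr 1
      funext t
      rw [gaussianPDFReal]
      simp only [NNReal.coe_one, mul_one, sub_zero]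
      rw [← mul_assoc, mul_inv_cancel₀ hpi.ne', one_mul]
      congr 1
      ring
    have h2 : x - x ^ 3 / 6 + x ^ 5 / 40 =
        ∫ t in (0 : ℝ)..x, (1 - t ^ 2 / 2 + (t ^ 2 / 2) ^ 2 / 2) := by
      have hd : ∀ t ∈ uIcc 0 x, HasDerivAt (fun t : ℝ => t - t ^ 3 / 6 + t ^ 5 / 40)
          (1 - t ^ 2 / 2 + (t ^ 2 / 2) ^ 2 / 2) t := fun t _ => by
        have := ((hasDerivAt_id t).sub ((hasDerivAt_pow 3 t).div_const 6)).add
          ((hasDerivAt_pow 5 t).div_const 40)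
        exact this.congr_deriv (by push_cast; ring)
      rw [intervalIntegral.integral_eq_sub_of_hasDerivAt hd
        (Continuous.intervalIntegrable (by fun_prop) _ _)]
      simp
    have h3 : x ^ 7 / 336 = ∫ t in (0 : ℝ)..x, (t ^ 2 / 2) ^ 3 / 6 := by
      have hd : ∀ t ∈ uIcc 0 x, HasDerivAt (fun t : ℝ => t ^ 7 / 336)
          ((t ^ 2 / 2) ^ 3 / 6) t := fun t _ => by
        exact ((hasDerivAt_pow 7 t).div_const 336).congr_deriv (by push_cast; ring)
      rw [intervalIntegral.integral_eq_sub_of_hasDerivAt hd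
        (Continuous.intervalIntegrable (by fun_prop) _ _)]
      simp
    rw [h1, h2, h3, ← intervalIntegral.integral_sub
      (Continuous.intervalIntegrable (by fun_prop) _ _)
      (Continuous.intervalIntegrable (by fun_prop) _ _)]
    refine (intervalIntegral.abs_integral_le_integral_abs hx).trans ?_
    refine intervalIntegral.integral_mono_on hx
      (Continuous.intervalIntegrable (by fun_prop) _ _)
      (Continuous.intervalIntegrable (by fun_prop) _ _) fun t _ => ?_
    exact exp_neg_bound (by positivity)
  rcases le_total 0 x with hx | hx
  · rw [abs_of_nonneg hx]
    exact key x hx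
  · have h := key (-x) (by linarith)
    rw [abs_of_nonpos hx]
    rw [Phi_neg, ← abs_neg] at h
    convert h using 2
    ring

/-! ### Quantiles -/

lemma quantile_eq {ν : Measure ℝ} {p q : ℝ}
    (h : ∀ t, ENNReal.ofReal p ≤ ν (Iic t) ↔ q ≤ t) : quantile ν p = q := by
  have : {t : ℝ | ENNReal.ofReal p ≤ ν (Iic t)} = Ici q := by
    ext t
    exact h t
  rw [quantile, this, csInf_Ici]

/-- For a distribution with continuous, strictly increasing distribution function `F`, the quantile
inverts `F`. -/
lemma apply_quantile {ν : Measure ℝ} {F : ℝ → ℝ} (hν : ∀ t, ν (Iic t) = ENNReal.ofReal (F t))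
    (hF : StrictMono F) (hc : Continuous F) (h0 : Tendsto F atBot (𝓝 0))
    (h1 : Tendsto F atTop (𝓝 1)) {p : ℝ} (hp : p ∈ Ioo (0 : ℝ) 1) : F (quantile ν p) = p := by
  obtain ⟨s, hs⟩ := (h0.eventually_lt_const hp.1).exists
  obtain ⟨t, ht⟩ := (h1.eventually_const_lt hp.2).exists
  obtain ⟨q, hq⟩ := mem_range_of_exists_le_of_exists_ge hc ⟨s, hs.le⟩ ⟨t, ht.le⟩
  have : quantile ν p = q := quantile_eq fun t => by
    rw [hν, ← hq, ← hF.le_iff_le]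
    refine ⟨fun h => ?_, fun h => ENNReal.ofReal_le_ofReal h⟩
    rcases ENNReal.ofReal_le_ofReal_iff'.1 h with h | h
    · exact h
    · linarith [hp.1]
  rw [this, hq]

/-! ### Chi-squared variables -/

lemma isProbabilityMeasure_chiSquared {k : ℝ} (hk : 0 < k) :
    IsProbabilityMeasure (chiSquared k) :=
  isProbabilityMeasure_gammaMeasure (by positivity) (by norm_num)

instance sFinite_chiSquared (k : ℝ) : SFinite (chiSquared k) := by
  unfold chiSquared gammaMeasure
  infer_instance

lemma ae_pos_chiSquared (k : ℝ) : ∀ᵐ u ∂chiSquared k, 0 < u := by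
  have h : {u : ℝ | ¬ 0 < u} = Iic 0 := by
    ext u
    simp
  rw [ae_iff, h, chiSquared, gammaMeasure, withDensity_apply _ measurableSet_Iic,
    setLIntegral_congr Iio_ae_eq_Iic.symm]
  exact lintegral_gammaPDF_of_nonpos le_rfl

lemma integral_lt_integral_of_ae_lt {α : Type*} [MeasurableSpace α] {μ : Measure α}
    [IsProbabilityMeasure μ] {f g : α → ℝ} (hf : Integrable f μ) (hg : Integrable g μ)
    (h : ∀ᵐ x ∂μ, f x < g x) : ∫ x, f x ∂μ < ∫ x, g x ∂μ := by
  have h1 : 0 < ∫ x, (g x - f x) ∂μ := by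
    rw [integral_pos_iff_support_of_nonneg_ae (h.mono fun x hx => (sub_pos.2 hx).le) (hg.sub hf)]
    have : μ (Function.support fun x => g x - f x) = 1 := by
      rw [← measure_univ (μ := μ)]
      exact measure_congr (eventuallyEq_univ.2 (h.mono fun x hx => (sub_pos.2 hx).ne'))
    rw [this]
    exact one_pos
  rw [integral_sub hg hf] at h1
  linarith

/-! ### The mixture `E Φ(c √χ²_k - t √χ²_l)` -/

/-- The value `E Φ(c √χ²_k - t √χ²_l)` for independent chi-squared variables: as a function of `c` it
is the distribution function of `(t √χ²_l - Z) / √χ²_k`. -/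
def mixture (k l c t : ℝ) : ℝ :=
  ∫ p, Phi (c * √p.1 - t * √p.2) ∂(chiSquared k).prod (chiSquared l)

section

variable {k l : ℝ}

lemma ae_pos_chiSquared_prod (k l : ℝ) :
    ∀ᵐ p ∂(chiSquared k).prod (chiSquared l), 0 < p.1 ∧ 0 < p.2 :=
  (Measure.quasiMeasurePreserving_fst.ae (ae_pos_chiSquared k)).and
    (Measure.quasiMeasurePreserving_snd.ae (ae_pos_chiSquared l))

lemma measurable_mixture_integrand (c t : ℝ) :
    Measurable fun p : ℝ × ℝ => Phi (c * √p.1 - t * √p.2) :=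
  measurable_Phi.comp (by fun_prop)

lemma norm_Phi_le (x : ℝ) : ‖Phi x‖ ≤ 1 := by
  rw [Real.norm_of_nonneg (Phi_nonneg x)]
  exact Phi_le_one x

lemma integrable_mixture (hk : 0 < k) (hl : 0 < l) (c t : ℝ) :
    Integrable (fun p : ℝ × ℝ => Phi (c * √p.1 - t * √p.2))
      ((chiSquared k).prod (chiSquared l)) := by
  have := isProbabilityMeasure_chiSquared hk
  have := isProbabilityMeasure_chiSquared hl
  exact Integrable.of_bound (measurable_mixture_integrand c t).aestronglyMeasurable 1
    (ae_of_all _ fun p => norm_Phi_le _)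

lemma strictMono_mixture (hk : 0 < k) (hl : 0 < l) (t : ℝ) :
    StrictMono fun c => mixture k l c t := by
  intro c d h
  have := isProbabilityMeasure_chiSquared hk
  have := isProbabilityMeasure_chiSquared hl
  refine integral_lt_integral_of_ae_lt (integrable_mixture hk hl _ _)
    (integrable_mixture hk hl _ _) ((ae_pos_chiSquared_prod k l).mono fun p hp => strictMono_Phi ?_)
  have := mul_lt_mul_of_pos_right h (Real.sqrt_pos.2 hp.1)
  linarith

lemma strictAnti_mixture (hk : 0 < k) (hl : 0 < l) (c : ℝ) :
    StrictAnti fun t => mixture k l c t := by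
  intro s t h
  have := isProbabilityMeasure_chiSquared hk
  have := isProbabilityMeasure_chiSquared hl
  refine integral_lt_integral_of_ae_lt (integrable_mixture hk hl _ _)
    (integrable_mixture hk hl _ _) ((ae_pos_chiSquared_prod k l).mono fun p hp => strictMono_Phi ?_)
  have := mul_lt_mul_of_pos_right h (Real.sqrt_pos.2 hp.2)
  linarith

lemma continuous_mixture_left (hk : 0 < k) (hl : 0 < l) (t : ℝ) :
    Continuous fun c => mixture k l c t := by
  have := isProbabilityMeasure_chiSquared hk
  have := isProbabilityMeasure_chiSquared hl
  refine continuous_of_dominated (bound := fun _ => 1)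
    (fun c => (measurable_mixture_integrand c t).aestronglyMeasurable)
    (fun c => ae_of_all _ fun p => norm_Phi_le _) (integrable_const _)
    (ae_of_all _ fun p => continuous_Phi.comp (by fun_prop))

lemma continuous_mixture_right (hk : 0 < k) (hl : 0 < l) (c : ℝ) :
    Continuous fun t => mixture k l c t := by
  have := isProbabilityMeasure_chiSquared hk
  have := isProbabilityMeasure_chiSquared hl
  refine continuous_of_dominated (bound := fun _ => 1)
    (fun t => (measurable_mixture_integrand c t).aestronglyMeasurable)
    (fun t => ae_of_all _ fun p => norm_Phi_le _) (integrable_const _)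
    (ae_of_all _ fun p => continuous_Phi.comp (by fun_prop))

lemma tendsto_integral_Phi {α : Type*} [MeasurableSpace α] {μ : Measure α}
    [IsProbabilityMeasure μ] {F : Filter ℝ} [F.IsCountablyGenerated] {g : ℝ → α → ℝ}
    (hg : ∀ c, Measurable (g c)) {L : ℝ} {G : Filter ℝ} (hG : Tendsto Phi G (𝓝 L))
    (h : ∀ᵐ x ∂μ, Tendsto (fun c => g c x) F G) :
    Tendsto (fun c => ∫ x, Phi (g c x) ∂μ) F (𝓝 L) := by
  have h1 : ∫ _, L ∂μ = L := by simp
  rw [← h1]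
  refine tendsto_integral_filter_of_dominated_convergence (fun _ => 1)
    (Eventually.of_forall fun c => (measurable_Phi.comp (hg c)).aestronglyMeasurable)
    (Eventually.of_forall fun c => ae_of_all _ fun p => norm_Phi_le _) (integrable_const _)
    (h.mono fun x hx => hG.comp hx)

lemma tendsto_mixture_atTop (hk : 0 < k) (hl : 0 < l) (t : ℝ) :
    Tendsto (fun c => mixture k l c t) atTop (𝓝 1) := by
  have := isProbabilityMeasure_chiSquared hk
  have := isProbabilityMeasure_chiSquared hl
  refine tendsto_integral_Phi (fun c => by fun_prop) tendsto_Phi_atTop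
    ((ae_pos_chiSquared_prod k l).mono fun p hp => ?_)
  exact tendsto_atTop_add_const_right _ _ (tendsto_id.atTop_mul_const (Real.sqrt_pos.2 hp.1))

lemma tendsto_mixture_atBot (hk : 0 < k) (hl : 0 < l) (t : ℝ) :
    Tendsto (fun c => mixture k l c t) atBot (𝓝 0) := by
  have := isProbabilityMeasure_chiSquared hk
  have := isProbabilityMeasure_chiSquared hl
  refine tendsto_integral_Phi (fun c => by fun_prop) tendsto_Phi_atBot
    ((ae_pos_chiSquared_prod k l).mono fun p hp => ?_)
  exact tendsto_atBot_add_const_right _ _ (tendsto_id.atBot_mul_const (Real.sqrt_pos.2 hp.1))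

lemma tendsto_mixture_right_atTop (hk : 0 < k) (hl : 0 < l) (c : ℝ) :
    Tendsto (fun t => mixture k l c t) atTop (𝓝 0) := by
  have := isProbabilityMeasure_chiSquared hk
  have := isProbabilityMeasure_chiSquared hl
  refine tendsto_integral_Phi (fun c => by fun_prop) tendsto_Phi_atBot
    ((ae_pos_chiSquared_prod k l).mono fun p hp => ?_)
  exact tendsto_atBot_add_const_left _ _
    (tendsto_neg_atTop_atBot.comp (tendsto_id.atTop_mul_const (Real.sqrt_pos.2 hp.2)))

lemma tendsto_mixture_right_atBot (hk : 0 < k) (hl : 0 < l) (c : ℝ) :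
    Tendsto (fun t => mixture k l c t) atBot (𝓝 1) := by
  have := isProbabilityMeasure_chiSquared hk
  have := isProbabilityMeasure_chiSquared hl
  refine tendsto_integral_Phi (fun c => by fun_prop) tendsto_Phi_atTop
    ((ae_pos_chiSquared_prod k l).mono fun p hp => ?_)
  exact tendsto_atTop_add_const_left _ _
    (tendsto_neg_atBot_atTop.comp (tendsto_id.atBot_mul_const (Real.sqrt_pos.2 hp.2)))

lemma mixture_nonneg (k l c t : ℝ) : 0 ≤ mixture k l c t :=
  integral_nonneg fun _ => Phi_nonneg _

lemma lintegral_Phi_mixture (hk : 0 < k) (hl : 0 < l) (c t : ℝ) :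
    ∫⁻ p, ENNReal.ofReal (Phi (c * √p.1 - t * √p.2)) ∂(chiSquared k).prod (chiSquared l) =
      ENNReal.ofReal (mixture k l c t) :=
  (ofReal_integral_eq_lintegral_ofReal (integrable_mixture hk hl c t)
    (ae_of_all _ fun _ => Phi_nonneg _)).symm

lemma one_sub_mixture (hk : 0 < k) (hl : 0 < l) (c t : ℝ) :
    1 - mixture k l c t = mixture k l (-c) (-t) := by
  have := isProbabilityMeasure_chiSquared hk
  have := isProbabilityMeasure_chiSquared hl
  have h : ∀ p : ℝ × ℝ, Phi (-c * √p.1 - -t * √p.2) = 1 - Phi (c * √p.1 - t * √p.2) := fun p => by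
    rw [← Phi_neg]
    congr 1
    ring
  rw [mixture, mixture]
  simp_rw [h]
  rw [integral_sub (integrable_const _) (integrable_mixture hk hl c t)]
  simp

/-- A family of conditional laws of the normal component determines the law of a statistic. -/
lemma map_normalChiChi_Iic {f : ℝ × ℝ × ℝ → ℝ} (hf : Measurable f) {y c t : ℝ}
    (hk : 0 < k) (hl : 0 < l)
    (h : ∀ u v, 0 < u → 0 < v → gaussianReal 0 1 {z | f (z, u, v) ≤ y} =
      ENNReal.ofReal (Phi (c * √u - t * √v))) :
    (normalChiChi k l).map f (Iic y) = ENNReal.ofReal (mixture k l c t) := by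
  rw [Measure.map_apply hf measurableSet_Iic, normalChiChi,
    Measure.prod_apply_symm (hf measurableSet_Iic), ← lintegral_Phi_mixture hk hl]
  refine lintegral_congr_ae ((ae_pos_chiSquared_prod k l).mono fun p hp => ?_)
  exact h p.1 p.2 hp.1 hp.2

lemma isProbabilityMeasure_normalChiChi (hk : 0 < k) (hl : 0 < l) :
    IsProbabilityMeasure (normalChiChi k l) := by
  have := isProbabilityMeasure_chiSquared hk
  have := isProbabilityMeasure_chiSquared hl
  unfold normalChiChi
  infer_instance

lemma measurable_yStar (t : ℝ) :
    Measurable fun p : ℝ × ℝ × ℝ => -p.1 / √p.2.1 + √p.2.2 / √p.2.1 * t := by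
  fun_prop

lemma measurable_ratio (ρ : ℝ) :
    Measurable fun p : ℝ × ℝ × ℝ => (√(1 - ρ ^ 2) * p.1 + ρ * √p.2.1) / √p.2.2 := by
  fun_prop

/-- The distribution function of `Y*`. -/
lemma yStarLaw_Iic {n : ℕ} {a b : ℝ} (ha : a < n) (hb : b < n) (r y : ℝ) :
    yStarLaw n a b r (Iic y) =
      ENNReal.ofReal (mixture (n - a) (n - b) y (r / √(1 - r ^ 2))) := by
  refine map_normalChiChi_Iic (measurable_yStar _) (sub_pos.2 ha) (sub_pos.2 hb) ?_
  intro u v hu hv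
  have hu' := Real.sqrt_pos.2 hu
  have h : {z : ℝ | -z / √u + √v / √u * (r / √(1 - r ^ 2)) ≤ y} =
      Ici (r / √(1 - r ^ 2) * √v - y * √u) := by
    ext z
    have : -z / √u + √v / √u * (r / √(1 - r ^ 2)) = (-z + r / √(1 - r ^ 2) * √v) / √u := by
      field_simp
    rw [mem_ofPred_eq, this, div_le_iff₀ hu', mem_Ici]
    constructor <;> intro h <;> linarith
  rw [h, gaussianReal_Ici]
  congr 2
  ring

/-- The distribution function of `(√(1 - ρ²) Z + ρ √χ²_k) / √χ²_l`. -/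
lemma ratioLaw_Iic (hk : 0 < k) (hl : 0 < l) {ρ : ℝ} (hρ : ρ ∈ Ioo (-1 : ℝ) 1) (q : ℝ) :
    ratioLaw ρ k l (Iic q) =
      ENNReal.ofReal (1 - mixture k l (ρ / √(1 - ρ ^ 2)) (q / √(1 - ρ ^ 2))) := by
  have hw : 0 < √(1 - ρ ^ 2) := Real.sqrt_pos.2 (by nlinarith [hρ.1, hρ.2])
  rw [one_sub_mixture hk hl]
  refine map_normalChiChi_Iic (measurable_ratio _) hk hl ?_
  intro u v hu hv
  have hv' := Real.sqrt_pos.2 hv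
  have h : {z : ℝ | (√(1 - ρ ^ 2) * z + ρ * √u) / √v ≤ q} =
      Iic (-(ρ / √(1 - ρ ^ 2)) * √u - -(q / √(1 - ρ ^ 2)) * √v) := by
    ext z
    have : -(ρ / √(1 - ρ ^ 2)) * √u - -(q / √(1 - ρ ^ 2)) * √v =
        (q * √v - ρ * √u) / √(1 - ρ ^ 2) := by
      field_simp
      ring
    rw [mem_ofPred_eq, this, div_le_iff₀ hv', mem_Iic, le_div_iff₀ hw]
    constructor <;> intro h <;> linarith
  rw [h, gaussianReal_Iic]

lemma mixture_quantile_yStarLaw {n : ℕ} {a b : ℝ} (ha : a < n) (hb : b < n) (r : ℝ) {p : ℝ}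
    (hp : p ∈ Ioo (0 : ℝ) 1) :
    mixture (n - a) (n - b) (quantile (yStarLaw n a b r) p) (r / √(1 - r ^ 2)) = p := by
  have hk := sub_pos.2 ha
  have hl := sub_pos.2 hb
  exact apply_quantile (F := fun y => mixture (n - a) (n - b) y (r / √(1 - r ^ 2)))
    (yStarLaw_Iic ha hb r) (strictMono_mixture hk hl _) (continuous_mixture_left hk hl _)
    (tendsto_mixture_atBot hk hl _) (tendsto_mixture_atTop hk hl _) hp

lemma mixture_quantile_ratioLaw (hk : 0 < k) (hl : 0 < l) {ρ : ℝ} (hρ : ρ ∈ Ioo (-1 : ℝ) 1)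
    {p : ℝ} (hp : p ∈ Ioo (0 : ℝ) 1) :
    mixture k l (ρ / √(1 - ρ ^ 2)) (quantile (ratioLaw ρ k l) p / √(1 - ρ ^ 2)) = 1 - p := by
  have hw : 0 < √(1 - ρ ^ 2) := Real.sqrt_pos.2 (by nlinarith [hρ.1, hρ.2])
  have h := apply_quantile
    (F := fun q => 1 - mixture k l (ρ / √(1 - ρ ^ 2)) (q / √(1 - ρ ^ 2)))
    (ratioLaw_Iic hk hl hρ) ?_ ?_ ?_ ?_ hp
  · linarith
  · intro q q' hq
    have := strictAnti_mixture hk hl (ρ / √(1 - ρ ^ 2)) (div_lt_div_of_pos_right hq hw)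
    simp only at this ⊢
    linarith
  · exact continuous_const.sub ((continuous_mixture_right hk hl _).comp (by fun_prop))
  · have := (tendsto_mixture_right_atBot hk hl (ρ / √(1 - ρ ^ 2))).comp
      (tendsto_id.atBot_div_const hw)
    simpa using this.const_sub 1
  · have := (tendsto_mixture_right_atTop hk hl (ρ / √(1 - ρ ^ 2))).comp
      (tendsto_id.atTop_div_const hw)
    simpa using this.const_sub 1

end

/-! ### One-dimensional changes of variables -/

lemma lintegral_exp_neg_mul_sub_sq {b : ℝ} (hb : 0 < b) (c : ℝ) :
    ∫⁻ x, ENNReal.ofReal (Real.exp (-b * (x - c) ^ 2)) = ENNReal.ofReal √(Real.pi / b) := by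
  rw [lintegral_sub_right_eq_self (fun x => ENNReal.ofReal (Real.exp (-b * x ^ 2))) c,
    ← integral_gaussian, ofReal_integral_eq_lintegral_ofReal (integrable_exp_neg_mul_sq hb)
      (ae_of_all _ fun x => (Real.exp_pos _).le)]

lemma lintegral_chiSquared (k : ℝ) {g : ℝ → ENNReal} (hg : Measurable g) :
    ∫⁻ u, g u ∂chiSquared k = ∫⁻ u in Ioi 0,
      ENNReal.ofReal ((1 / 2) ^ (k / 2) / Real.Gamma (k / 2) * u ^ (k / 2 - 1) *
        Real.exp (-(1 / 2 * u))) * g u := by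
  have hm : Measurable (gammaPDF (k / 2) (1 / 2)) :=
    (measurable_gammaPDFReal _ _).ennreal_ofReal
  have h0 : ∫⁻ u, g u ∂chiSquared k = ∫⁻ u in Ioi 0, g u ∂chiSquared k := by
    rw [Measure.restrict_eq_self_of_ae_mem (s := Ioi (0 : ℝ)) (ae_pos_chiSquared k)]
  rw [h0, chiSquared, gammaMeasure, restrict_withDensity measurableSet_Ioi,
    lintegral_withDensity_eq_lintegral_mul _ hm hg]
  refine setLIntegral_congr_fun measurableSet_Ioi fun u hu => ?_
  rw [Pi.mul_apply, gammaPDF_of_nonneg (le_of_lt hu)]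

/-- If `σ` has the density `σ ^ (-(k + 1)) exp (-A / (2 σ²))`, up to a constant, then `A / σ²` is
chi-squared with `k` degrees of freedom. -/
lemma lintegral_inverse_chi {k A : ℝ} (hk : 0 < k) (hA : 0 < A) {g : ℝ → ENNReal}
    (hg : Measurable g) :
    ∫⁻ σ in Ioi 0, ENNReal.ofReal (σ ^ (-(k + 1)) * Real.exp (-(A / σ ^ 2) / 2)) * g (A / σ ^ 2) =
      ENNReal.ofReal (1 / 2 * A ^ (-(k / 2)) * 2 ^ (k / 2) * Real.Gamma (k / 2)) *
        ∫⁻ u, g u ∂chiSquared k := by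
  have hΓ := Real.Gamma_pos_of_pos (half_pos hk)
  have himg : (fun u : ℝ => (A / u) ^ (1 / 2 : ℝ)) '' Ioi 0 = Ioi 0 := by
    ext σ
    simp only [mem_image, mem_Ioi]
    constructor
    · rintro ⟨u, hu, rfl⟩
      positivity
    · intro hσ
      refine ⟨A / σ ^ 2, by positivity, ?_⟩
      rw [div_div_cancel₀ hA.ne', ← Real.sqrt_eq_rpow, Real.sqrt_sq hσ.le]
  have hsq : ∀ u : ℝ, 0 < u → A / ((A / u) ^ (1 / 2 : ℝ)) ^ 2 = u := fun u hu => by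
    rw [← Real.sqrt_eq_rpow, Real.sq_sqrt (by positivity), div_div_cancel₀ hA.ne']
  have hd : ∀ u ∈ Ioi (0 : ℝ), HasDerivWithinAt (fun u : ℝ => (A / u) ^ (1 / 2 : ℝ))
      (-(A / u ^ 2) * (1 / 2) * (A / u) ^ (1 / 2 - 1 : ℝ)) (Ioi 0) u := fun u hu => by
    have hu' : u ≠ 0 := ne_of_gt hu
    have h1 : HasDerivAt (fun u : ℝ => A / u) (-(A / u ^ 2)) u :=
      ((hasDerivAt_inv hu').const_mul A).congr_deriv (by ring)
    exact (h1.rpow_const (Or.inl (div_pos hA hu).ne')).hasDerivWithinAt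
  have hinj : InjOn (fun u : ℝ => (A / u) ^ (1 / 2 : ℝ)) (Ioi 0) := fun u hu v hv h => by
    have h' : (A / u) ^ (1 / 2 : ℝ) = (A / v) ^ (1 / 2 : ℝ) := h
    rw [← hsq u hu, ← hsq v hv, h']
  rw [lintegral_chiSquared k hg, ← lintegral_const_mul' _ _ ENNReal.ofReal_ne_top]
  conv_lhs => rw [← himg]
  rw [lintegral_image_eq_lintegral_abs_deriv_mul measurableSet_Ioi hd hinj]
  refine setLIntegral_congr_fun measurableSet_Ioi fun u (hu : 0 < u) => ?_
  rw [hsq u hu, ← mul_assoc, ← mul_assoc, ← ENNReal.ofReal_mul (abs_nonneg _),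
    ← ENNReal.ofReal_mul (by positivity)]
  congr 2
  have hAu : 0 < A / u := div_pos hA hu
  have e1 : |-(A / u ^ 2) * (1 / 2) * (A / u) ^ (1 / 2 - 1 : ℝ)| =
      A / u ^ 2 * (1 / 2) * (A / u) ^ (1 / 2 - 1 : ℝ) := by
    rw [neg_mul, neg_mul, abs_neg, abs_of_pos (by positivity)]
  have e2 : A / u ^ 2 = (A / u) * u⁻¹ := by
    field_simp
  have e3 : Real.exp (-u / 2) = Real.exp (-(1 / 2 * u)) := by
    congr 1
    ring
  have e4 : (A / u) * (A / u) ^ (1 / 2 - 1 : ℝ) * ((A / u) ^ (1 / 2 : ℝ)) ^ (-(k + 1)) =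
      A ^ (-(k / 2)) * u ^ (k / 2) := by
    have : (A / u) * (A / u) ^ (1 / 2 - 1 : ℝ) * ((A / u) ^ (1 / 2 : ℝ)) ^ (-(k + 1)) =
        (A / u) ^ (-(k / 2)) := by
      rw [← Real.rpow_mul hAu.le]
      nth_rewrite 1 [← Real.rpow_one (A / u)]
      rw [← Real.rpow_add hAu, ← Real.rpow_add hAu]
      congr 1
      ring
    rw [this, Real.div_rpow hA.le hu.le, Real.rpow_neg hu.le]
    field_simp
  have e5 : u ^ (k / 2 - 1) = u ^ (k / 2) * u⁻¹ := by
    rw [Real.rpow_sub_one hu.ne', div_eq_mul_inv]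
  have e6 : (1 / 2 : ℝ) ^ (k / 2) * 2 ^ (k / 2) = 1 := by
    rw [← Real.mul_rpow (by norm_num) (by norm_num)]
    norm_num
  rw [e1, e2, e3, e5]
  calc A / u * u⁻¹ * (1 / 2) * (A / u) ^ (1 / 2 - 1 : ℝ) *
        (((A / u) ^ (1 / 2 : ℝ)) ^ (-(k + 1)) * Real.exp (-(1 / 2 * u)))
      = (1 / 2) * u⁻¹ * Real.exp (-(1 / 2 * u)) * ((A / u) * (A / u) ^ (1 / 2 - 1 : ℝ) *
        ((A / u) ^ (1 / 2 : ℝ)) ^ (-(k + 1))) := by ring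
    _ = (1 / 2) * u⁻¹ * Real.exp (-(1 / 2 * u)) * (A ^ (-(k / 2)) * u ^ (k / 2)) *
        ((1 / 2 : ℝ) ^ (k / 2) * 2 ^ (k / 2)) := by rw [e4, e6, mul_one]
    _ = _ := by
      field_simp

lemma one_sub_sq_pos {ρ : ℝ} (hρ : ρ ∈ Ioo (-1 : ℝ) 1) : 0 < 1 - ρ ^ 2 := by
  nlinarith [hρ.1, hρ.2]

lemma psi_div_sqrt {ρ : ℝ} (hρ : ρ ∈ Ioo (-1 : ℝ) 1) : psi (ρ / √(1 - ρ ^ 2)) = ρ := by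
  have h := one_sub_sq_pos hρ
  have h1 : 1 + (ρ / √(1 - ρ ^ 2)) ^ 2 = (1 - ρ ^ 2)⁻¹ := by
    rw [div_pow, Real.sq_sqrt h.le]
    field_simp
    ring
  rw [psi, h1, Real.sqrt_inv]
  have := Real.sqrt_pos.2 h
  field_simp

lemma psi_mem_Ioo (y : ℝ) : psi y ∈ Ioo (-1 : ℝ) 1 := by
  have h : 0 < √(1 + y ^ 2) := Real.sqrt_pos.2 (by positivity)
  have h1 : |y| < √(1 + y ^ 2) := by
    rw [← Real.sqrt_sq_eq_abs]
    exact Real.sqrt_lt_sqrt (sq_nonneg _) (by linarith)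
  rw [psi, mem_Ioo, lt_div_iff₀ h, div_lt_iff₀ h]
  have := abs_lt.1 h1
  constructor <;> linarith

lemma psi_div_sqrt_one_sub_sq (y : ℝ) : psi y / √(1 - psi y ^ 2) = y := by
  have h : 0 < 1 + y ^ 2 := by positivity
  have h' := Real.sqrt_pos.2 h
  have h1 : 1 - psi y ^ 2 = (1 + y ^ 2)⁻¹ := by
    rw [psi, div_pow, Real.sq_sqrt h.le]
    field_simp
    ring
  rw [h1, Real.sqrt_inv, psi]
  field_simp

lemma strictMono_psi : StrictMono psi := by
  have key : ∀ ρ ∈ Ioo (-1 : ℝ) 1, ∀ ρ' ∈ Ioo (-1 : ℝ) 1, 0 ≤ ρ → ρ ≤ ρ' →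
      ρ / √(1 - ρ ^ 2) ≤ ρ' / √(1 - ρ' ^ 2) := by
    intro ρ h ρ' h' h0 hle
    have p' := Real.sqrt_pos.2 (one_sub_sq_pos h')
    have : √(1 - ρ' ^ 2) ≤ √(1 - ρ ^ 2) := Real.sqrt_le_sqrt (by nlinarith)
    exact div_le_div₀ (h0.trans hle) hle p' this
  have hinv : MonotoneOn (fun ρ : ℝ => ρ / √(1 - ρ ^ 2)) (Ioo (-1) 1) := by
    intro ρ h ρ' h' hle
    rcases le_total 0 ρ with h0 | h0
    · exact key ρ h ρ' h' h0 hle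
    rcases le_total 0 ρ' with h1 | h1
    · exact (div_nonpos_of_nonpos_of_nonneg h0 (Real.sqrt_nonneg _)).trans
        (div_nonneg h1 (Real.sqrt_nonneg _))
    · have := key (-ρ') ⟨by linarith [h'.2], by linarith [h'.1]⟩ (-ρ)
        ⟨by linarith [h.2], by linarith [h.1]⟩ (by linarith) (by linarith)
      simp only [even_two.neg_pow, neg_div] at this
      simp only
      linarith
  intro y y' hlt
  by_contra! hcon
  have := hinv (psi_mem_Ioo y') (psi_mem_Ioo y) hcon
  simp only [psi_div_sqrt_one_sub_sq] at this
  linarith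

lemma continuous_psi : Continuous psi := by
  unfold psi
  refine continuous_id.div (by fun_prop) fun y => ?_
  have : 0 < 1 + y ^ 2 := by positivity
  positivity

lemma psi_le_iff {ρ y : ℝ} (hρ : ρ ∈ Ioo (-1 : ℝ) 1) : psi y ≤ ρ ↔ y ≤ ρ / √(1 - ρ ^ 2) := by
  conv_lhs => rw [← psi_div_sqrt hρ]
  exact strictMono_psi.le_iff_le

/-- The substitution `y = ρ / √(1 - ρ²)`. -/
lemma lintegral_comp_div_sqrt (g : ℝ → ENNReal) :
    ∫⁻ ρ in Ioo (-1 : ℝ) 1, ENNReal.ofReal ((√(1 - ρ ^ 2) ^ 3)⁻¹) * g (ρ / √(1 - ρ ^ 2)) =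
      ∫⁻ y, g y := by
  have himg : (fun ρ : ℝ => ρ / √(1 - ρ ^ 2)) '' Ioo (-1) 1 = univ := by
    refine eq_univ_of_forall fun y => ⟨psi y, psi_mem_Ioo y, psi_div_sqrt_one_sub_sq y⟩
  have hinj : InjOn (fun ρ : ℝ => ρ / √(1 - ρ ^ 2)) (Ioo (-1) 1) := fun ρ h ρ' h' he => by
    rw [← psi_div_sqrt h, ← psi_div_sqrt h']
    exact congrArg psi he
  have hd : ∀ ρ ∈ Ioo (-1 : ℝ) 1, HasDerivWithinAt (fun ρ : ℝ => ρ / √(1 - ρ ^ 2))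
      ((√(1 - ρ ^ 2) ^ 3)⁻¹) (Ioo (-1) 1) ρ := fun ρ h => by
    have hp := one_sub_sq_pos h
    have hw := Real.sqrt_pos.2 hp
    have h1 : HasDerivAt (fun ρ : ℝ => √(1 - ρ ^ 2)) (-(2 * ρ) / (2 * √(1 - ρ ^ 2))) ρ := by
      refine HasDerivAt.sqrt ?_ hp.ne'
      exact ((hasDerivAt_pow 2 ρ).const_sub 1).congr_deriv (by simp)
    refine (((hasDerivAt_id ρ).div h1 hw.ne').congr_deriv ?_).hasDerivWithinAt
    simp only [id]
    have h2 : √(1 - ρ ^ 2) ^ 2 = 1 - ρ ^ 2 := Real.sq_sqrt hp.le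
    field_simp
    rw [h2]
    ring
  rw [← setLIntegral_univ g, ← himg,
    lintegral_image_eq_lintegral_abs_deriv_mul measurableSet_Ioo hd hinj]
  refine setLIntegral_congr_fun measurableSet_Ioo fun ρ h => ?_
  have hw := Real.sqrt_pos.2 (one_sub_sq_pos h)
  rw [abs_of_pos (by positivity)]

/-! ### The density of `Y*` -/

/-- The density of `(t √v - Z) / √u` at `y`, without the factor `(2π)^(-1/2)`. -/
def yStarKernel (t y : ℝ) (p : ℝ × ℝ) : ℝ :=
  √p.1 * Real.exp (-(y * √p.1 - t * √p.2) ^ 2 / 2)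

lemma lintegral_affine {c : ℝ} (hc : c ≠ 0) (d : ℝ) (g : ℝ → ENNReal) :
    ∫⁻ z, g z = ENNReal.ofReal |c| * ∫⁻ y, g (d + c * y) := by
  have hd : ∀ y ∈ (univ : Set ℝ), HasDerivWithinAt (fun y : ℝ => d + c * y) c univ y :=
    fun y _ => (((hasDerivAt_id y).const_mul c).const_add d).congr_deriv (by simp)
      |>.hasDerivWithinAt
  have hinj : InjOn (fun y : ℝ => d + c * y) univ := fun y _ y' _ h => by
    simpa [hc] using h
  have himg : (fun y : ℝ => d + c * y) '' univ = univ :=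
    eq_univ_of_forall fun z => ⟨(z - d) / c, mem_univ _, by field_simp; ring⟩
  rw [← setLIntegral_univ, ← himg,
    lintegral_image_eq_lintegral_abs_deriv_mul MeasurableSet.univ hd hinj, setLIntegral_univ,
    lintegral_const_mul' _ _ ENNReal.ofReal_ne_top]

lemma measurable_yStarKernel (t : ℝ) :
    Measurable fun q : ℝ × ℝ × ℝ => yStarKernel t q.1 q.2 := by
  unfold yStarKernel
  fun_prop

/-- Given the two chi-squared variables, `Y*` is normal; its density is the average of
`yStarKernel` over them. -/
lemma lintegral_yStarLaw {n : ℕ} {a b : ℝ} (r : ℝ)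
    {g : ℝ → ENNReal} (hg : Measurable g) :
    ∫⁻ y, g y ∂yStarLaw n a b r = ENNReal.ofReal (√(2 * Real.pi))⁻¹ *
      ∫⁻ y, g y * ∫⁻ p, ENNReal.ofReal (yStarKernel (r / √(1 - r ^ 2)) y p)
        ∂(chiSquared (n - a)).prod (chiSquared (n - b)) := by
  set t := r / √(1 - r ^ 2)
  set ν := (chiSquared (n - a)).prod (chiSquared (n - b))
  have hK := measurable_yStarKernel t
  have h1 : ∫⁻ y, g y * ∫⁻ p, ENNReal.ofReal (yStarKernel t y p) ∂ν =
      ∫⁻ p, ∫⁻ y, g y * ENNReal.ofReal (yStarKernel t y p) ∂volume ∂ν := by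
    rw [← lintegral_lintegral_swap
      (((hg.comp measurable_fst).mul hK.ennreal_ofReal).aemeasurable)]
    refine lintegral_congr fun y => ?_
    rw [lintegral_const_mul]
    exact (hK.comp measurable_prodMk_left).ennreal_ofReal
  rw [h1, ← lintegral_const_mul' _ _ ENNReal.ofReal_ne_top, yStarLaw,
    lintegral_map hg (measurable_yStar t), normalChiChi]
  refine (lintegral_prod_symm _ (hg.comp (measurable_yStar t)).aemeasurable).trans ?_
  refine lintegral_congr_ae ((ae_pos_chiSquared_prod _ _).mono fun p hp => ?_)
  have hu := Real.sqrt_pos.2 hp.1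
  have hm : Measurable fun z : ℝ => g (-z / √p.1 + √p.2 / √p.1 * t) := hg.comp (by fun_prop)
  change ∫⁻ z, g (-z / √p.1 + √p.2 / √p.1 * t) ∂gaussianReal 0 1 =
    ENNReal.ofReal (√(2 * Real.pi))⁻¹ * ∫⁻ y, g y * ENNReal.ofReal (yStarKernel t y p)
  rw [gaussianReal_of_var_ne_zero _ one_ne_zero,
    lintegral_withDensity_eq_lintegral_mul _ (measurable_gaussianPDF 0 1) hm,
    lintegral_affine (neg_ne_zero.2 hu.ne') (t * √p.2), abs_neg, abs_of_pos hu,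
    ← lintegral_const_mul' _ _ ENNReal.ofReal_ne_top,
    ← lintegral_const_mul' _ _ ENNReal.ofReal_ne_top]
  refine lintegral_congr fun y => ?_
  have e : -(t * √p.2 + -√p.1 * y) / √p.1 + √p.2 / √p.1 * t = y := by
    field_simp
    ring
  simp only [Pi.mul_apply, e]
  rw [gaussianPDF, ← mul_assoc, ← ENNReal.ofReal_mul hu.le, mul_comm (g y), ← mul_assoc,
    ← ENNReal.ofReal_mul (by positivity)]
  congr 2
  rw [gaussianPDFReal, yStarKernel]
  simp only [NNReal.coe_one, mul_one, sub_zero]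
  rw [show -(t * √p.2 + -√p.1 * y) ^ 2 = -(y * √p.1 - t * √p.2) ^ 2 by ring]
  ring

/-! ### The marginal posterior of the correlation -/

section

variable {n : ℕ}

lemma sum_sub_sq₁ (hn : n ≠ 0) (x : Fin n → ℝ × ℝ) (μ : ℝ) :
    ∑ k, ((x k).1 - μ) ^ 2 = s₁₁ x + n * (mean₁ x - μ) ^ 2 := by
  have hn' : (n : ℝ) ≠ 0 := Nat.cast_ne_zero.2 hn
  have h : ∑ k, (x k).1 = n * mean₁ x := by
    rw [mean₁]
    field_simp
  have e : ∀ k, ((x k).1 - μ) ^ 2 = ((x k).1 - mean₁ x) ^ 2 +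
      2 * (mean₁ x - μ) * (x k).1 + (μ ^ 2 - mean₁ x ^ 2) := fun k => by ring
  simp_rw [e, Finset.sum_add_distrib, ← Finset.mul_sum, h, s₁₁]
  simp
  ring

lemma sum_sub_sq₂ (hn : n ≠ 0) (x : Fin n → ℝ × ℝ) (μ : ℝ) :
    ∑ k, ((x k).2 - μ) ^ 2 = s₂₂ x + n * (mean₂ x - μ) ^ 2 := by
  have hn' : (n : ℝ) ≠ 0 := Nat.cast_ne_zero.2 hn
  have h : ∑ k, (x k).2 = n * mean₂ x := by
    rw [mean₂]
    field_simp
  have e : ∀ k, ((x k).2 - μ) ^ 2 = ((x k).2 - mean₂ x) ^ 2 +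
      2 * (mean₂ x - μ) * (x k).2 + (μ ^ 2 - mean₂ x ^ 2) := fun k => by ring
  simp_rw [e, Finset.sum_add_distrib, ← Finset.mul_sum, h, s₂₂]
  simp
  ring

lemma sum_sub_mul_sub (hn : n ≠ 0) (x : Fin n → ℝ × ℝ) (μ₁ μ₂ : ℝ) :
    ∑ k, ((x k).1 - μ₁) * ((x k).2 - μ₂) =
      s₁₂ x + n * (mean₁ x - μ₁) * (mean₂ x - μ₂) := by
  have hn' : (n : ℝ) ≠ 0 := Nat.cast_ne_zero.2 hn
  have h₁ : ∑ k, (x k).1 = n * mean₁ x := by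
    rw [mean₁]
    field_simp
  have h₂ : ∑ k, (x k).2 = n * mean₂ x := by
    rw [mean₂]
    field_simp
  have e : ∀ k, ((x k).1 - μ₁) * ((x k).2 - μ₂) =
      ((x k).1 - mean₁ x) * ((x k).2 - mean₂ x) + (mean₂ x - μ₂) * (x k).1 +
      (mean₁ x - μ₁) * (x k).2 + (μ₁ * μ₂ - mean₁ x * mean₂ x) := fun k => by ring
  simp_rw [e, Finset.sum_add_distrib, ← Finset.mul_sum, h₁, h₂, s₁₂]
  simp
  ring

/-- After completing the squares in both means, the likelihood is a product of inverse chi kernels in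
`σ₁` and `σ₂`, the kernel of the conditional law of `Y*` given the chi-squared variables
`s₁₁ / σ₁²` and `s₂₂ (1 - r²) / ((1 - ρ²) σ₂²)`, and Gaussian kernels in the means. -/
lemma likelihood_eq (hn : n ≠ 0) {x : Fin n → ℝ × ℝ} (hx : Nondegenerate x)
    {σ₁ σ₂ ρ : ℝ} (h₁ : 0 < σ₁) (h₂ : 0 < σ₂) (hρ : ρ ∈ Ioo (-1 : ℝ) 1) (μ₁ μ₂ : ℝ) :
    likelihood x (μ₁, μ₂, σ₁, σ₂, ρ) =
      ((2 * Real.pi * σ₁ * σ₂ * √(1 - ρ ^ 2)) ^ n)⁻¹ *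
      (Real.exp (-(s₁₁ x / σ₁ ^ 2) / 2) *
        Real.exp (-(s₂₂ x * (1 - sampleCorr x ^ 2) / √(1 - ρ ^ 2) ^ 2 / σ₂ ^ 2) / 2) *
        Real.exp (-(ρ / √(1 - ρ ^ 2) * √(s₁₁ x / σ₁ ^ 2) -
          sampleCorr x / √(1 - sampleCorr x ^ 2) *
            √(s₂₂ x * (1 - sampleCorr x ^ 2) / √(1 - ρ ^ 2) ^ 2 / σ₂ ^ 2)) ^ 2 / 2)) *
      (Real.exp (-(n / (2 * σ₁ ^ 2)) * (μ₁ - mean₁ x) ^ 2) *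
        Real.exp (-(n / (2 * (√(1 - ρ ^ 2) * σ₂) ^ 2)) *
          (μ₂ - (mean₂ x + ρ * σ₂ / σ₁ * (μ₁ - mean₁ x))) ^ 2)) := by
  obtain ⟨hs1, hs2, hr⟩ := hx
  have hr' : sampleCorr x ∈ Ioo (-1 : ℝ) 1 := abs_lt.1 hr
  have hw := Real.sqrt_pos.2 (one_sub_sq_pos hρ)
  have hv := Real.sqrt_pos.2 (one_sub_sq_pos hr')
  have hw2 := Real.sq_sqrt (one_sub_sq_pos hρ).le
  have hv2 := Real.sq_sqrt (one_sub_sq_pos hr').le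
  have hP := Real.sqrt_pos.2 hs1
  have hS := Real.sqrt_pos.2 hs2
  have hP2 := Real.sq_sqrt hs1.le
  have hS2 := Real.sq_sqrt hs2.le
  have hs12 : s₁₂ x = sampleCorr x * √(s₁₁ x) * √(s₂₂ x) := by
    rw [sampleCorr, Real.sqrt_mul hs1.le]
    field_simp
  rw [likelihood]
  simp only [normalPDF]
  rw [Finset.prod_mul_distrib, Finset.prod_const, Finset.card_univ, Fintype.card_fin,
    ← Real.exp_sum, one_div, inv_pow, mul_assoc _ (_ * _ * _) _, ← Real.exp_add, ← Real.exp_add,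
    ← Real.exp_add, ← Real.exp_add]
  congr 2
  rw [← Finset.sum_div, Finset.sum_neg_distrib, Finset.sum_sub_distrib, Finset.sum_add_distrib]
  have e : ∀ k, 2 * ρ * σ₁ * σ₂ * ((x k).1 - μ₁) * ((x k).2 - μ₂) =
    2 * ρ * σ₁ * σ₂ * (((x k).1 - μ₁) * ((x k).2 - μ₂)) := fun k => by ring
  simp_rw [e, ← Finset.mul_sum, sum_sub_sq₁ hn, sum_sub_sq₂ hn, sum_sub_mul_sub hn]
  rw [Real.sqrt_div hs1.le, Real.sqrt_sq h₁.le,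
    Real.sqrt_div (by have := one_sub_sq_pos hr'; positivity), Real.sqrt_sq h₂.le,
    Real.sqrt_div (by have := one_sub_sq_pos hr'; positivity), Real.sqrt_sq hw.le,
    Real.sqrt_mul hs2.le, hs12, ← hw2, ← hv2]
  generalize √(1 - ρ ^ 2) = w at *
  generalize √(1 - sampleCorr x ^ 2) = v at *
  generalize mean₁ x = m₁ at *
  generalize mean₂ x = m₂ at *
  generalize sampleCorr x = r at *
  rw [← hP2, ← hS2]
  generalize √(s₁₁ x) = P at *
  generalize √(s₂₂ x) = S at *
  have hvv : v ^ 2 = 1 - r ^ 2 := hv2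
  rw [Real.sqrt_sq hP.le, Real.sqrt_sq hS.le, Real.sqrt_sq hw.le, Real.sqrt_sq hv.le]
  have e2 : r / v * (S * v / w / σ₂) = r * S / w / σ₂ := by
    field_simp
  rw [e2, hvv]
  have hρ2 : ρ ^ 2 = 1 - w ^ 2 := by linarith
  field_simp
  ring_nf
  rw [hρ2]
  ring

lemma lintegral_prod_prod_symm {α β γ : Type*} [MeasurableSpace α] [MeasurableSpace β]
    [MeasurableSpace γ] {μ : Measure α} {ν : Measure β} {τ : Measure γ} [SFinite μ] [SFinite ν]
    [SFinite τ] {F : α × β × γ → ENNReal} (hF : Measurable F) :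
    ∫⁻ θ, F θ ∂μ.prod (ν.prod τ) = ∫⁻ z, ∫⁻ y, ∫⁻ x, F (x, y, z) ∂μ ∂ν ∂τ := by
  rw [lintegral_prod_symm' _ hF, lintegral_prod_symm' _ hF.lintegral_prod_left']

lemma sqrt_pi_div {n : ℕ} (hn : n ≠ 0) {σ : ℝ} (hσ : 0 < σ) :
    √(Real.pi / (n / (2 * σ ^ 2))) = √(2 * Real.pi / n) * σ := by
  have hn' : (0 : ℝ) < n := Nat.cast_pos.2 (Nat.pos_of_ne_zero hn)
  rw [show Real.pi / (n / (2 * σ ^ 2)) = 2 * Real.pi / n * σ ^ 2 by field_simp,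
    Real.sqrt_mul (by positivity), Real.sqrt_sq hσ.le]

/-- Integrating the two means out of the likelihood. -/
lemma lintegral_likelihood (hn : n ≠ 0) {x : Fin n → ℝ × ℝ} (hx : Nondegenerate x)
    {σ₁ σ₂ ρ : ℝ} (h₁ : 0 < σ₁) (h₂ : 0 < σ₂) (hρ : ρ ∈ Ioo (-1 : ℝ) 1) :
    ∫⁻ μ₂, ∫⁻ μ₁, ENNReal.ofReal (likelihood x (μ₁, μ₂, σ₁, σ₂, ρ)) =
      ENNReal.ofReal (((2 * Real.pi * σ₁ * σ₂ * √(1 - ρ ^ 2)) ^ n)⁻¹ *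
      (Real.exp (-(s₁₁ x / σ₁ ^ 2) / 2) *
        Real.exp (-(s₂₂ x * (1 - sampleCorr x ^ 2) / √(1 - ρ ^ 2) ^ 2 / σ₂ ^ 2) / 2) *
        Real.exp (-(ρ / √(1 - ρ ^ 2) * √(s₁₁ x / σ₁ ^ 2) -
          sampleCorr x / √(1 - sampleCorr x ^ 2) *
            √(s₂₂ x * (1 - sampleCorr x ^ 2) / √(1 - ρ ^ 2) ^ 2 / σ₂ ^ 2)) ^ 2 / 2)) *
      (2 * Real.pi / n * (σ₁ * (√(1 - ρ ^ 2) * σ₂)))) := by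
  have hw := Real.sqrt_pos.2 (one_sub_sq_pos hρ)
  have hn' : (0 : ℝ) < n := Nat.cast_pos.2 (Nat.pos_of_ne_zero hn)
  simp_rw [likelihood_eq hn hx h₁ h₂ hρ]
  generalize hC : ((2 * Real.pi * σ₁ * σ₂ * √(1 - ρ ^ 2)) ^ n)⁻¹ *
      (Real.exp (-(s₁₁ x / σ₁ ^ 2) / 2) *
        Real.exp (-(s₂₂ x * (1 - sampleCorr x ^ 2) / √(1 - ρ ^ 2) ^ 2 / σ₂ ^ 2) / 2) *
        Real.exp (-(ρ / √(1 - ρ ^ 2) * √(s₁₁ x / σ₁ ^ 2) -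
          sampleCorr x / √(1 - sampleCorr x ^ 2) *
            √(s₂₂ x * (1 - sampleCorr x ^ 2) / √(1 - ρ ^ 2) ^ 2 / σ₂ ^ 2)) ^ 2 / 2)) = C
  have hC0 : 0 ≤ C := by
    rw [← hC]
    positivity
  rw [lintegral_lintegral_swap (Measurable.aemeasurable (by fun_prop))]
  simp_rw [ENNReal.ofReal_mul hC0, ENNReal.ofReal_mul (Real.exp_pos _).le,
    lintegral_const_mul' _ _ ENNReal.ofReal_ne_top]
  simp_rw [lintegral_exp_neg_mul_sub_sq (b := n / (2 * (√(1 - ρ ^ 2) * σ₂) ^ 2)) (by positivity)]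
  rw [lintegral_mul_const' _ _ ENNReal.ofReal_ne_top,
    lintegral_exp_neg_mul_sub_sq (by positivity), ← ENNReal.ofReal_mul (Real.sqrt_nonneg _),
    sqrt_pi_div hn h₁, sqrt_pi_div hn (mul_pos hw h₂)]
  congr 2
  have := Real.mul_self_sqrt (show 0 ≤ 2 * Real.pi / n by positivity)
  nth_rewrite 3 [← this]
  ring

/-- The marginal of prior times likelihood in `(σ₁, σ₂, ρ)`, in a form suited to
`lintegral_inverse_chi` in `σ₁` and then in `σ₂`. -/
lemma prior_mul_marginal (hn : n ≠ 0) (a b : ℝ) {x : Fin n → ℝ × ℝ} (hx : Nondegenerate x)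
    {σ₁ σ₂ ρ : ℝ} (h₁ : 0 < σ₁) (h₂ : 0 < σ₂) (hρ : ρ ∈ Ioo (-1 : ℝ) 1) :
    ∫⁻ μ₂, ∫⁻ μ₁, ENNReal.ofReal (prior a b (μ₁, μ₂, σ₁, σ₂, ρ) *
        likelihood x (μ₁, μ₂, σ₁, σ₂, ρ)) =
      ENNReal.ofReal (((2 * Real.pi) ^ n)⁻¹ * (2 * Real.pi / n) / √(s₁₁ x) *
        √(1 - ρ ^ 2) ^ (-3 - (n - b))) *
      (ENNReal.ofReal (σ₂ ^ (-((n - b) + 1)) *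
        Real.exp (-(s₂₂ x * (1 - sampleCorr x ^ 2) / √(1 - ρ ^ 2) ^ 2 / σ₂ ^ 2) / 2)) *
      (ENNReal.ofReal (σ₁ ^ (-((n - a) + 1)) * Real.exp (-(s₁₁ x / σ₁ ^ 2) / 2)) *
      ENNReal.ofReal (yStarKernel (sampleCorr x / √(1 - sampleCorr x ^ 2)) (ρ / √(1 - ρ ^ 2))
        (s₁₁ x / σ₁ ^ 2, s₂₂ x * (1 - sampleCorr x ^ 2) / √(1 - ρ ^ 2) ^ 2 / σ₂ ^ 2)))) := by
  have hw := Real.sqrt_pos.2 (one_sub_sq_pos hρ)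
  have hs := Real.sqrt_pos.2 hx.1
  have hn' : (0 : ℝ) < n := Nat.cast_pos.2 (Nat.pos_of_ne_zero hn)
  have hp : 0 ≤ 1 / (σ₁ ^ (3 - a) * σ₂ ^ (2 - b) * (1 - ρ ^ 2) ^ (2 - b / 2)) := by
    have := one_sub_sq_pos hρ
    positivity
  simp only [prior]
  simp_rw [ENNReal.ofReal_mul hp, lintegral_const_mul' _ _ ENNReal.ofReal_ne_top]
  rw [lintegral_likelihood hn hx h₁ h₂ hρ, ← ENNReal.ofReal_mul hp,
    ← ENNReal.ofReal_mul (by positivity), ← ENNReal.ofReal_mul (by positivity),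
    ← ENNReal.ofReal_mul (by positivity)]
  congr 1
  have e1 : σ₁ ^ (-((n - a) + 1)) = (σ₁ ^ (3 - a))⁻¹ * (σ₁ ^ n)⁻¹ * σ₁ ^ 2 := by
    rw [← Real.rpow_natCast σ₁ n, ← Real.rpow_natCast σ₁ 2, ← Real.rpow_neg h₁.le,
      ← Real.rpow_neg h₁.le, ← Real.rpow_add h₁, ← Real.rpow_add h₁]
    congr 1
    push_cast
    ring
  have e2 : σ₂ ^ (-((n - b) + 1)) = (σ₂ ^ (2 - b))⁻¹ * (σ₂ ^ n)⁻¹ * σ₂ := by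
    conv_rhs => rw [← Real.rpow_natCast σ₂ n, ← Real.rpow_neg h₂.le,
      ← Real.rpow_neg h₂.le, ← Real.rpow_add h₂, ← Real.rpow_add_one h₂.ne']
    congr 1
    ring
  have e3 : √(1 - ρ ^ 2) ^ (-3 - (n - b)) =
      ((1 - ρ ^ 2) ^ (2 - b / 2))⁻¹ * (√(1 - ρ ^ 2) ^ n)⁻¹ * √(1 - ρ ^ 2) := by
    have : (1 - ρ ^ 2) ^ (2 - b / 2) = √(1 - ρ ^ 2) ^ (4 - b) := by
      rw [Real.sqrt_eq_rpow, ← Real.rpow_mul (one_sub_sq_pos hρ).le]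
      congr 1
      ring
    rw [this]
    generalize √(1 - ρ ^ 2) = w at hw
    conv_rhs => rw [← Real.rpow_natCast w n, ← Real.rpow_neg hw.le,
      ← Real.rpow_neg hw.le, ← Real.rpow_add hw, ← Real.rpow_add_one hw.ne']
    congr 1
    ring
  rw [e1, e2, e3, yStarKernel]
  have e4 : √(s₁₁ x / σ₁ ^ 2) = √(s₁₁ x) / σ₁ := by
    rw [Real.sqrt_div hx.1.le, Real.sqrt_sq h₁.le]
  rw [mul_pow, mul_pow, mul_pow _ σ₁]
  nth_rewrite 2 [e4]
  field_simp

lemma measurable_likelihood (x : Fin n → ℝ × ℝ) : Measurable (likelihood x) := by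
  unfold likelihood normalPDF
  fun_prop

lemma measurable_prior (a b : ℝ) : Measurable (prior a b) := by
  unfold prior
  fun_prop

lemma restrict_paramSpace : (volume : Measure (ℝ × ℝ × ℝ × ℝ × ℝ)).restrict paramSpace =
    (volume : Measure ℝ).prod ((volume : Measure ℝ).prod
      ((volume.restrict (Ioi (0 : ℝ))).prod ((volume.restrict (Ioi (0 : ℝ))).prod
        (volume.restrict (Ioo (-1 : ℝ) 1))))) := by
  have h : paramSpace = univ ×ˢ univ ×ˢ Ioi (0 : ℝ) ×ˢ Ioi (0 : ℝ) ×ˢ Ioo (-1 : ℝ) 1 := by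
    ext ⟨μ₁, μ₂, σ₁, σ₂, ρ⟩
    simp [paramSpace]
  rw [h, Measure.volume_eq_prod, ← Measure.prod_restrict, Measure.volume_eq_prod,
    ← Measure.prod_restrict, Measure.volume_eq_prod, ← Measure.prod_restrict,
    Measure.volume_eq_prod, ← Measure.prod_restrict, Measure.restrict_univ]

/-- The integral of prior times likelihood over the means and standard deviations, as a function of
`ρ`: the scales `s₁₁ / σ₁²` and `s₂₂ (1 - r²) / ((1 - ρ²) σ₂²)` become chi-squared variables. -/
lemma exists_lintegral_scales (hn : n ≠ 0) {a b : ℝ} (ha : a < n) (hb : b < n)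
    {x : Fin n → ℝ × ℝ} (hx : Nondegenerate x) :
    ∃ C : ℝ, 0 < C ∧ ∀ ρ ∈ Ioo (-1 : ℝ) 1,
      ∫⁻ σ₂ in Ioi (0 : ℝ), ∫⁻ σ₁ in Ioi (0 : ℝ), ∫⁻ μ₂, ∫⁻ μ₁,
      ENNReal.ofReal (prior a b (μ₁, μ₂, σ₁, σ₂, ρ) * likelihood x (μ₁, μ₂, σ₁, σ₂, ρ)) =
      ENNReal.ofReal C * (ENNReal.ofReal ((√(1 - ρ ^ 2) ^ 3)⁻¹) *
        ∫⁻ p, ENNReal.ofReal (yStarKernel (sampleCorr x / √(1 - sampleCorr x ^ 2))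
          (ρ / √(1 - ρ ^ 2)) p) ∂(chiSquared (n - a)).prod (chiSquared (n - b))) := by
  have hk := sub_pos.2 ha
  have hl := sub_pos.2 hb
  have hr : sampleCorr x ∈ Ioo (-1 : ℝ) 1 := abs_lt.1 hx.2.2
  have hn' : (0 : ℝ) < n := Nat.cast_pos.2 (Nat.pos_of_ne_zero hn)
  have hs := Real.sqrt_pos.2 hx.1
  have hD : 0 < s₂₂ x * (1 - sampleCorr x ^ 2) := mul_pos hx.2.1 (one_sub_sq_pos hr)
  set D := s₂₂ x * (1 - sampleCorr x ^ 2) with hDdef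
  set t := sampleCorr x / √(1 - sampleCorr x ^ 2) with ht
  set K := ((2 * Real.pi) ^ n)⁻¹ * (2 * Real.pi / n) / √(s₁₁ x) with hK
  set K₁ := 1 / 2 * s₁₁ x ^ (-((n - a) / 2)) * 2 ^ ((n - a) / 2) * Real.Gamma ((n - a) / 2) with hK₁
  set K₂ := 1 / 2 * D ^ (-((n - b) / 2)) * 2 ^ ((n - b) / 2) * Real.Gamma ((n - b) / 2) with hK₂
  have hKp : 0 < K := by positivity
  have hK₁p : 0 < K₁ := by
    have := Real.Gamma_pos_of_pos (half_pos hk)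
    have := hx.1
    positivity
  have hK₂p : 0 < K₂ := by
    have := Real.Gamma_pos_of_pos (half_pos hl)
    positivity
  have hker := measurable_yStarKernel t
  refine ⟨K * K₁ * K₂, by positivity, fun ρ hρ => ?_⟩
  have hw := Real.sqrt_pos.2 (one_sub_sq_pos hρ)
  have hDw : 0 < D / √(1 - ρ ^ 2) ^ 2 := by positivity
  set y := ρ / √(1 - ρ ^ 2)
  have hkm : Measurable fun p : ℝ × ℝ => ENNReal.ofReal (yStarKernel t y p) :=
    (hker.comp measurable_prodMk_left).ennreal_ofReal
  have step : ∀ σ₂ ∈ Ioi (0 : ℝ), ∫⁻ σ₁ in Ioi (0 : ℝ), ∫⁻ μ₂, ∫⁻ μ₁,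
      ENNReal.ofReal (prior a b (μ₁, μ₂, σ₁, σ₂, ρ) * likelihood x (μ₁, μ₂, σ₁, σ₂, ρ)) =
      ENNReal.ofReal (K * √(1 - ρ ^ 2) ^ (-3 - (n - b)) * K₁) *
      (ENNReal.ofReal (σ₂ ^ (-((n - b) + 1)) *
        Real.exp (-(D / √(1 - ρ ^ 2) ^ 2 / σ₂ ^ 2) / 2)) *
        ∫⁻ u, ENNReal.ofReal (yStarKernel t y (u, D / √(1 - ρ ^ 2) ^ 2 / σ₂ ^ 2))
          ∂chiSquared (n - a)) := by
    intro σ₂ h₂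
    rw [setLIntegral_congr_fun measurableSet_Ioi
      (fun σ₁ h₁ => prior_mul_marginal hn a b hx h₁ h₂ hρ),
      lintegral_const_mul' _ _ ENNReal.ofReal_ne_top,
      lintegral_const_mul' _ _ ENNReal.ofReal_ne_top,
      lintegral_inverse_chi (g := fun u =>
        ENNReal.ofReal (yStarKernel t y (u, D / √(1 - ρ ^ 2) ^ 2 / σ₂ ^ 2))) hk hx.1
        (hkm.comp measurable_prodMk_right),
      ENNReal.ofReal_mul (q := K₁) (by positivity)]
    ring
  rw [setLIntegral_congr_fun measurableSet_Ioi step,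
    lintegral_const_mul' _ _ ENNReal.ofReal_ne_top,
    lintegral_inverse_chi (g := fun v => ∫⁻ u, ENNReal.ofReal (yStarKernel t y (u, v))
      ∂chiSquared (n - a)) hl hDw hkm.lintegral_prod_left', lintegral_prod_symm' _ hkm,
    ← mul_assoc (ENNReal.ofReal _) (ENNReal.ofReal _) (lintegral _ _),
    ← mul_assoc (ENNReal.ofReal _) (ENNReal.ofReal _) (lintegral _ _),
    ← ENNReal.ofReal_mul (by positivity), ← ENNReal.ofReal_mul (by positivity)]
  congr 2
  have e : (D / √(1 - ρ ^ 2) ^ 2) ^ (-((n - b) / 2)) =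
      D ^ (-((n - b) / 2)) * √(1 - ρ ^ 2) ^ (n - b) := by
    rw [Real.div_rpow hD.le (by positivity), ← Real.rpow_natCast, ← Real.rpow_mul hw.le,
      div_eq_mul_inv, ← Real.rpow_neg hw.le]
    congr 2
    push_cast
    ring
  have e2 : √(1 - ρ ^ 2) ^ (-3 - (n - b)) * √(1 - ρ ^ 2) ^ (n - b) = (√(1 - ρ ^ 2) ^ 3)⁻¹ := by
    rw [← Real.rpow_add hw, ← Real.rpow_natCast _ 3, ← Real.rpow_neg hw.le]
    congr 1
    push_cast
    ring
  rw [e, ← e2, hK₂]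
  ring

lemma lintegral_const_mul_of_measurable {L : ℝ × ℝ × ℝ × ℝ × ℝ → ENNReal} (hL : Measurable L)
    {ν : Measure ℝ} [SFinite ν] (c : ENNReal) (ρ : ℝ) :
    ∫⁻ σ₂, ∫⁻ σ₁, ∫⁻ μ₂, ∫⁻ μ₁, c * L (μ₁, μ₂, σ₁, σ₂, ρ) ∂volume ∂volume ∂ν ∂ν =
      c * ∫⁻ σ₂, ∫⁻ σ₁, ∫⁻ μ₂, ∫⁻ μ₁, L (μ₁, μ₂, σ₁, σ₂, ρ) ∂volume ∂volume ∂ν ∂ν := by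
  have h1 : Measurable fun q : ℝ × ℝ × ℝ × ℝ => ∫⁻ μ₁, L (μ₁, q) := hL.lintegral_prod_left'
  have h2 : Measurable fun q : ℝ × ℝ × ℝ => ∫⁻ μ₂, ∫⁻ μ₁, L (μ₁, μ₂, q) := h1.lintegral_prod_left'
  have h3 : Measurable fun q : ℝ × ℝ => ∫⁻ σ₁, ∫⁻ μ₂, ∫⁻ μ₁, L (μ₁, μ₂, σ₁, q)
      ∂volume ∂volume ∂ν := h2.lintegral_prod_left'
  refine (lintegral_congr fun σ₂ => ?_).trans
    (lintegral_const_mul c (h3.comp (measurable_prodMk_right (y := ρ))))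
  refine (lintegral_congr fun σ₁ => ?_).trans
    (lintegral_const_mul c (h2.comp (measurable_prodMk_right (y := (σ₂, ρ)))))
  refine (lintegral_congr fun μ₂ => ?_).trans
    (lintegral_const_mul c (h1.comp (measurable_prodMk_right (y := (σ₁, σ₂, ρ)))))
  exact lintegral_const_mul c (hL.comp (measurable_prodMk_right (y := (μ₂, σ₁, σ₂, ρ))))

/-- The unnormalized posterior distribution of `ρ` is a positive finite multiple of the law of
`ψ(Y*)`. -/
lemma exists_lintegral_unnormalizedPosterior (hn : n ≠ 0) {a b : ℝ} (ha : a < n) (hb : b < n)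
    {x : Fin n → ℝ × ℝ} (hx : Nondegenerate x) :
    ∃ C : ENNReal, C ≠ 0 ∧ C ≠ ⊤ ∧ ∀ f : ℝ → ENNReal, Measurable f →
      ∫⁻ θ, f θ.2.2.2.2 ∂unnormalizedPosterior a b x =
        C * ∫⁻ y, f (psi y) ∂yStarLaw n a b (sampleCorr x) := by
  obtain ⟨C, hC, inner⟩ := exists_lintegral_scales hn ha hb hx
  refine ⟨ENNReal.ofReal C * ENNReal.ofReal √(2 * Real.pi), ?_, ?_, fun f hf => ?_⟩
  · refine mul_ne_zero ?_ ?_ <;> rw [ENNReal.ofReal_ne_zero_iff] <;> positivity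
  · exact ENNReal.mul_ne_top ENNReal.ofReal_ne_top ENNReal.ofReal_ne_top
  have hm : Measurable fun θ => ENNReal.ofReal (prior a b θ * likelihood x θ) :=
    ((measurable_prior a b).mul (measurable_likelihood x)).ennreal_ofReal
  have hf' : Measurable fun θ : ℝ × ℝ × ℝ × ℝ × ℝ => f θ.2.2.2.2 := hf.comp (by fun_prop)
  have hF : Measurable fun θ : ℝ × ℝ × ℝ × ℝ × ℝ =>
      f θ.2.2.2.2 * ENNReal.ofReal (prior a b θ * likelihood x θ) := hf'.mul hm
  have hG : Measurable fun s : ℝ × ℝ × ℝ => ∫⁻ μ₂, ∫⁻ μ₁,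
      f s.2.2 * ENNReal.ofReal (prior a b (μ₁, μ₂, s) * likelihood x (μ₁, μ₂, s)) :=
    hF.lintegral_prod_left'.lintegral_prod_left'
  rw [unnormalizedPosterior, lintegral_withDensity_eq_lintegral_mul _ hm hf',
    restrict_paramSpace]
  have e0 : ((fun θ => ENNReal.ofReal (prior a b θ * likelihood x θ)) *
      fun θ : ℝ × ℝ × ℝ × ℝ × ℝ => f θ.2.2.2.2) =
      fun θ => f θ.2.2.2.2 * ENNReal.ofReal (prior a b θ * likelihood x θ) := by
    funext θ
    simp [mul_comm]
  have hy := lintegral_yStarLaw (n := n) (a := a) (b := b) (sampleCorr x)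
    (hf.comp continuous_psi.measurable)
  rw [← lintegral_comp_div_sqrt] at hy
  simp only [Function.comp_apply] at hy
  rw [e0, lintegral_prod_prod_symm hF, lintegral_prod_prod_symm hG, hy, mul_assoc, ← mul_assoc
    (ENNReal.ofReal √(2 * Real.pi)), ← ENNReal.ofReal_mul (Real.sqrt_nonneg _),
    mul_inv_cancel₀ (by positivity), ENNReal.ofReal_one, one_mul,
    ← lintegral_const_mul' _ _ ENNReal.ofReal_ne_top]
  refine setLIntegral_congr_fun measurableSet_Ioo fun ρ hρ => ?_
  simp only []
  rw [lintegral_const_mul_of_measurable hm, inner ρ hρ, psi_div_sqrt hρ]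
  ring

lemma isProbabilityMeasure_yStarLaw {a b : ℝ} (ha : a < n) (hb : b < n) (r : ℝ) :
    IsProbabilityMeasure (yStarLaw n a b r) := by
  have := isProbabilityMeasure_normalChiChi (sub_pos.2 ha) (sub_pos.2 hb)
  exact Measure.isProbabilityMeasure_map (measurable_yStar _).aemeasurable

lemma yStarLaw_singleton (n : ℕ) (a b r q : ℝ) : yStarLaw n a b r {q} = 0 := by
  rw [← lintegral_indicator_one (measurableSet_singleton q),
    lintegral_yStarLaw r (measurable_one.indicator (measurableSet_singleton q))]
  have : ∫⁻ y, ({q} : Set ℝ).indicator 1 y *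
      ∫⁻ p, ENNReal.ofReal (yStarKernel (r / √(1 - r ^ 2)) y p)
        ∂(chiSquared (n - a)).prod (chiSquared (n - b)) = 0 := by
    rw [← lintegral_zero (μ := (volume : Measure ℝ))]
    refine lintegral_congr_ae ?_
    have h : ∀ᵐ y : ℝ, y ≠ q := by
      simp [ae_iff]
    filter_upwards [h] with y hy
    simp [hy]
  rw [this, mul_zero]

lemma isProbabilityMeasure_posteriorLaw (hn : n ≠ 0) {a b : ℝ} (ha : a < n) (hb : b < n)
    {x : Fin n → ℝ × ℝ} (hx : Nondegenerate x) :
    IsProbabilityMeasure (posteriorLaw a b x) := by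
  obtain ⟨C, hC0, hC, h⟩ := exists_lintegral_unnormalizedPosterior hn ha hb hx
  have := isProbabilityMeasure_yStarLaw ha hb (sampleCorr x)
  have h1 := h 1 measurable_one
  simp only [Pi.one_apply, lintegral_one, measure_univ, mul_one] at h1
  constructor
  rw [posteriorLaw, Measure.smul_apply, h1, smul_eq_mul, ENNReal.inv_mul_cancel hC0 hC]

/-- The posterior distribution of the correlation is the law of `ψ(Y*)`. -/
lemma posteriorRho_eq (hn : n ≠ 0) {a b : ℝ} (ha : a < n) (hb : b < n)
    {x : Fin n → ℝ × ℝ} (hx : Nondegenerate x) :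
    posteriorRho a b x = (yStarLaw n a b (sampleCorr x)).map psi := by
  obtain ⟨C, hC0, hC, h⟩ := exists_lintegral_unnormalizedPosterior hn ha hb hx
  have := isProbabilityMeasure_yStarLaw ha hb (sampleCorr x)
  have h1 := h 1 measurable_one
  simp only [Pi.one_apply, lintegral_one, measure_univ, mul_one] at h1
  have hm : Measurable fun θ : ℝ × ℝ × ℝ × ℝ × ℝ => θ.2.2.2.2 := by fun_prop
  refine Measure.ext_of_lintegral _ fun f hf => ?_
  rw [posteriorRho, lintegral_map hf hm, lintegral_map hf continuous_psi.measurable, posteriorLaw,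
    lintegral_smul_measure, h1, h f hf, smul_eq_mul, ← mul_assoc, ENNReal.inv_mul_cancel hC0 hC,
    one_mul]

lemma posteriorRho_Iic (hn : n ≠ 0) {a b : ℝ} (ha : a < n) (hb : b < n)
    {x : Fin n → ℝ × ℝ} (hx : Nondegenerate x) {ρ : ℝ} (hρ : ρ ∈ Ioo (-1 : ℝ) 1) :
    posteriorRho a b x (Iic ρ) = ENNReal.ofReal (mixture (n - a) (n - b) (ρ / √(1 - ρ ^ 2))
      (sampleCorr x / √(1 - sampleCorr x ^ 2))) := by
  rw [posteriorRho_eq hn ha hb hx, Measure.map_apply continuous_psi.measurable measurableSet_Iic,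
    ← yStarLaw_Iic ha hb]
  congr 1
  ext y
  exact psi_le_iff hρ

/-- Quantiles are equivariant under the increasing bijection `ψ`. -/
lemma quantile_posteriorRho (hn : n ≠ 0) {a b : ℝ} (ha : a < n) (hb : b < n)
    {x : Fin n → ℝ × ℝ} (hx : Nondegenerate x) {p : ℝ} (hp : p ∈ Ioo (0 : ℝ) 1) :
    quantile (posteriorRho a b x) p = psi (quantile (yStarLaw n a b (sampleCorr x)) p) := by
  have := isProbabilityMeasure_yStarLaw ha hb (sampleCorr x)
  set q := quantile (yStarLaw n a b (sampleCorr x)) p with hqdef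
  have hq := mixture_quantile_yStarLaw ha hb (sampleCorr x) hp
  refine quantile_eq fun ρ => ?_
  have hψ := psi_mem_Ioo q
  rcases le_or_gt ρ (-1) with h1 | h1
  · have h0 : posteriorRho a b x (Iic ρ) = 0 := by
      rw [posteriorRho_eq hn ha hb hx, Measure.map_apply continuous_psi.measurable
        measurableSet_Iic]
      have : psi ⁻¹' Iic ρ = ∅ := by
        ext y
        simpa using lt_of_le_of_lt h1 (psi_mem_Ioo y).1
      rw [this, measure_empty]
    rw [h0]
    simp only [nonpos_iff_eq_zero, ENNReal.ofReal_eq_zero]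
    constructor
    · intro h
      linarith [hp.1]
    · intro h
      linarith [hψ.1]
  rcases le_or_gt 1 ρ with h2 | h2
  · have h0 : posteriorRho a b x (Iic ρ) = 1 := by
      rw [posteriorRho_eq hn ha hb hx, Measure.map_apply continuous_psi.measurable
        measurableSet_Iic]
      have : psi ⁻¹' Iic ρ = univ := by
        ext y
        simpa using (psi_mem_Ioo y).2.le.trans h2
      rw [this, measure_univ]
    rw [h0]
    simp only [ENNReal.ofReal_le_one]
    constructor
    · intro _
      linarith [hψ.2]
    · intro _
      exact hp.2.le
  have hρ : ρ ∈ Ioo (-1 : ℝ) 1 := ⟨h1, h2⟩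
  rw [posteriorRho_Iic hn ha hb hx hρ, psi_le_iff hρ,
    ENNReal.ofReal_le_ofReal_iff (mixture_nonneg _ _ _ _)]
  conv_lhs => rw [← hq]
  exact (strictMono_mixture (sub_pos.2 ha) (sub_pos.2 hb) _).le_iff_le

lemma posteriorRho_Iio_quantile (hn : n ≠ 0) {a b : ℝ} (ha : a < n) (hb : b < n)
    {x : Fin n → ℝ × ℝ} (hx : Nondegenerate x) {p : ℝ} (hp : p ∈ Ioo (0 : ℝ) 1) :
    posteriorRho a b x (Iio (quantile (posteriorRho a b x) p)) = ENNReal.ofReal p := by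
  rw [quantile_posteriorRho hn ha hb hx hp, posteriorRho_eq hn ha hb hx,
    Measure.map_apply continuous_psi.measurable measurableSet_Iio]
  set q := quantile (yStarLaw n a b (sampleCorr x)) p
  have h : psi ⁻¹' Iio (psi q) = Iio q := by
    ext y
    exact strictMono_psi.lt_iff_lt
  have h' : yStarLaw n a b (sampleCorr x) (Iio q) = yStarLaw n a b (sampleCorr x) (Iic q) := by
    rw [← Iio_union_right]
    exact le_antisymm (measure_mono subset_union_left) ((measure_union_le _ _).trans
      (by rw [yStarLaw_singleton, add_zero]))
  rw [h, h', yStarLaw_Iic ha hb, mixture_quantile_yStarLaw ha hb _ hp]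

/-- The event that the credible interval covers `ρ`, in terms of `r / √(1 - r²)`. -/
lemma mem_credibleInterval_iff (hn : n ≠ 0) {a b : ℝ} (ha : a < n) (hb : b < n)
    {x : Fin n → ℝ × ℝ} (hx : Nondegenerate x) {α : ℝ} (hα : α ∈ Ioo (0 : ℝ) 1)
    {ρ : ℝ} (hρ : ρ ∈ Ioo (-1 : ℝ) 1) :
    ρ ∈ Ioo (-1) (quantile (posteriorRho a b x) (1 - α)) ↔
      quantile (ratioLaw ρ (n - a) (n - b)) α <
        √(1 - ρ ^ 2) * (sampleCorr x / √(1 - sampleCorr x ^ 2)) := by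
  have hw := Real.sqrt_pos.2 (one_sub_sq_pos hρ)
  have hα' : 1 - α ∈ Ioo (0 : ℝ) 1 := ⟨by linarith [hα.2], by linarith [hα.1]⟩
  have hk := sub_pos.2 ha
  have hl := sub_pos.2 hb
  have h1 := mixture_quantile_yStarLaw ha hb (sampleCorr x) hα'
  have h2 := mixture_quantile_ratioLaw hk hl hρ hα
  have h3 := (strictAnti_mixture hk hl (ρ / √(1 - ρ ^ 2))).lt_iff_gt
    (a := sampleCorr x / √(1 - sampleCorr x ^ 2))
    (b := quantile (ratioLaw ρ (n - a) (n - b)) α / √(1 - ρ ^ 2))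
  rw [quantile_posteriorRho hn ha hb hx hα', mem_Ioo, and_iff_right hρ.1, ← div_lt_iff₀' hw, ← h3,
    h2, ← h1, (strictMono_mixture hk hl _).lt_iff_lt, ← not_le, psi_le_iff hρ, not_le, h1]

end

/-! ### Sums of squares of standard normal variables -/

/-- The chi-squared density without its normalizing constant. -/
def chiKernel (k u : ℝ) : ENNReal :=
  (Ioi (0 : ℝ)).indicator (fun u => ENNReal.ofReal (u ^ (k / 2 - 1) * Real.exp (-(u / 2)))) u

lemma measurable_chiKernel (k : ℝ) : Measurable (chiKernel k) := by
  unfold chiKernel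
  exact Measurable.indicator (by fun_prop) measurableSet_Ioi

/-- The normalizing constant of the chi-squared density. -/
def chiConst (k : ℝ) : ENNReal := ENNReal.ofReal ((1 / 2) ^ (k / 2) / Real.Gamma (k / 2))

lemma chiConst_ne_top (k : ℝ) : chiConst k ≠ ⊤ := ENNReal.ofReal_ne_top

lemma lintegral_chiSquared_eq {k : ℝ} (hk : 0 < k) {g : ℝ → ENNReal} (hg : Measurable g) :
    ∫⁻ u, g u ∂chiSquared k = chiConst k * ∫⁻ u, chiKernel k u * g u := by
  have hΓ := Real.Gamma_pos_of_pos (half_pos hk)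
  rw [lintegral_chiSquared k hg, ← lintegral_const_mul' _ _ (chiConst_ne_top k),
    ← lintegral_indicator measurableSet_Ioi]
  refine lintegral_congr fun u => ?_
  by_cases hu : 0 < u
  · simp only [chiKernel, mem_Ioi, hu, indicator_of_mem]
    rw [chiConst, ← mul_assoc, ← ENNReal.ofReal_mul (by positivity), mul_assoc (_ / _),
      show 1 / 2 * u = u / 2 by ring]
  · simp [chiKernel, hu]

/-- A probability measure proportional to a chi-squared distribution is equal to it. -/
lemma eq_chiSquared_of_lintegral {k : ℝ} (hk : 0 < k) {ν : Measure ℝ} [IsProbabilityMeasure ν]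
    {K : ENNReal}
    (h : ∀ g : ℝ → ENNReal, Measurable g → ∫⁻ u, g u ∂ν = K * ∫⁻ u, chiKernel k u * g u) :
    ν = chiSquared k := by
  have := isProbabilityMeasure_chiSquared hk
  have hK : K = chiConst k := by
    have h1 := h 1 measurable_one
    have h2 := lintegral_chiSquared_eq hk measurable_one
    simp only [Pi.one_apply, lintegral_one, measure_univ, mul_one] at h1 h2
    rw [ENNReal.eq_inv_of_mul_eq_one_left h1.symm, ENNReal.eq_inv_of_mul_eq_one_left h2.symm]
  refine Measure.ext_of_lintegral _ fun g hg => ?_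
  rw [h g hg, lintegral_chiSquared_eq hk hg, hK]

lemma map_add_chiSquared {k l : ℝ} (hk : 0 < k) (hl : 0 < l) :
    ((chiSquared k).prod (chiSquared l)).map (fun p => p.1 + p.2) = chiSquared (k + l) := by
  have := isProbabilityMeasure_chiSquared hk
  have := isProbabilityMeasure_chiSquared hl
  have hadd : Measurable fun p : ℝ × ℝ => p.1 + p.2 := by fun_prop
  have := Measure.isProbabilityMeasure_map
    (μ := (chiSquared k).prod (chiSquared l)) hadd.aemeasurable
  have mk := measurable_chiKernel k
  have ml := measurable_chiKernel l
  refine eq_chiSquared_of_lintegral (add_pos hk hl)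
    (K := chiConst k * (chiConst l * ∫⁻ s, (Ioo (0 : ℝ) 1).indicator
      (fun s => ENNReal.ofReal (s ^ (k / 2 - 1) * (1 - s) ^ (l / 2 - 1))) s)) fun g hg => ?_
  -- the inner convolution integral, by scaling
  have conv : ∀ y : ℝ, y ≠ 0 → ∫⁻ u, chiKernel k u * chiKernel l (y - u) =
      chiKernel (k + l) y * ∫⁻ s, (Ioo (0 : ℝ) 1).indicator
        (fun s => ENNReal.ofReal (s ^ (k / 2 - 1) * (1 - s) ^ (l / 2 - 1))) s := by
    intro y hy
    rcases lt_or_gt_of_ne hy with hy | hy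
    · have h0 : ∀ u, chiKernel k u * chiKernel l (y - u) = 0 := fun u => by
        by_cases hu : 0 < u
        · have : ¬ 0 < y - u := by linarith
          simp [chiKernel, this]
        · simp [chiKernel, hu]
      have h1 : chiKernel (k + l) y = 0 := by
        simp [chiKernel, hy.le]
      simp [h0, h1]
    · rw [lintegral_affine hy.ne' 0, ← lintegral_const_mul' _ _ ENNReal.ofReal_ne_top,
        ← lintegral_const_mul' _ _ (by simp [chiKernel, hy])]
      refine lintegral_congr fun s => ?_
      by_cases hs : s ∈ Ioo (0 : ℝ) 1
      · have h1 : 0 < y * s := mul_pos hy hs.1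
        have h2 : 0 < 1 - s := by linarith [hs.2]
        have h3 : y - y * s = y * (1 - s) := by ring
        have h4 : 0 < y * (1 - s) := mul_pos hy h2
        simp only [chiKernel, zero_add, h3, mem_Ioi, h1, h4, hy, indicator_of_mem, hs]
        rw [← ENNReal.ofReal_mul (by positivity), ← ENNReal.ofReal_mul (by positivity),
          ← ENNReal.ofReal_mul (by positivity), abs_of_pos hy, Real.mul_rpow hy.le hs.1.le,
          Real.mul_rpow hy.le h2.le]
        congr 1
        have e1 : Real.exp (-(y / 2)) =
            Real.exp (-(y * s / 2)) * Real.exp (-(y * (1 - s) / 2)) := by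
          rw [← Real.exp_add]
          congr 1
          ring
        have e2 : y ^ ((k + l) / 2 - 1) = y * (y ^ (k / 2 - 1) * y ^ (l / 2 - 1)) := by
          rw [← Real.rpow_add hy, mul_comm, ← Real.rpow_add_one hy.ne']
          congr 1
          ring
        rw [e1, e2]
        ring
      · rw [indicator_of_notMem hs, mul_zero]
        by_cases h1 : 0 < s
        · have h2 : ¬ 0 < y - y * s := by
            have : 1 ≤ s := by
              by_contra! h
              exact hs ⟨h1, h⟩
            nlinarith
          simp [chiKernel, h2]
        · have : ¬ 0 < y * s := by nlinarith
          simp [chiKernel, this]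
  have hga : Measurable fun p : ℝ × ℝ => g (p.1 + p.2) := hg.comp hadd
  rw [lintegral_map hg hadd, lintegral_prod _ hga.aemeasurable]
  have e1 : ∀ u, ∫⁻ v, g (u + v) ∂chiSquared l =
      chiConst l * ∫⁻ y, chiKernel l (y - u) * g y := fun u => by
    rw [lintegral_chiSquared_eq hl (g := fun v => g (u + v)) (by fun_prop),
      ← lintegral_sub_right_eq_self (fun v => chiKernel l v * g (u + v)) u]
    simp
  simp only [e1]
  have mkl : Measurable fun p : ℝ × ℝ => chiKernel l (p.2 - p.1) := ml.comp (by fun_prop)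
  have mj : Measurable fun p : ℝ × ℝ => chiKernel l (p.2 - p.1) * g p.2 :=
    mkl.mul (hg.comp measurable_snd)
  rw [lintegral_chiSquared_eq hk (mj.lintegral_prod_right'.const_mul _), mul_assoc, mul_assoc]
  congr 1
  have e2 : ∀ u, chiKernel k u * (chiConst l * ∫⁻ y, chiKernel l (y - u) * g y) =
      chiConst l * ∫⁻ y, chiKernel k u * (chiKernel l (y - u) * g y) := fun u => by
    rw [mul_left_comm]
    congr 1
    exact (lintegral_const_mul _ (mj.comp (measurable_prodMk_left (x := u)))).symm
  simp only [e2]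
  rw [lintegral_const_mul' _ _ (chiConst_ne_top l), lintegral_lintegral_swap
    ((mk.comp measurable_fst).mul mj).aemeasurable]
  congr 1
  have mg : Measurable fun y => chiKernel (k + l) y * g y := (measurable_chiKernel _).mul hg
  rw [← lintegral_const_mul _ mg]
  have hne : ∀ᵐ y : ℝ, y ≠ 0 := by
    simp [ae_iff]
  refine lintegral_congr_ae (hne.mono fun y hy => ?_)
  simp only [← mul_assoc]
  have mkly : Measurable fun u => chiKernel k u * chiKernel l (y - u) :=
    mk.mul (ml.comp (by fun_prop))
  rw [lintegral_mul_const _ mkly, conv y hy, mul_comm (chiKernel _ _)]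

/-- The square of a standard normal variable is chi-squared with one degree of freedom. -/
lemma map_sq_gaussianReal : (gaussianReal 0 1).map (fun z => z ^ 2) = chiSquared 1 := by
  have hsq : Measurable fun z : ℝ => z ^ 2 := by fun_prop
  have := Measure.isProbabilityMeasure_map (μ := gaussianReal 0 1) hsq.aemeasurable
  refine eq_chiSquared_of_lintegral one_pos (K := ENNReal.ofReal (√(2 * Real.pi))⁻¹)
    fun g hg => ?_
  have hpos : ∀ h : ℝ → ENNReal, ∫⁻ z in Ioi (0 : ℝ), h (z ^ 2) =
      ENNReal.ofReal (1 / 2) * ∫⁻ u in Ioi (0 : ℝ), ENNReal.ofReal (u ^ (1 / 2 - 1 : ℝ)) * h u := by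
    intro h
    have himg : (fun u : ℝ => u ^ (1 / 2 : ℝ)) '' Ioi 0 = Ioi 0 := by
      ext z
      simp only [mem_image, mem_Ioi]
      constructor
      · rintro ⟨u, hu, rfl⟩
        positivity
      · intro hz
        exact ⟨z ^ 2, by positivity, by rw [← Real.sqrt_eq_rpow, Real.sqrt_sq hz.le]⟩
    have hs : ∀ u : ℝ, 0 < u → (u ^ (1 / 2 : ℝ)) ^ 2 = u := fun u hu => by
      rw [← Real.sqrt_eq_rpow, Real.sq_sqrt hu.le]
    have hd : ∀ u ∈ Ioi (0 : ℝ), HasDerivWithinAt (fun u : ℝ => u ^ (1 / 2 : ℝ))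
        (1 / 2 * u ^ (1 / 2 - 1 : ℝ)) (Ioi 0) u := fun u hu =>
      (Real.hasDerivAt_rpow_const (Or.inl (ne_of_gt hu))).hasDerivWithinAt
    have hinj : InjOn (fun u : ℝ => u ^ (1 / 2 : ℝ)) (Ioi 0) := fun u hu v hv h => by
      have h' : u ^ (1 / 2 : ℝ) = v ^ (1 / 2 : ℝ) := h
      rw [← hs u hu, ← hs v hv, h']
    conv_lhs => rw [← himg]
    rw [lintegral_image_eq_lintegral_abs_deriv_mul measurableSet_Ioi hd hinj,
      ← lintegral_const_mul' _ _ ENNReal.ofReal_ne_top]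
    refine setLIntegral_congr_fun measurableSet_Ioi fun u (hu : 0 < u) => ?_
    rw [hs u hu, abs_of_pos (by positivity), ENNReal.ofReal_mul (by norm_num), mul_assoc]
  have hneg : ∀ h : ℝ → ENNReal, ∫⁻ z, h (z ^ 2) = 2 * ∫⁻ z in Ioi (0 : ℝ), h (z ^ 2) := by
    intro h
    have h1 : ∫⁻ z in Iio (0 : ℝ), h (z ^ 2) = ∫⁻ z in Ioi (0 : ℝ), h (z ^ 2) := by
      have h2 := (Measure.measurePreserving_neg (volume : Measure ℝ)).setLIntegral_comp_preimage_emb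
        (MeasurableEquiv.neg ℝ).measurableEmbedding (fun z => h (z ^ 2)) (Ioi 0)
      rw [← h2]
      simp
    rw [← lintegral_add_compl _ measurableSet_Ioi, compl_Ioi,
      setLIntegral_congr Iio_ae_eq_Iic.symm, h1, two_mul]
  have hgs : Measurable fun z => g (z ^ 2) := hg.comp hsq
  rw [lintegral_map hg hsq, gaussianReal_of_var_ne_zero _ one_ne_zero,
    lintegral_withDensity_eq_lintegral_mul _ (measurable_gaussianPDF 0 1) hgs]
  have e : ∀ z, (gaussianPDF 0 1 * fun z => g (z ^ 2)) z = ENNReal.ofReal (√(2 * Real.pi))⁻¹ *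
      (fun u => ENNReal.ofReal (Real.exp (-(u / 2))) * g u) (z ^ 2) := fun z => by
    simp only [Pi.mul_apply, gaussianPDF, gaussianPDFReal, NNReal.coe_one,
      mul_one, sub_zero]
    rw [ENNReal.ofReal_mul (by positivity), mul_assoc, neg_div]
  simp only [e]
  rw [lintegral_const_mul' _ _ ENNReal.ofReal_ne_top,
    hneg (fun u => ENNReal.ofReal (Real.exp (-(u / 2))) * g u),
    hpos (fun u => ENNReal.ofReal (Real.exp (-(u / 2))) * g u), ← mul_assoc 2]
  have h2 : (2 : ENNReal) * ENNReal.ofReal (1 / 2) = 1 := by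
    rw [show (2 : ENNReal) = ENNReal.ofReal 2 by simp, ← ENNReal.ofReal_mul (by norm_num)]
    norm_num
  rw [h2, one_mul, ← lintegral_indicator measurableSet_Ioi]
  congr 1
  refine lintegral_congr fun u => ?_
  by_cases hu : 0 < u
  · simp only [chiKernel, mem_Ioi, hu, indicator_of_mem]
    rw [ENNReal.ofReal_mul (by positivity), mul_assoc]
  · simp [chiKernel, hu]

/-- The sum of `m + 1` squares of independent standard normal variables is chi-squared with `m + 1`
degrees of freedom. -/
lemma map_sum_sq_pi_gaussianReal (m : ℕ) :
    (Measure.pi fun _ : Fin (m + 1) => gaussianReal 0 1).map (fun x => ∑ i, x i ^ 2) =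
      chiSquared ((m : ℝ) + 1) := by
  induction m with
  | zero =>
    have h := (measurePreserving_piUnique fun _ : Fin 1 => gaussianReal 0 1)
    have h1 : (fun x : Fin 1 → ℝ => ∑ i, x i ^ 2) =
        (fun z => z ^ 2) ∘ MeasurableEquiv.piUnique fun _ : Fin 1 => ℝ := by
      funext x
      simp [MeasurableEquiv.piUnique]
    rw [h1, ← Measure.map_map (by fun_prop) h.measurable, h.map_eq, map_sq_gaussianReal]
    simp
  | succ m ih =>
    have h := measurePreserving_piFinSuccAbove (fun _ : Fin (m + 2) => gaussianReal 0 1) 0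
    have h1 : (fun x : Fin (m + 2) → ℝ => ∑ i, x i ^ 2) = (fun p : ℝ × ℝ => p.1 + p.2) ∘
        Prod.map (fun z : ℝ => z ^ 2) (fun x : Fin (m + 1) → ℝ => ∑ i, x i ^ 2) ∘
        MeasurableEquiv.piFinSuccAbove (fun _ : Fin (m + 2) => ℝ) 0 := by
      funext x
      simp [MeasurableEquiv.piFinSuccAbove, Fin.sum_univ_succ, Fin.insertNthEquiv, Fin.tail]
    rw [h1, ← Measure.map_map (by fun_prop) ((by fun_prop : Measurable _).comp h.measurable),
      ← Measure.map_map (by fun_prop) h.measurable, h.map_eq,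
      ← Measure.map_prod_map _ _ (by fun_prop) (by fun_prop), map_sq_gaussianReal, ih,
      map_add_chiSquared one_pos (by positivity)]
    push_cast
    ring_nf

/-! ### The sampling distribution of the correlation coefficient -/

lemma lintegral_gaussianReal {g : ℝ → ENNReal} (hg : Measurable g) :
    ∫⁻ z, g z ∂gaussianReal 0 1 = ∫⁻ z, gaussianPDF 0 1 z * g z := by
  rw [gaussianReal_of_var_ne_zero _ one_ne_zero,
    lintegral_withDensity_eq_lintegral_mul _ (measurable_gaussianPDF 0 1) hg]
  rfl

/-- A bivariate normal vector as an affine image of a pair of independent standard normals. -/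
def affinePair (μ₁ μ₂ σ₁ σ₂ ρ : ℝ) (z : ℝ × ℝ) : ℝ × ℝ :=
  (μ₁ + σ₁ * z.1, μ₂ + σ₂ * ρ * z.1 + σ₂ * √(1 - ρ ^ 2) * z.2)

lemma measurable_affinePair (μ₁ μ₂ σ₁ σ₂ ρ : ℝ) : Measurable (affinePair μ₁ μ₂ σ₁ σ₂ ρ) := by
  unfold affinePair
  fun_prop

lemma measurable_normalPDF (μ₁ μ₂ σ₁ σ₂ ρ : ℝ) : Measurable (normalPDF μ₁ μ₂ σ₁ σ₂ ρ) := by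
  unfold normalPDF
  fun_prop

lemma normalPDF_affinePair {μ₁ μ₂ σ₁ σ₂ ρ : ℝ} (h₁ : 0 < σ₁) (h₂ : 0 < σ₂)
    (hρ : ρ ∈ Ioo (-1 : ℝ) 1) (z : ℝ × ℝ) :
    σ₁ * (σ₂ * √(1 - ρ ^ 2) * normalPDF μ₁ μ₂ σ₁ σ₂ ρ (affinePair μ₁ μ₂ σ₁ σ₂ ρ z)) =
      gaussianPDFReal 0 1 z.1 * gaussianPDFReal 0 1 z.2 := by
  have hp := one_sub_sq_pos hρ
  have hw := Real.sqrt_pos.2 hp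
  have hw2 := Real.sq_sqrt hp.le
  rw [normalPDF, affinePair, gaussianPDFReal, gaussianPDFReal,
    mul_mul_mul_comm (_)⁻¹ (Real.exp _) (_)⁻¹ (Real.exp _), ← Real.exp_add,
    ← mul_inv]
  simp only [NNReal.coe_one, mul_one, sub_zero]
  rw [Real.mul_self_sqrt (by positivity)]
  rw [← hw2]
  rw [Real.sqrt_sq hw.le]
  have e : -(σ₂ ^ 2 * (μ₁ + σ₁ * z.1 - μ₁) ^ 2 +
      σ₁ ^ 2 * (μ₂ + σ₂ * ρ * z.1 + σ₂ * √(1 - ρ ^ 2) * z.2 - μ₂) ^ 2 -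
      2 * ρ * σ₁ * σ₂ * (μ₁ + σ₁ * z.1 - μ₁) *
        (μ₂ + σ₂ * ρ * z.1 + σ₂ * √(1 - ρ ^ 2) * z.2 - μ₂)) /
      (2 * σ₁ ^ 2 * σ₂ ^ 2 * √(1 - ρ ^ 2) ^ 2) = -z.1 ^ 2 / 2 + -z.2 ^ 2 / 2 := by
    have hρ2 : ρ ^ 2 = 1 - √(1 - ρ ^ 2) ^ 2 := by linarith
    generalize √(1 - ρ ^ 2) = w at *
    field_simp
    ring_nf
    rw [hρ2]
    ring
  rw [e]
  field_simp

lemma normalLaw_eq_map {μ₁ μ₂ σ₁ σ₂ ρ : ℝ} (h₁ : 0 < σ₁) (h₂ : 0 < σ₂)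
    (hρ : ρ ∈ Ioo (-1 : ℝ) 1) :
    normalLaw μ₁ μ₂ σ₁ σ₂ ρ =
      ((gaussianReal 0 1).prod (gaussianReal 0 1)).map (affinePair μ₁ μ₂ σ₁ σ₂ ρ) := by
  have hw := Real.sqrt_pos.2 (one_sub_sq_pos hρ)
  have hA := measurable_affinePair μ₁ μ₂ σ₁ σ₂ ρ
  have hP := (measurable_normalPDF μ₁ μ₂ σ₁ σ₂ ρ).ennreal_ofReal
  refine Measure.ext_of_lintegral _ fun f hf => ?_
  have hfA : Measurable fun z => f (affinePair μ₁ μ₂ σ₁ σ₂ ρ z) := hf.comp hA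
  have hPf : Measurable fun x => ENNReal.ofReal (normalPDF μ₁ μ₂ σ₁ σ₂ ρ x) * f x := hP.mul hf
  have e0 : ∫⁻ x, f x ∂normalLaw μ₁ μ₂ σ₁ σ₂ ρ =
      ∫⁻ x, ENNReal.ofReal (normalPDF μ₁ μ₂ σ₁ σ₂ ρ x) * f x :=
    lintegral_withDensity_eq_lintegral_mul _ hP hf
  rw [e0, lintegral_map hf hA,
    lintegral_prod _ hfA.aemeasurable,
    lintegral_gaussianReal hfA.lintegral_prod_right', Measure.volume_eq_prod,
    lintegral_prod _ hPf.aemeasurable, lintegral_affine h₁.ne' μ₁,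
    ← lintegral_const_mul' _ _ ENNReal.ofReal_ne_top]
  refine lintegral_congr fun z₁ => ?_
  rw [lintegral_gaussianReal (g := fun z₂ => f (affinePair μ₁ μ₂ σ₁ σ₂ ρ (z₁, z₂)))
      (hfA.comp measurable_prodMk_left),
    ← lintegral_const_mul' _ _ gaussianPDF_ne_top,
    lintegral_affine (mul_pos h₂ hw).ne' (μ₂ + σ₂ * ρ * z₁),
    ← lintegral_const_mul' _ _ ENNReal.ofReal_ne_top,
    ← lintegral_const_mul' _ _ ENNReal.ofReal_ne_top]
  refine lintegral_congr fun z₂ => ?_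
  have e := normalPDF_affinePair (μ₁ := μ₁) (μ₂ := μ₂) h₁ h₂ hρ (z₁, z₂)
  have e' := congrArg ENNReal.ofReal e
  rw [ENNReal.ofReal_mul h₁.le, ENNReal.ofReal_mul (mul_pos h₂ hw).le,
    ENNReal.ofReal_mul (gaussianPDFReal_nonneg _ _ _)] at e'
  rw [abs_of_pos h₁, abs_of_pos (mul_pos h₂ hw)]
  simp only [gaussianPDF]
  rw [← mul_assoc (ENNReal.ofReal (gaussianPDFReal 0 1 z₁)), ← e']
  simp only [affinePair, mul_assoc]

section

variable {n : ℕ}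

/-- The law of `2 n` independent standard normal variables, arranged as `n` pairs. -/
def stdSample (n : ℕ) : Measure (Fin n → ℝ × ℝ) :=
  Measure.pi fun _ => (gaussianReal 0 1).prod (gaussianReal 0 1)

lemma sampleLaw_eq_map (n : ℕ) {μ₁ μ₂ σ₁ σ₂ ρ : ℝ} (h₁ : 0 < σ₁) (h₂ : 0 < σ₂)
    (hρ : ρ ∈ Ioo (-1 : ℝ) 1) :
    sampleLaw n μ₁ μ₂ σ₁ σ₂ ρ =
      (stdSample n).map fun z k => affinePair μ₁ μ₂ σ₁ σ₂ ρ (z k) := by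
  have hA := measurable_affinePair μ₁ μ₂ σ₁ σ₂ ρ
  have := Measure.isProbabilityMeasure_map
    (μ := (gaussianReal 0 1).prod (gaussianReal 0 1)) hA.aemeasurable
  rw [stdSample, Measure.pi_map_pi fun _ => hA.aemeasurable, sampleLaw]
  simp_rw [normalLaw_eq_map h₁ h₂ hρ]

lemma mean₁_affinePair (hn : n ≠ 0) (μ₁ μ₂ σ₁ σ₂ ρ : ℝ) (z : Fin n → ℝ × ℝ) :
    mean₁ (fun k => affinePair μ₁ μ₂ σ₁ σ₂ ρ (z k)) = μ₁ + σ₁ * mean₁ z := by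
  have hn' : (n : ℝ) ≠ 0 := Nat.cast_ne_zero.2 hn
  simp only [mean₁, affinePair, Finset.sum_add_distrib, ← Finset.mul_sum]
  simp
  field_simp

lemma mean₂_affinePair (hn : n ≠ 0) (μ₁ μ₂ σ₁ σ₂ ρ : ℝ) (z : Fin n → ℝ × ℝ) :
    mean₂ (fun k => affinePair μ₁ μ₂ σ₁ σ₂ ρ (z k)) =
      μ₂ + σ₂ * ρ * mean₁ z + σ₂ * √(1 - ρ ^ 2) * mean₂ z := by
  have hn' : (n : ℝ) ≠ 0 := Nat.cast_ne_zero.2 hn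
  simp only [mean₁, mean₂, affinePair, Finset.sum_add_distrib, ← Finset.mul_sum]
  simp
  field_simp

lemma s₁₁_affinePair (hn : n ≠ 0) (μ₁ μ₂ σ₁ σ₂ ρ : ℝ) (z : Fin n → ℝ × ℝ) :
    s₁₁ (fun k => affinePair μ₁ μ₂ σ₁ σ₂ ρ (z k)) = σ₁ ^ 2 * s₁₁ z := by
  rw [s₁₁, mean₁_affinePair hn, s₁₁, Finset.mul_sum]
  refine Finset.sum_congr rfl fun k _ => ?_
  simp only [affinePair]
  ring

lemma s₁₂_affinePair (hn : n ≠ 0) (μ₁ μ₂ σ₁ σ₂ ρ : ℝ) (z : Fin n → ℝ × ℝ) :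
    s₁₂ (fun k => affinePair μ₁ μ₂ σ₁ σ₂ ρ (z k)) =
      σ₁ * σ₂ * (ρ * s₁₁ z + √(1 - ρ ^ 2) * s₁₂ z) := by
  rw [s₁₂, mean₁_affinePair hn, mean₂_affinePair hn, s₁₂, s₁₁, Finset.mul_sum, Finset.mul_sum,
    ← Finset.sum_add_distrib, Finset.mul_sum]
  refine Finset.sum_congr rfl fun k _ => ?_
  simp only [affinePair]
  ring

lemma s₂₂_affinePair (hn : n ≠ 0) (μ₁ μ₂ σ₁ σ₂ ρ : ℝ) (z : Fin n → ℝ × ℝ) :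
    s₂₂ (fun k => affinePair μ₁ μ₂ σ₁ σ₂ ρ (z k)) = σ₂ ^ 2 *
      (ρ ^ 2 * s₁₁ z + 2 * ρ * √(1 - ρ ^ 2) * s₁₂ z + √(1 - ρ ^ 2) ^ 2 * s₂₂ z) := by
  rw [s₂₂, mean₂_affinePair hn, s₁₂, s₁₁, s₂₂, Finset.mul_sum, Finset.mul_sum, Finset.mul_sum,
    ← Finset.sum_add_distrib, ← Finset.sum_add_distrib, Finset.mul_sum]
  refine Finset.sum_congr rfl fun k _ => ?_
  simp only [affinePair]
  ring

/-- The statistic `(s₁₂ / √s₁₁, s₁₁, s₂₂ - s₁₂² / s₁₁)`, which for a standard sample has independent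
components. -/
def bartlett (z : Fin n → ℝ × ℝ) : ℝ × ℝ × ℝ :=
  (s₁₂ z / √(s₁₁ z), s₁₁ z, s₂₂ z - s₁₂ z ^ 2 / s₁₁ z)

/-- The sample correlation of a bivariate normal sample in terms of the Bartlett components of
the underlying standard normal sample. -/
lemma nondegenerate_affinePair (hn : n ≠ 0) (μ₁ μ₂ : ℝ) {σ₁ σ₂ ρ : ℝ} (h₁ : 0 < σ₁)
    (h₂ : 0 < σ₂) (hρ : ρ ∈ Ioo (-1 : ℝ) 1) {z : Fin n → ℝ × ℝ}
    (hA : 0 < (bartlett z).2.1) (hC : 0 < (bartlett z).2.2) :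
    Nondegenerate (fun k => affinePair μ₁ μ₂ σ₁ σ₂ ρ (z k)) ∧
    √(1 - ρ ^ 2) * (sampleCorr (fun k => affinePair μ₁ μ₂ σ₁ σ₂ ρ (z k)) /
      √(1 - sampleCorr (fun k => affinePair μ₁ μ₂ σ₁ σ₂ ρ (z k)) ^ 2)) =
      (√(1 - ρ ^ 2) * (bartlett z).1 + ρ * √(bartlett z).2.1) / √(bartlett z).2.2 := by
  have hw := Real.sqrt_pos.2 (one_sub_sq_pos hρ)
  have hw2 := Real.sq_sqrt (one_sub_sq_pos hρ).le
  simp only [bartlett] at hA hC ⊢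
  simp only [Nondegenerate, sampleCorr, s₁₁_affinePair hn, s₁₂_affinePair hn, s₂₂_affinePair hn]
  generalize √(1 - ρ ^ 2) = w at *
  obtain ⟨C, hCdef⟩ : ∃ C, s₂₂ z - s₁₂ z ^ 2 / s₁₁ z = C := ⟨_, rfl⟩
  have hs22 : s₂₂ z = C + s₁₂ z ^ 2 / s₁₁ z := by rw [← hCdef]; ring
  rw [hCdef] at hC ⊢
  rw [hs22]
  generalize s₁₁ z = A at *
  generalize s₁₂ z = B at *
  have hA' := Real.sqrt_pos.2 hA
  have hA2 := Real.sq_sqrt hA.le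
  have hC' := Real.sqrt_pos.2 hC
  have hC2 := Real.sq_sqrt hC.le
  have e22 : ρ ^ 2 * A + 2 * ρ * w * B + w ^ 2 * (C + B ^ 2 / A) =
      ((ρ * A + w * B) ^ 2 + w ^ 2 * A * C) / A := by
    field_simp
    ring
  have p22 : 0 < ((ρ * A + w * B) ^ 2 + w ^ 2 * A * C) / A := by positivity
  rw [e22]
  have eprod : σ₁ ^ 2 * A * (σ₂ ^ 2 * (((ρ * A + w * B) ^ 2 + w ^ 2 * A * C) / A)) =
      (σ₁ * σ₂) ^ 2 * ((ρ * A + w * B) ^ 2 + w ^ 2 * A * C) := by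
    field_simp
  have hS : 0 < (ρ * A + w * B) ^ 2 + w ^ 2 * A * C := by positivity
  rw [eprod, Real.sqrt_mul (by positivity), Real.sqrt_sq (by positivity), mul_div_mul_left _ _
    (by positivity)]
  have hS' := Real.sqrt_pos.2 hS
  have hS2 := Real.sq_sqrt hS.le
  have hone : 1 - ((ρ * A + w * B) / √((ρ * A + w * B) ^ 2 + w ^ 2 * A * C)) ^ 2 =
      (w * √A * √C) ^ 2 / √((ρ * A + w * B) ^ 2 + w ^ 2 * A * C) ^ 2 := by
    rw [mul_pow, mul_pow, hA2, hC2, div_pow, hS2]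
    field_simp
    ring
  refine ⟨⟨by positivity, by positivity, ?_⟩, ?_⟩
  · rw [← sq_lt_one_iff_abs_lt_one]
    have : 0 < 1 - ((ρ * A + w * B) / √((ρ * A + w * B) ^ 2 + w ^ 2 * A * C)) ^ 2 := by
      rw [hone]
      positivity
    linarith
  · rw [hone, ← div_pow, Real.sqrt_sq (by positivity)]
    generalize √((ρ * A + w * B) ^ 2 + w ^ 2 * A * C) = S at *
    nth_rewrite 1 [← hA2]
    field_simp
    ring

/-! ### Orthogonal decomposition of a standard normal vector -/

/-- The law of `n` independent standard normal variables. -/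
def stdVector (n : ℕ) : Measure (Fin n → ℝ) := Measure.pi fun _ => gaussianReal 0 1

instance isProbabilityMeasure_stdVector (n : ℕ) : IsProbabilityMeasure (stdVector n) := by
  unfold stdVector
  infer_instance

/-- The coordinates of a standard normal vector in an orthonormal basis are independent standard
normal variables. -/
lemma map_coordinates_stdVector (b : OrthonormalBasis (Fin n) ℝ (EuclideanSpace ℝ (Fin n))) :
    (stdVector n).map (fun x i => ∑ k, b i k * x k) = stdVector n := by
  have h1 : (stdVector n).map (WithLp.toLp 2) =
      (stdVector n).map (fun x : Fin n → ℝ => ∑ i, x i • b i) := by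
    rw [stdVector, map_pi_eq_stdGaussian, stdGaussian_eq_map_pi_orthonormalBasis b]
  have hc : Measurable fun (z : EuclideanSpace ℝ (Fin n)) (i : Fin n) => inner ℝ (b i) z := by
    fun_prop
  have h2 := congrArg (Measure.map fun (z : EuclideanSpace ℝ (Fin n)) (i : Fin n) =>
    inner ℝ (b i) z) h1
  rw [Measure.map_map hc (by fun_prop), Measure.map_map hc (by fun_prop)] at h2
  have e1 : (fun (z : EuclideanSpace ℝ (Fin n)) (i : Fin n) => inner ℝ (b i) z) ∘
      WithLp.toLp 2 = fun x i => ∑ k, b i k * x k := by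
    funext x i
    simp [PiLp.inner_apply, mul_comm]
  have e2 : (fun (z : EuclideanSpace ℝ (Fin n)) (i : Fin n) => inner ℝ (b i) z) ∘
      (fun x : Fin n → ℝ => ∑ i, x i • b i) = id := by
    funext x i
    simp only [Function.comp_apply, id]
    rw [b.orthonormal.inner_right_fintype]
  rw [e1, e2, Measure.map_id] at h2
  exact h2

lemma sum_sq_coordinates (b : OrthonormalBasis (Fin n) ℝ (EuclideanSpace ℝ (Fin n)))
    (x : Fin n → ℝ) : ∑ i, (∑ k, b i k * x k) ^ 2 = ∑ k, x k ^ 2 := by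
  have h := b.sum_sq_inner_right (WithLp.toLp 2 x)
  rw [EuclideanSpace.real_norm_sq_eq] at h
  rw [← h]
  refine Finset.sum_congr rfl fun i _ => ?_
  simp [PiLp.inner_apply, mul_comm]

/-- The constant unit vector. -/
def meanDirection (n : ℕ) : EuclideanSpace ℝ (Fin n) := WithLp.toLp 2 fun _ => (√n)⁻¹

lemma meanDirection_inner_self (hn : n ≠ 0) :
    inner ℝ (meanDirection n) (meanDirection n) = 1 := by
  have hn' : (0 : ℝ) < n := Nat.cast_pos.2 (Nat.pos_of_ne_zero hn)
  simp only [meanDirection, PiLp.inner_apply]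
  simp [hn'.ne']

lemma sum_meanDirection (x : Fin n → ℝ) :
    (∑ k, meanDirection n k * x k) ^ 2 = (∑ k, x k) ^ 2 / n := by
  simp only [meanDirection, ← Finset.mul_sum]
  rw [mul_pow, inv_pow, Real.sq_sqrt (Nat.cast_nonneg n)]
  ring

lemma map_tail_stdVector (m : ℕ) :
    (stdVector (m + 1)).map (fun y => (y 0, Fin.tail y)) =
      (gaussianReal 0 1).prod (stdVector m) := by
  have h := measurePreserving_piFinSuccAbove (fun _ : Fin (m + 1) => gaussianReal 0 1) 0
  have h1 : (MeasurableEquiv.piFinSuccAbove (fun _ : Fin (m + 1) => ℝ) 0 : _ → _) =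
      fun y : Fin (m + 1) → ℝ => (y 0, Fin.tail y) := by
    funext y
    simp [MeasurableEquiv.piFinSuccAbove, Fin.insertNthEquiv]
  rw [← h1]
  exact h.map_eq

lemma measurable_tail (m : ℕ) : Measurable fun y : Fin (m + 1) → ℝ => (y 0, Fin.tail y) := by
  unfold Fin.tail
  fun_prop

/-- The centered sum of squares of `m + 2` standard normal variables is the sum of the squares of the
`m + 1` coordinates orthogonal to the constant direction. -/
lemma map_centered_sum_sq (m : ℕ) :
    (stdVector (m + 2)).map (fun x => ∑ k, x k ^ 2 - (∑ k, x k) ^ 2 / ((m + 2 : ℕ) : ℝ)) =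
      chiSquared ((m : ℝ) + 1) := by
  obtain ⟨b, hb⟩ := Orthonormal.exists_orthonormalBasis_extension_of_card_eq (𝕜 := ℝ)
    (E := EuclideanSpace ℝ (Fin (m + 2))) (ι := Fin (m + 2)) (by simp)
    (v := fun _ => meanDirection (m + 2)) (s := {0}) (by
      rw [orthonormal_iff_ite]
      rintro ⟨i, rfl⟩ ⟨j, rfl⟩
      simpa using meanDirection_inner_self (n := m + 2) (by omega))
  have hb0 : b 0 = meanDirection (m + 2) := hb 0 rfl
  have e : (fun x : Fin (m + 2) → ℝ => ∑ k, x k ^ 2 - (∑ k, x k) ^ 2 / ((m + 2 : ℕ) : ℝ)) =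
      (fun y : Fin (m + 1) → ℝ => ∑ i, y i ^ 2) ∘ Prod.snd ∘
        (fun y : Fin (m + 2) → ℝ => (y 0, Fin.tail y)) ∘
        (fun x i => ∑ k, b i k * x k) := by
    funext x
    have h := sum_sq_coordinates b x
    rw [Fin.sum_univ_succ, hb0, sum_meanDirection] at h
    rw [← h]
    simp [Fin.tail]
  rw [e, ← Measure.map_map (by fun_prop)
      (measurable_snd.comp ((measurable_tail _).comp (by fun_prop))),
    ← Measure.map_map measurable_snd ((measurable_tail _).comp (by fun_prop)),
    ← Measure.map_map (measurable_tail _) (by fun_prop), map_coordinates_stdVector,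
    map_tail_stdVector, Measure.map_snd_prod, measure_univ, one_smul]
  exact map_sum_sq_pi_gaussianReal m

/-- The component of a standard normal vector along a centered unit vector is independent of the
residual sum of squares: the two use different coordinates in an orthonormal basis containing the
constant direction and that unit vector. -/
lemma map_projection (m : ℕ) {c : Fin (m + 3) → ℝ} (hc0 : ∑ k, c k = 0) (hc1 : ∑ k, c k ^ 2 = 1) :
    (stdVector (m + 3)).map (fun x => (∑ k, c k * x k,
      ∑ k, x k ^ 2 - (∑ k, x k) ^ 2 / ((m + 3 : ℕ) : ℝ) - (∑ k, c k * x k) ^ 2)) =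
      (gaussianReal 0 1).prod (chiSquared ((m : ℝ) + 1)) := by
  have hM := meanDirection_inner_self (n := m + 3) (by omega)
  have hcc : inner ℝ (WithLp.toLp 2 c : EuclideanSpace ℝ (Fin (m + 3))) (WithLp.toLp 2 c) = 1 := by
    rw [← hc1]
    simp only [PiLp.inner_apply]
    simp [sq]
  have hMc : inner ℝ (meanDirection (m + 3)) (WithLp.toLp 2 c) = 0 := by
    simp only [meanDirection, PiLp.inner_apply]
    simp [← Finset.sum_mul, hc0]
  obtain ⟨b, hb⟩ := Orthonormal.exists_orthonormalBasis_extension_of_card_eq (𝕜 := ℝ)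
    (E := EuclideanSpace ℝ (Fin (m + 3))) (ι := Fin (m + 3)) (by simp)
    (v := fun i => if i = 0 then meanDirection (m + 3) else WithLp.toLp 2 c) (s := {0, 1}) (by
      rw [orthonormal_iff_ite]
      rintro ⟨i, rfl | rfl⟩ ⟨j, rfl | rfl⟩
      · simpa using hM
      · rw [if_neg (by simp [Subtype.ext_iff])]
        simpa using hMc
      · rw [if_neg (by simp [Subtype.ext_iff])]
        simpa [real_inner_comm] using hMc
      · simpa using hcc)
  have hb0 : b 0 = meanDirection (m + 3) := by simpa using hb 0 (by simp)
  have hb1 : b 1 = WithLp.toLp 2 c := by simpa using hb 1 (by simp)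
  have e : (fun x : Fin (m + 3) → ℝ => (∑ k, c k * x k,
      ∑ k, x k ^ 2 - (∑ k, x k) ^ 2 / ((m + 3 : ℕ) : ℝ) - (∑ k, c k * x k) ^ 2)) =
      Prod.map id (fun y : Fin (m + 1) → ℝ => ∑ i, y i ^ 2) ∘
        (fun y : Fin (m + 2) → ℝ => (y 0, Fin.tail y)) ∘ Prod.snd ∘
        (fun y : Fin (m + 3) → ℝ => (y 0, Fin.tail y)) ∘
        (fun x i => ∑ k, b i k * x k) := by
    funext x
    have h := sum_sq_coordinates b x
    rw [Fin.sum_univ_succ, hb0, sum_meanDirection,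
      Fin.sum_univ_succ fun i : Fin (m + 2) => (∑ k, b i.succ k * x k) ^ 2,
      Fin.succ_zero_eq_one, hb1] at h
    rw [← h]
    simp [Fin.tail, hb1]
  have m1 : Measurable fun (x : Fin (m + 3) → ℝ) i => ∑ k, b i k * x k := by fun_prop
  have m2 := (measurable_tail (m + 2)).comp m1
  have m3 := measurable_snd.comp m2
  have m4 := (measurable_tail (m + 1)).comp m3
  rw [e, ← Measure.map_map (by fun_prop) m4, ← Measure.map_map (measurable_tail _) m3,
    ← Measure.map_map measurable_snd m2, ← Measure.map_map (measurable_tail _) m1,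
    map_coordinates_stdVector, map_tail_stdVector, Measure.map_snd_prod, measure_univ, one_smul,
    map_tail_stdVector, ← Measure.map_prod_map _ _ measurable_id (by fun_prop), Measure.map_id]
  congr 1
  exact map_sum_sq_pi_gaussianReal m

/-! ### Independence of the Bartlett components -/

lemma s₁₁_zip (hn : n ≠ 0) (x y : Fin n → ℝ) :
    s₁₁ (fun k => (x k, y k)) = ∑ k, x k ^ 2 - (∑ k, x k) ^ 2 / n := by
  have hn' : (n : ℝ) ≠ 0 := Nat.cast_ne_zero.2 hn
  have h := sum_sub_sq₁ hn (fun k => (x k, y k)) 0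
  simp only [sub_zero, mean₁] at h
  rw [h]
  field_simp
  ring

lemma s₂₂_zip (hn : n ≠ 0) (x y : Fin n → ℝ) :
    s₂₂ (fun k => (x k, y k)) = ∑ k, y k ^ 2 - (∑ k, y k) ^ 2 / n := by
  have hn' : (n : ℝ) ≠ 0 := Nat.cast_ne_zero.2 hn
  have h := sum_sub_sq₂ hn (fun k => (x k, y k)) 0
  simp only [sub_zero, mean₂] at h
  rw [h]
  field_simp
  ring

lemma s₁₂_zip (hn : n ≠ 0) (x y : Fin n → ℝ) :
    s₁₂ (fun k => (x k, y k)) = ∑ k, (x k - (∑ j, x j) / n) * y k := by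
  have h := sum_sub_mul_sub hn (fun k => (x k, y k)) (mean₁ fun k => (x k, y k)) 0
  simp only [sub_zero, sub_self, mul_zero, zero_mul, add_zero] at h
  rw [← h]
  simp only [mean₁]

lemma measurable_bartlett : Measurable (bartlett : (Fin n → ℝ × ℝ) → ℝ × ℝ × ℝ) := by
  unfold bartlett s₁₂ s₁₁ s₂₂ mean₁ mean₂
  fun_prop

lemma measurable_sampleCorr : Measurable (sampleCorr : (Fin n → ℝ × ℝ) → ℝ) := by
  unfold sampleCorr s₁₂ s₁₁ s₂₂ mean₁ mean₂
  fun_prop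

/-- For a sample of standard normal pairs, `s₁₂ / √s₁₁`, `s₁₁` and `s₂₂ - s₁₂² / s₁₁` are
independent. Given the first coordinates, the first and the third are the component along the
centered first coordinates and the residual sum of squares of the second coordinates. -/
lemma map_bartlett (m : ℕ) :
    (stdSample (m + 3)).map bartlett = normalChiChi ((m : ℝ) + 2) ((m : ℝ) + 1) := by
  have hm : ((m : ℝ) + 2) = ((m + 1 : ℕ) : ℝ) + 1 := by
    push_cast
    ring
  rw [hm]
  set T : (Fin (m + 3) → ℝ) × (Fin (m + 3) → ℝ) → ℝ × ℝ × ℝ :=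
    fun p => bartlett fun k => (p.1 k, p.2 k) with hTdef
  have hT : Measurable T := measurable_bartlett.comp (by fun_prop)
  have hpres := measurePreserving_arrowProdEquivProdArrow ℝ ℝ (Fin (m + 3))
    (fun _ => gaussianReal 0 1) (fun _ => gaussianReal 0 1)
  have e1 : (bartlett : (Fin (m + 3) → ℝ × ℝ) → _) =
      T ∘ MeasurableEquiv.arrowProdEquivProdArrow ℝ ℝ (Fin (m + 3)) := by
    funext z
    rfl
  have e2 : (stdSample (m + 3)).map bartlett =
      ((stdVector (m + 3)).prod (stdVector (m + 3))).map T := by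
    rw [e1, ← Measure.map_map hT hpres.measurable]
    exact congrArg _ hpres.map_eq
  have hS : Measurable fun x : Fin (m + 3) → ℝ =>
      ∑ k, x k ^ 2 - (∑ k, x k) ^ 2 / ((m + 3 : ℕ) : ℝ) := by fun_prop
  have hSmap := map_centered_sum_sq (m + 1)
  rw [show m + 1 + 2 = m + 3 by ring] at hSmap
  have hpos : ∀ᵐ x ∂stdVector (m + 3), 0 < ∑ k, x k ^ 2 - (∑ k, x k) ^ 2 / ((m + 3 : ℕ) : ℝ) := by
    refine ae_of_ae_map hS.aemeasurable ?_
    rw [hSmap]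
    exact ae_pos_chiSquared _
  rw [e2]
  refine Measure.ext_of_lintegral _ fun g hg => ?_
  have hgT : Measurable fun p => g (T p) := hg.comp hT
  have hg' : Measurable fun q : ℝ × ℝ × ℝ => g (q.2.1, q.1, q.2.2) := hg.comp (by fun_prop)
  rw [lintegral_map hg hT, lintegral_prod _ hgT.aemeasurable]
  have inner : ∀ᵐ x ∂stdVector (m + 3), ∫⁻ y, g (T (x, y)) ∂stdVector (m + 3) =
      ∫⁻ q, g (q.1, ∑ k, x k ^ 2 - (∑ k, x k) ^ 2 / ((m + 3 : ℕ) : ℝ), q.2)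
        ∂(gaussianReal 0 1).prod (chiSquared ((m : ℝ) + 1)) := by
    filter_upwards [hpos] with x hx
    obtain ⟨A, hA⟩ : ∃ A, ∑ k, x k ^ 2 - (∑ k, x k) ^ 2 / ((m + 3 : ℕ) : ℝ) = A := ⟨_, rfl⟩
    rw [hA] at hx ⊢
    have hA' := Real.sqrt_pos.2 hx
    have hA2 := Real.sq_sqrt hx.le
    have hs11 : ∀ y : Fin (m + 3) → ℝ, s₁₁ (fun k => (x k, y k)) = A := fun y => by
      rw [s₁₁_zip (by omega), hA]
    have hgA : Measurable fun q : ℝ × ℝ => g (q.1, A, q.2) := hg.comp (by fun_prop)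
    rw [← map_projection m (c := fun k => (x k - (∑ j, x j) / ((m + 3 : ℕ) : ℝ)) / √A),
      lintegral_map hgA (by fun_prop)]
    · refine lintegral_congr fun y => congrArg g ?_
      have e : ∑ k, (x k - (∑ j, x j) / ((m + 3 : ℕ) : ℝ)) / √A * y k =
          s₁₂ (fun k => (x k, y k)) / √A := by
        rw [s₁₂_zip (by omega)]
        exact (Finset.sum_congr rfl fun k _ => by ring).trans (Finset.sum_div _ _ _).symm
      simp only [hTdef, bartlett, hs11, s₂₂_zip (show m + 3 ≠ 0 by omega)]
      rw [e, div_pow, hA2]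
    · rw [← Finset.sum_div, Finset.sum_sub_distrib]
      simp only [Finset.sum_const, Finset.card_univ, Fintype.card_fin, nsmul_eq_mul]
      rw [mul_div_cancel₀ _ (by positivity), sub_self, zero_div]
    · simp_rw [div_pow, ← Finset.sum_div, hA2]
      rw [div_eq_one_iff_eq hx.ne']
      have h := hs11 0
      simpa only [s₁₁, mean₁] using h
  rw [lintegral_congr_ae inner]
  have hG : Measurable fun u : ℝ => ∫⁻ q, g (q.1, u, q.2)
      ∂(gaussianReal 0 1).prod (chiSquared ((m : ℝ) + 1)) := hg'.lintegral_prod_right'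
  rw [← lintegral_map hG hS, hSmap, normalChiChi, lintegral_prod _ hg.aemeasurable]
  have e3 : ∀ u, ∫⁻ q, g (q.1, u, q.2) ∂(gaussianReal 0 1).prod (chiSquared ((m : ℝ) + 1)) =
      ∫⁻ z, ∫⁻ v, g (z, u, v) ∂chiSquared ((m : ℝ) + 1) ∂gaussianReal 0 1 := fun u =>
    lintegral_prod _ (hg'.comp measurable_prodMk_left).aemeasurable
  simp only [e3]
  have hg'' : Measurable fun r : (ℝ × ℝ) × ℝ => g (r.1.2, r.1.1, r.2) := hg.comp (by fun_prop)
  rw [lintegral_lintegral_swap hg''.lintegral_prod_right'.aemeasurable]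
  refine lintegral_congr fun z => ?_
  exact (lintegral_prod _ (hg.comp measurable_prodMk_left).aemeasurable).symm

/-- Almost every bivariate normal sample of size at least three is nondegenerate, and
`√(1 - ρ²) r / √(1 - r²)` is a function of the Bartlett components of a standard sample. -/
lemma ae_nondegenerate (hn : 3 ≤ n) (μ₁ μ₂ : ℝ) {σ₁ σ₂ ρ : ℝ} (h₁ : 0 < σ₁)
    (h₂ : 0 < σ₂) (hρ : ρ ∈ Ioo (-1 : ℝ) 1) :
    ∀ᵐ z ∂stdSample n, Nondegenerate (fun k => affinePair μ₁ μ₂ σ₁ σ₂ ρ (z k)) ∧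
    √(1 - ρ ^ 2) * (sampleCorr (fun k => affinePair μ₁ μ₂ σ₁ σ₂ ρ (z k)) /
      √(1 - sampleCorr (fun k => affinePair μ₁ μ₂ σ₁ σ₂ ρ (z k)) ^ 2)) =
      (√(1 - ρ ^ 2) * (bartlett z).1 + ρ * √(bartlett z).2.1) / √(bartlett z).2.2 := by
  obtain ⟨m, rfl⟩ : ∃ m, n = m + 3 := ⟨n - 3, by omega⟩
  have h : ∀ᵐ p ∂(stdSample (m + 3)).map bartlett, 0 < p.2.1 ∧ 0 < p.2.2 := by
    rw [map_bartlett, normalChiChi]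
    exact Measure.quasiMeasurePreserving_snd.ae (ae_pos_chiSquared_prod _ _)
  filter_upwards [ae_of_ae_map measurable_bartlett.aemeasurable h] with z hz
  exact nondegenerate_affinePair (by omega) μ₁ μ₂ h₁ h₂ hρ hz.1 hz.2

/-! ### Coverage and fiducial distribution -/

/-- The sampling probability of an event which, on nondegenerate samples, depends only on
`√(1 - ρ²) r / √(1 - r²)`. -/
lemma sampleLaw_apply (hn : 3 ≤ n) (μ₁ μ₂ : ℝ) {σ₁ σ₂ ρ : ℝ} (h₁ : 0 < σ₁)
    (h₂ : 0 < σ₂) (hρ : ρ ∈ Ioo (-1 : ℝ) 1) {E : Set (Fin n → ℝ × ℝ)} {B : Set ℝ}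
    (hB : MeasurableSet B) (hE : ∀ x, Nondegenerate x →
      (x ∈ E ↔ √(1 - ρ ^ 2) * (sampleCorr x / √(1 - sampleCorr x ^ 2)) ∈ B)) :
    sampleLaw n μ₁ μ₂ σ₁ σ₂ ρ E = ratioLaw ρ (n - 1) (n - 2) B := by
  have hA : Measurable fun (z : Fin n → ℝ × ℝ) k => affinePair μ₁ μ₂ σ₁ σ₂ ρ (z k) :=
    measurable_pi_lambda _ fun k => (measurable_affinePair _ _ _ _ _).comp (measurable_pi_apply k)
  have hae := ae_nondegenerate hn μ₁ μ₂ h₁ h₂ hρ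
  have hcorr : Measurable fun x : Fin n → ℝ × ℝ =>
      √(1 - ρ ^ 2) * (sampleCorr x / √(1 - sampleCorr x ^ 2)) := by
    have := measurable_sampleCorr (n := n)
    fun_prop
  have hND : ∀ᵐ x ∂sampleLaw n μ₁ μ₂ σ₁ σ₂ ρ, Nondegenerate x := by
    have hms : MeasurableSet {x : Fin n → ℝ × ℝ | Nondegenerate x} := by
      have h1 : Measurable (s₁₁ : (Fin n → ℝ × ℝ) → ℝ) := by
        unfold s₁₁ mean₁
        fun_prop
      have h2 : Measurable (s₂₂ : (Fin n → ℝ × ℝ) → ℝ) := by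
        unfold s₂₂ mean₂
        fun_prop
      have h3 : Measurable fun x : Fin n → ℝ × ℝ => |sampleCorr x| :=
        measurable_sampleCorr.abs
      exact (measurableSet_lt measurable_const h1).inter
        ((measurableSet_lt measurable_const h2).inter (measurableSet_lt h3 measurable_const))
    rw [sampleLaw_eq_map n h₁ h₂ hρ, ae_map_iff hA.aemeasurable hms]
    exact hae.mono fun z hz => hz.1
  have hset : E =ᵐ[sampleLaw n μ₁ μ₂ σ₁ σ₂ ρ]
      (fun x => √(1 - ρ ^ 2) * (sampleCorr x / √(1 - sampleCorr x ^ 2))) ⁻¹' B := by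
    filter_upwards [hND] with x hx
    exact propext (hE x hx)
  obtain ⟨m, rfl⟩ : ∃ m, n = m + 3 := ⟨n - 3, by omega⟩
  have ek : ((m + 3 : ℕ) : ℝ) - 1 = (m : ℝ) + 2 := by
    push_cast
    ring
  have el : ((m + 3 : ℕ) : ℝ) - 2 = (m : ℝ) + 1 := by
    push_cast
    ring
  rw [measure_congr hset, sampleLaw_eq_map _ h₁ h₂ hρ, Measure.map_apply hA (hcorr hB), ratioLaw,
    ek, el, ← map_bartlett, Measure.map_map (measurable_ratio ρ) measurable_bartlett,
    Measure.map_apply ((measurable_ratio ρ).comp measurable_bartlett) hB]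
  refine measure_congr ?_
  filter_upwards [hae] with z hz
  refine propext ?_
  change √(1 - ρ ^ 2) * (_ / _) ∈ B ↔ _ ∈ B
  rw [hz.2]
  rfl

/-- The credible interval covers `ρ` when `√(1 - ρ²) r / √(1 - r²)` exceeds a quantile, so that the
coverage is a value of the survival function of this statistic. -/
lemma coverage_eq (hn : 3 ≤ n) {a b : ℝ} (ha : a < n) (hb : b < n) {α : ℝ}
    (hα : α ∈ Ioo (0 : ℝ) 1) (μ₁ μ₂ : ℝ) {σ₁ σ₂ ρ : ℝ} (h₁ : 0 < σ₁) (h₂ : 0 < σ₂)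
    (hρ : ρ ∈ Ioo (-1 : ℝ) 1) :
    coverage n a b α μ₁ μ₂ σ₁ σ₂ ρ =
      (ratioLaw ρ (n - 1) (n - 2)).real (Ioi (quantile (ratioLaw ρ (n - a) (n - b)) α)) := by
  have h := sampleLaw_apply hn μ₁ μ₂ h₁ h₂ hρ
    (E := {x | ρ ∈ Ioo (-1) (quantile (posteriorRho a b x) (1 - α))}) measurableSet_Ioi fun x hx =>
      mem_credibleInterval_iff (by omega) ha hb hx hα hρ
  rw [coverage, measureReal_def, measureReal_def, h]

lemma isProbabilityMeasure_ratioLaw {k l : ℝ} (hk : 0 < k) (hl : 0 < l) (ρ : ℝ) :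
    IsProbabilityMeasure (ratioLaw ρ k l) := by
  have := isProbabilityMeasure_normalChiChi hk hl
  exact Measure.isProbabilityMeasure_map (measurable_ratio _).aemeasurable

lemma ratioLaw_real_Ioi {k l : ℝ} (hk : 0 < k) (hl : 0 < l) {ρ : ℝ} (hρ : ρ ∈ Ioo (-1 : ℝ) 1)
    (q : ℝ) :
    (ratioLaw ρ k l).real (Ioi q) = mixture k l (ρ / √(1 - ρ ^ 2)) (q / √(1 - ρ ^ 2)) := by
  have := isProbabilityMeasure_ratioLaw hk hl ρ
  have h0 : 0 ≤ 1 - mixture k l (ρ / √(1 - ρ ^ 2)) (q / √(1 - ρ ^ 2)) := by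
    rw [one_sub_mixture hk hl]
    exact mixture_nonneg _ _ _ _
  rw [← compl_Iic, probReal_compl_eq_one_sub measurableSet_Iic, measureReal_def,
    ratioLaw_Iic hk hl hρ, ENNReal.toReal_ofReal h0]
  ring

/-- Under the right-Haar prior the posterior distribution of the correlation is its fiducial
distribution. -/
lemma posteriorRho_eq_fiducialCDF (hn : 3 ≤ n) {x : Fin n → ℝ × ℝ} (hx : Nondegenerate x)
    (μ₁ μ₂ : ℝ) {σ₁ σ₂ ρ : ℝ} (h₁ : 0 < σ₁) (h₂ : 0 < σ₂) (hρ : ρ ∈ Ioo (-1 : ℝ) 1) :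
    (posteriorRho 1 2 x).real (Iic ρ) = fiducialCDF n μ₁ μ₂ σ₁ σ₂ (sampleCorr x) ρ := by
  have h3 : (3 : ℝ) ≤ n := by exact_mod_cast hn
  have h1n : (1 : ℝ) < n := by linarith
  have h2n : (2 : ℝ) < n := by linarith
  have hk := sub_pos.2 h1n
  have hl := sub_pos.2 h2n
  have hw := Real.sqrt_pos.2 (one_sub_sq_pos hρ)
  have hE : ∀ y : Fin n → ℝ × ℝ, Nondegenerate y → (y ∈ {y | sampleCorr y ≤ sampleCorr x} ↔
      √(1 - ρ ^ 2) * (sampleCorr y / √(1 - sampleCorr y ^ 2)) ∈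
        Iic (√(1 - ρ ^ 2) * (sampleCorr x / √(1 - sampleCorr x ^ 2)))) := fun y hy => by
    rw [mem_Iic, mul_le_mul_iff_right₀ hw, ← psi_le_iff (abs_lt.1 hx.2.2),
      psi_div_sqrt (abs_lt.1 hy.2.2)]
    rfl
  have h0 : 0 ≤ 1 - mixture (n - 1) (n - 2) (ρ / √(1 - ρ ^ 2))
      (sampleCorr x / √(1 - sampleCorr x ^ 2)) := by
    rw [one_sub_mixture hk hl]
    exact mixture_nonneg _ _ _ _
  rw [fiducialCDF, measureReal_def, measureReal_def,
    sampleLaw_apply hn μ₁ μ₂ h₁ h₂ hρ measurableSet_Iic hE, ratioLaw_Iic hk hl hρ,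
    posteriorRho_Iic (by omega) h1n h2n hx hρ, ENNReal.toReal_ofReal (mixture_nonneg _ _ _ _),
    mul_div_cancel_left₀ _ hw.ne', ENNReal.toReal_ofReal h0]
  ring

end

/-! ### Monotonicity in the degrees of freedom -/

/-- Since `χ²_{k'} = χ²_k + χ²_{k' - k}` in law, chi-squared distributions are strictly stochastically
increasing in the degrees of freedom. -/
lemma integral_chiSquared_lt {k k' : ℝ} (hk : 0 < k) (h : k < k') {f : ℝ → ℝ} (hf : Measurable f)
    (hb : ∀ u, ‖f u‖ ≤ 1) (hmono : StrictMonoOn f (Ioi 0)) :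
    ∫ u, f u ∂chiSquared k < ∫ u, f u ∂chiSquared k' := by
  have hd : 0 < k' - k := sub_pos.2 h
  have := isProbabilityMeasure_chiSquared hk
  have := isProbabilityMeasure_chiSquared hd
  have e1 : ∫ u, f u ∂chiSquared k' =
      ∫ p, f (p.1 + p.2) ∂(chiSquared k).prod (chiSquared (k' - k)) := by
    rw [← integral_map (φ := fun p : ℝ × ℝ => p.1 + p.2) (by fun_prop)
      hf.aestronglyMeasurable, map_add_chiSquared hk hd, add_sub_cancel]
  have e2 : ∫ u, f u ∂chiSquared k =
      ∫ p, f p.1 ∂(chiSquared k).prod (chiSquared (k' - k)) := by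
    rw [integral_fun_fst]
    simp
  have h1 : Measurable fun p : ℝ × ℝ => f p.1 := hf.comp measurable_fst
  have h2 : Measurable fun p : ℝ × ℝ => f (p.1 + p.2) := hf.comp (by fun_prop)
  rw [e1, e2]
  refine integral_lt_integral_of_ae_lt
    (Integrable.of_bound h1.aestronglyMeasurable 1 (ae_of_all _ fun p => hb _))
    (Integrable.of_bound h2.aestronglyMeasurable 1 (ae_of_all _ fun p => hb _))
    ((ae_pos_chiSquared_prod _ _).mono fun p hp => ?_)
  exact hmono hp.1 (add_pos hp.1 hp.2) (by linarith [hp.2])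

lemma mixture_lt_of_lt_left {k k' l c : ℝ} (hk : 0 < k) (h : k < k') (hl : 0 < l) (hc : 0 < c)
    (t : ℝ) : mixture k l c t < mixture k' l c t := by
  have hk' := hk.trans h
  have := isProbabilityMeasure_chiSquared hk
  have := isProbabilityMeasure_chiSquared hk'
  have := isProbabilityMeasure_chiSquared hl
  rw [mixture, mixture, integral_prod _ (integrable_mixture hk hl c t),
    integral_prod _ (integrable_mixture hk' hl c t)]
  have hI : ∀ u, Integrable (fun v => Phi (c * √u - t * √v)) (chiSquared l) := fun u =>
    Integrable.of_bound (measurable_Phi.comp (by fun_prop)).aestronglyMeasurable 1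
      (ae_of_all _ fun p => norm_Phi_le _)
  refine integral_chiSquared_lt hk h ?_ (fun u => ?_) fun u hu v hv huv => ?_
  · exact (measurable_mixture_integrand c t).stronglyMeasurable.integral_prod_right'.measurable
  · refine (norm_integral_le_of_norm_le_const (ae_of_all _ fun v => norm_Phi_le _)).trans ?_
    simp
  · refine integral_lt_integral_of_ae_lt (hI u) (hI v) (ae_of_all _ fun w => strictMono_Phi ?_)
    have := mul_lt_mul_of_pos_left (Real.sqrt_lt_sqrt (le_of_lt hu) huv) hc
    linarith

lemma mixture_injective_left {k k' l c t : ℝ} (hk : 0 < k) (hk' : 0 < k') (hl : 0 < l) (hc : 0 < c)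
    (h : mixture k l c t = mixture k' l c t) : k = k' := by
  rcases lt_trichotomy k k' with h' | h' | h'
  · exact absurd h (mixture_lt_of_lt_left hk h' hl hc t).ne
  · exact h'
  · exact absurd h (mixture_lt_of_lt_left hk' h' hl hc t).ne'

lemma mixture_swap (k l c t : ℝ) : mixture k l c t = mixture l k (-t) (-c) := by
  rw [mixture, mixture, ← integral_prod_swap]
  refine integral_congr_ae (ae_of_all _ fun p => ?_)
  simp only [Prod.fst_swap, Prod.snd_swap]
  congr 1
  ring

lemma mixture_zero_left {k : ℝ} (hk : 0 < k) (l t : ℝ) :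
    mixture k l 0 t = ∫ v, Phi (-t * √v) ∂chiSquared l := by
  have := isProbabilityMeasure_chiSquared hk
  have h : ∀ p : ℝ × ℝ, Phi (0 * √p.1 - t * √p.2) = Phi (-t * √p.2) := fun p => by
    congr 1
    ring
  simp_rw [mixture, h]
  rw [integral_fun_snd (μ := chiSquared k) (ν := chiSquared l) fun v => Phi (-t * √v)]
  simp

/-- Off the median, the values at `c = 0` and at one `c > 0` determine both degrees of freedom. -/
lemma eq_of_mixture_eq_of_ne_half {k l k' l' t c s p : ℝ} (hk : 0 < k) (hl : 0 < l) (hk' : 0 < k')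
    (hl' : 0 < l') (hp : p ≠ 1 / 2) (h0 : mixture k l 0 t = p) (h0' : mixture k' l' 0 t = p)
    (hc : 0 < c) (h : mixture k l c s = mixture k' l' c s) : k = k' ∧ l = l' := by
  have ht : t ≠ 0 := by
    rintro rfl
    have := isProbabilityMeasure_chiSquared hl
    rw [mixture_zero_left hk] at h0
    simp [Phi_zero] at h0
    exact hp (by rw [← h0]; norm_num)
  have hl1 : l = l' := by
    have e : mixture k l 0 t = mixture k l' 0 t := by
      rw [h0, ← h0', mixture_zero_left hk', mixture_zero_left hk]
    rcases ht.lt_or_gt with ht | ht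
    · rw [mixture_swap, mixture_swap k l'] at e
      exact mixture_injective_left hl hl' hk (neg_pos.2 ht) e
    · have e' : mixture k l (-0) (-t) = mixture k l' (-0) (-t) := by
        rw [← one_sub_mixture hk hl, ← one_sub_mixture hk hl', e]
      rw [mixture_swap, mixture_swap k l', neg_neg] at e'
      exact mixture_injective_left hl hl' hk ht e'
  subst hl1
  exact ⟨mixture_injective_left hk hk' hl hc h, rfl⟩

/-! ### Moments of chi variables -/

/-- The reciprocal `2^{k/2} Γ(k/2)` of the normalizing constant of the chi-squared density. -/
def chiNorm (k : ℝ) : ℝ := 2 ^ (k / 2) * Real.Gamma (k / 2)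

lemma chiNorm_pos {k : ℝ} (hk : 0 < k) : 0 < chiNorm k :=
  mul_pos (by positivity) (Real.Gamma_pos_of_pos (half_pos hk))

lemma chiNorm_add_two {k : ℝ} (hk : 0 < k) : chiNorm (k + 2) = k * chiNorm k := by
  rw [chiNorm, chiNorm, show (k + 2) / 2 = k / 2 + 1 by ring, Real.Gamma_add_one (by positivity),
    Real.rpow_add_one (by norm_num)]
  ring

lemma chiConst_eq (k : ℝ) : chiConst k = ENNReal.ofReal (chiNorm k)⁻¹ := by
  rw [chiConst, chiNorm, mul_inv, one_div, Real.inv_rpow (by norm_num), div_eq_mul_inv]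

lemma lintegral_chiKernel {k : ℝ} (hk : 0 < k) :
    ∫⁻ u, chiKernel k u = ENNReal.ofReal (chiNorm k) := by
  have := isProbabilityMeasure_chiSquared hk
  have h := lintegral_chiSquared_eq hk (g := fun _ => 1) measurable_const
  rw [lintegral_one, measure_univ, chiConst_eq] at h
  simp only [mul_one] at h
  have hp := chiNorm_pos hk
  calc ∫⁻ u, chiKernel k u = ENNReal.ofReal (chiNorm k) *
        (ENNReal.ofReal (chiNorm k)⁻¹ * ∫⁻ u, chiKernel k u) := by
        rw [← mul_assoc, ← ENNReal.ofReal_mul hp.le, mul_inv_cancel₀ hp.ne', ENNReal.ofReal_one,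
          one_mul]
    _ = _ := by rw [← h, mul_one]

lemma lintegral_sqrt_pow_chiSquared {k : ℝ} (hk : 0 < k) (j : ℕ) :
    ∫⁻ u, ENNReal.ofReal (√u ^ j) ∂chiSquared k =
      ENNReal.ofReal (chiNorm (k + j) / chiNorm k) := by
  have hp := chiNorm_pos hk
  rw [lintegral_chiSquared_eq hk (by fun_prop), chiConst_eq]
  have h : ∀ u, chiKernel k u * ENNReal.ofReal (√u ^ j) = chiKernel (k + j) u := fun u => by
    by_cases hu : 0 < u
    · simp only [chiKernel, mem_Ioi, hu, indicator_of_mem]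
      rw [← ENNReal.ofReal_mul (by positivity), Real.sqrt_eq_rpow, ← Real.rpow_natCast,
        ← Real.rpow_mul hu.le, mul_right_comm, ← Real.rpow_add hu]
      ring_nf
    · simp [chiKernel, hu]
  simp_rw [h]
  rw [lintegral_chiKernel (by positivity), ← ENNReal.ofReal_mul (by positivity)]
  congr 1
  ring

lemma integrable_sqrt_pow_chiSquared {k : ℝ} (hk : 0 < k) (j : ℕ) :
    Integrable (fun u => √u ^ j) (chiSquared k) := by
  refine ⟨by fun_prop, ?_⟩
  rw [hasFiniteIntegral_iff_ofReal (ae_of_all _ fun u => by positivity),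
    lintegral_sqrt_pow_chiSquared hk]
  exact ENNReal.ofReal_lt_top

/-- The moments `E (√χ²_k)^j = 2^{j/2} Γ((k+j)/2) / Γ(k/2)`. -/
lemma integral_sqrt_pow_chiSquared {k : ℝ} (hk : 0 < k) (j : ℕ) :
    ∫ u, √u ^ j ∂chiSquared k = chiNorm (k + j) / chiNorm k := by
  have h1 := chiNorm_pos hk
  have h2 : 0 < chiNorm (k + j) := chiNorm_pos (by positivity)
  rw [integral_eq_lintegral_of_nonneg_ae (ae_of_all _ fun u => by positivity) (by fun_prop),
    lintegral_sqrt_pow_chiSquared hk, ENNReal.toReal_ofReal (by positivity)]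

/-- The mean of `√χ²_k`. -/
def chiMean (k : ℝ) : ℝ := chiNorm (k + 1) / chiNorm k

lemma chiMean_pos {k : ℝ} (hk : 0 < k) : 0 < chiMean k :=
  div_pos (chiNorm_pos (by positivity)) (chiNorm_pos hk)

lemma chiMean_mul_chiMean {k : ℝ} (hk : 0 < k) : chiMean k * chiMean (k + 1) = k := by
  have h1 := chiNorm_pos hk
  have h2 : 0 < chiNorm (k + 1) := chiNorm_pos (by positivity)
  rw [chiMean, chiMean, show k + 1 + 1 = k + 2 by ring, chiNorm_add_two hk]
  field_simp

lemma chiMoment_one {k : ℝ} (hk : 0 < k) : ∫ u, √u ^ 1 ∂chiSquared k = chiMean k := by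
  rw [integral_sqrt_pow_chiSquared hk, chiMean, Nat.cast_one]

lemma chiMoment_add_two {k : ℝ} (hk : 0 < k) (j : ℕ) :
    ∫ u, √u ^ (j + 2) ∂chiSquared k = (k + j) * ∫ u, √u ^ j ∂chiSquared k := by
  rw [integral_sqrt_pow_chiSquared hk, integral_sqrt_pow_chiSquared hk]
  push_cast
  rw [← add_assoc, chiNorm_add_two (by positivity)]
  ring

lemma chiMoment_two {k : ℝ} (hk : 0 < k) : ∫ u, √u ^ 2 ∂chiSquared k = k := by
  have := isProbabilityMeasure_chiSquared hk
  simpa using chiMoment_add_two hk 0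

/-- The variance of `√χ²_k` is nonnegative. -/
lemma chiMean_sq_le {k : ℝ} (hk : 0 < k) : chiMean k ^ 2 ≤ k := by
  have := isProbabilityMeasure_chiSquared hk
  have i1 := integrable_sqrt_pow_chiSquared hk 1
  have i2 := integrable_sqrt_pow_chiSquared hk 2
  have h : 0 ≤ ∫ u, (√u - chiMean k) ^ 2 ∂chiSquared k := integral_nonneg fun u => sq_nonneg _
  have e : ∀ u, (√u - chiMean k) ^ 2 = √u ^ 2 - 2 * chiMean k * √u ^ 1 + chiMean k ^ 2 :=
    fun u => by ring
  have i3 : Integrable (fun u => √u ^ 2 - 2 * chiMean k * √u ^ 1) (chiSquared k) :=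
    i2.sub (i1.const_mul _)
  simp_rw [e] at h
  rw [integral_add i3 (integrable_const _),
    integral_sub i2 (i1.const_mul _), integral_const_mul, chiMoment_one hk, chiMoment_two hk] at h
  simp at h
  linarith

lemma le_chiMean_sq {k : ℝ} (hk : 1 < k) : k - 1 ≤ chiMean k ^ 2 := by
  have h0 : 0 < k - 1 := sub_pos.2 hk
  have h1 := chiMean_mul_chiMean h0
  rw [sub_add_cancel] at h1
  have h2 := chiMean_sq_le h0
  have h3 : (k - 1) * (k - 1) ≤ (k - 1) * chiMean k ^ 2 :=
    calc (k - 1) * (k - 1) = chiMean (k - 1) ^ 2 * chiMean k ^ 2 := by rw [← mul_pow, h1, sq]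
      _ ≤ _ := by gcongr
  exact le_of_mul_le_mul_left h3 h0

/-- The ratio of `E √χ²_k ^ 4` to its second-order asymptotic value. -/
def chiRatio (l : ℝ) : ℝ := chiMean l ^ 4 * (2 * l + 1) / ((2 * l - 1) * l ^ 2)

lemma chiRatio_add_two_lt {l : ℝ} (hl : 1 ≤ l) : chiRatio (l + 2) < chiRatio l := by
  have hl0 : 0 < l := by linarith
  have he := chiMean_pos hl0
  have h1 := chiMean_mul_chiMean hl0
  have h2 := chiMean_mul_chiMean (k := l + 1) (by positivity)
  have e : chiMean (l + 2) = chiMean l * (l + 1) / l := by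
    rw [show l + 1 + 1 = l + 2 by ring] at h2
    rw [eq_div_iff hl0.ne']
    linear_combination chiMean l * h2 - chiMean (l + 2) * h1
  have hm : 0 < 2 * l - 1 := by linarith
  have hm' : 0 < 2 * (l + 2) - 1 := by linarith
  have hp : (l + 1) ^ 4 * (2 * (l + 2) + 1) * (2 * l - 1) <
      (2 * (l + 2) - 1) * (l + 2) ^ 2 * l ^ 2 * (2 * l + 1) := by
    nlinarith [sq_nonneg (l + 1), mul_pos hl0 hl0]
  rw [chiRatio, chiRatio, e, div_lt_div_iff₀ (by positivity) (by positivity)]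
  have : (chiMean l * (l + 1) / l) ^ 4 * (2 * (l + 2) + 1) * ((2 * l - 1) * l ^ 2) =
      chiMean l ^ 4 / l ^ 2 * ((l + 1) ^ 4 * (2 * (l + 2) + 1) * (2 * l - 1)) := by
    field_simp
  rw [this]
  have : chiMean l ^ 4 * (2 * l + 1) * ((2 * (l + 2) - 1) * (l + 2) ^ 2) = chiMean l ^ 4 / l ^ 2 *
      ((2 * (l + 2) - 1) * (l + 2) ^ 2 * l ^ 2 * (2 * l + 1)) := by
    field_simp
  rw [this]
  exact mul_lt_mul_of_pos_left hp (by positivity)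

/-- The ratio is at least `(1 - 1 / l)²`, so it is at least `1` in the limit along `l + 2 j`, and it
decreases strictly along this progression. -/
lemma one_lt_chiRatio {l : ℝ} (hl : 1 ≤ l) : 1 < chiRatio l := by
  have h1 : ∀ j : ℕ, chiRatio (l + 2 + 2 * j) ≤ chiRatio (l + 2) := fun j => by
    induction j with
    | zero => simp
    | succ j ih =>
      refine le_trans (le_of_lt ?_) ih
      have hj : (0 : ℝ) ≤ j := Nat.cast_nonneg j
      have := chiRatio_add_two_lt (l := l + 2 + 2 * j) (by linarith)
      push_cast
      rwa [mul_add, mul_one, ← add_assoc]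
  have h2 : ∀ x : ℝ, 1 < x → (1 - 1 / x) ^ 2 ≤ chiRatio x := fun x hx => by
    have hx0 : 0 < x := by linarith
    have h3 := le_chiMean_sq hx
    have h4 : (x - 1) ^ 2 ≤ chiMean x ^ 4 :=
      calc (x - 1) ^ 2 ≤ (chiMean x ^ 2) ^ 2 := by gcongr
        _ = _ := by ring
    have hm : 0 < 2 * x - 1 := by linarith
    have : (1 - 1 / x) ^ 2 = (x - 1) ^ 2 / x ^ 2 := by
      field_simp
    rw [this, chiRatio, div_le_div_iff₀ (by positivity) (by positivity)]
    have h5 : (x - 1) ^ 2 * (2 * x - 1) ≤ chiMean x ^ 4 * (2 * x + 1) := by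
      gcongr
      linarith
    calc _ = (x - 1) ^ 2 * (2 * x - 1) * x ^ 2 := by ring
      _ ≤ _ := by gcongr
  have h3 : Tendsto (fun j : ℕ => (1 - 1 / (l + 2 + 2 * (j : ℝ))) ^ 2) atTop (𝓝 1) := by
    have : Tendsto (fun j : ℕ => l + 2 + 2 * (j : ℝ)) atTop atTop :=
      tendsto_atTop_add_const_left _ _ (tendsto_natCast_atTop_atTop.const_mul_atTop two_pos)
    simpa using ((tendsto_const_nhds (x := (1 : ℝ))).sub
      (tendsto_const_nhds (x := (1 : ℝ)).div_atTop this)).pow 2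
  have h4 : 1 ≤ chiRatio (l + 2) := le_of_tendsto' h3 fun j =>
    (h2 _ (by nlinarith [(Nat.cast_nonneg j : (0 : ℝ) ≤ j)])).trans (h1 j)
  exact h4.trans_lt (chiRatio_add_two_lt hl)

/-- The squared ratio of the means of `√χ²_{l+1}` and `√χ²_l` is not `(2l + 1) / (2l - 1)`. -/
lemma chiMean_ratio_ne {l : ℝ} (hl : 1 ≤ l) :
    (chiMean (l + 1) / chiMean l) ^ 2 * (2 * l - 1) ≠ 2 * (l + 1) - 1 := by
  intro h
  have hl0 : 0 < l := by linarith
  have he := chiMean_pos hl0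
  have h1 := chiMean_mul_chiMean hl0
  have hm : 0 < 2 * l - 1 := by linarith
  have e : chiMean (l + 1) = l / chiMean l := by
    rw [eq_div_iff he.ne', mul_comm, h1]
  have h2 := one_lt_chiRatio hl
  rw [chiRatio, one_lt_div (by positivity)] at h2
  rw [e] at h
  field_simp at h
  nlinarith

/-! ### Expansion of the mixture at the median -/

section

variable {k l : ℝ}

lemma integrable_sqrt_sub_sqrt_pow (hk : 0 < k) (hl : 0 < l) (s : ℝ) (j : ℕ) :
    Integrable (fun p : ℝ × ℝ => (√p.1 - s * √p.2) ^ j)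
      ((chiSquared k).prod (chiSquared l)) := by
  simp_rw [sub_eq_add_neg, ← neg_mul, add_pow, mul_pow]
  refine integrable_finsetSum _ fun i _ => Integrable.mul_const ?_ _
  exact (integrable_sqrt_pow_chiSquared hk i).mul_prod
    ((integrable_sqrt_pow_chiSquared hl (j - i)).const_mul _)

lemma integral_sqrt_sub_sqrt_pow (hk : 0 < k) (hl : 0 < l) (s : ℝ) (j : ℕ) :
    ∫ p, (√p.1 - s * √p.2) ^ j ∂(chiSquared k).prod (chiSquared l) =
      ∑ i ∈ Finset.range (j + 1), (∫ u, √u ^ i ∂chiSquared k) *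
        ((-s) ^ (j - i) * ∫ v, √v ^ (j - i) ∂chiSquared l) * (j.choose i : ℝ) := by
  simp_rw [sub_eq_add_neg, ← neg_mul, add_pow, mul_pow]
  rw [integral_finsetSum]
  · refine Finset.sum_congr rfl fun i _ => ?_
    rw [integral_mul_const,
      integral_prod_mul (fun u => √u ^ i) fun v => (-s) ^ (j - i) * √v ^ (j - i),
      integral_const_mul]
  · refine fun i _ => Integrable.mul_const ?_ _
    exact (integrable_sqrt_pow_chiSquared hk i).mul_prod
      ((integrable_sqrt_pow_chiSquared hl (j - i)).const_mul _)

/-- `E (√χ²_k - s √χ²_l)³ / E √χ²_l`, where `q = E √χ²_k / E √χ²_l`. -/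
def cubicMoment (k l q s : ℝ) : ℝ :=
  (k + 1) * q - 3 * s * k + 3 * s ^ 2 * l * q - s ^ 3 * (l + 1)

/-- `E (√χ²_k - s √χ²_l)⁵ / E √χ²_l`, where `q = E √χ²_k / E √χ²_l`. -/
def quinticMoment (k l q s : ℝ) : ℝ :=
  (k + 1) * (k + 3) * q - 5 * s * (k * (k + 2)) + 10 * s ^ 2 * ((k + 1) * l * q) -
    10 * s ^ 3 * (k * (l + 1)) + 5 * s ^ 4 * (l * (l + 2) * q) - s ^ 5 * ((l + 1) * (l + 3))

/-- Expansion of `√(2π) (E Φ(c √χ²_k - c s √χ²_l) - 1/2)` as `c → 0`, with an error `O(c⁷)` locally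
uniform in `s`. -/
lemma mixture_expansion (hk : 0 < k) (hl : 0 < l) (B : ℝ) : ∃ C, ∀ c s, 0 < c → |s| ≤ B →
    |√(2 * Real.pi) * (mixture k l c (c * s) - 1 / 2) -
      c * chiMean l * (chiMean k / chiMean l - s -
        c ^ 2 / 6 * cubicMoment k l (chiMean k / chiMean l) s +
        c ^ 4 / 40 * quinticMoment k l (chiMean k / chiMean l) s)| ≤ C * c ^ 7 := by
  have := isProbabilityMeasure_chiSquared hk
  have := isProbabilityMeasure_chiSquared hl
  have he := (chiMean_pos hl).ne'
  refine ⟨∫ p, (√p.1 - -B * √p.2) ^ 7 / 336 ∂(chiSquared k).prod (chiSquared l),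
    fun c s hc hs => ?_⟩
  have k3 := chiMoment_add_two hk 1
  have k4 := chiMoment_add_two hk 2
  have k5 := chiMoment_add_two hk 3
  have l3 := chiMoment_add_two hl 1
  have l4 := chiMoment_add_two hl 2
  have l5 := chiMoment_add_two hl 3
  have k1' : ∫ u, √u ∂chiSquared k = chiMean k := by simpa using chiMoment_one hk
  have l1' : ∫ u, √u ∂chiSquared l = chiMean l := by simpa using chiMoment_one hl
  norm_num [k1', l1'] at k3 k4 k5 l3 l4 l5
  have k0 : ∫ u, √u ^ 0 ∂chiSquared k = 1 := by simp
  have l0 : ∫ u, √u ^ 0 ∂chiSquared l = 1 := by simp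
  have k1 := chiMoment_one hk
  have l1 := chiMoment_one hl
  have k2 := chiMoment_two hk
  have l2 := chiMoment_two hl
  have i1 := integrable_sqrt_sub_sqrt_pow hk hl s 1
  have i3 := integrable_sqrt_sub_sqrt_pow hk hl s 3
  have i5 := integrable_sqrt_sub_sqrt_pow hk hl s 5
  have i7 := (integrable_sqrt_sub_sqrt_pow hk hl (-B) 7).div_const 336
  have e1 := integral_sqrt_sub_sqrt_pow hk hl s 1
  have e3 := integral_sqrt_sub_sqrt_pow hk hl s 3
  have e5 := integral_sqrt_sub_sqrt_pow hk hl s 5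
  have iΦ := integrable_mixture hk hl c (c * s)
  have E1 : ∫ p, (√p.1 - s * √p.2) ^ 1 ∂(chiSquared k).prod (chiSquared l) =
      chiMean l * (chiMean k / chiMean l - s) := by
    rw [e1]
    simp only [Finset.sum_range_succ, Finset.sum_range_zero, Nat.sub_self, Nat.sub_zero,
      k0, k1, l0, l1]
    norm_num
    field_simp
    ring
  have E3 : ∫ p, (√p.1 - s * √p.2) ^ 3 ∂(chiSquared k).prod (chiSquared l) =
      chiMean l * cubicMoment k l (chiMean k / chiMean l) s := by
    rw [e3, cubicMoment]
    simp only [Finset.sum_range_succ, Finset.sum_range_zero, Nat.sub_self, Nat.sub_zero,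
      Nat.reduceSub, Nat.reduceAdd, k0, k1, k2, k3, l0, l1, l2, l3]
    norm_num [Nat.choose]
    field_simp
    ring
  have E5 : ∫ p, (√p.1 - s * √p.2) ^ 5 ∂(chiSquared k).prod (chiSquared l) =
      chiMean l * quinticMoment k l (chiMean k / chiMean l) s := by
    rw [e5, quinticMoment]
    simp only [Finset.sum_range_succ, Finset.sum_range_zero, Nat.sub_self, Nat.sub_zero,
      Nat.reduceSub, Nat.reduceAdd, k0, k1, k2, k3, k4, k5, l0, l1, l2, l3, l4, l5]
    norm_num [Nat.choose]
    field_simp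
    ring
  have ia : Integrable (fun p : ℝ × ℝ => √(2 * Real.pi) * (Phi (c * √p.1 - c * s * √p.2) - 1 / 2))
      ((chiSquared k).prod (chiSquared l)) := (iΦ.sub (integrable_const _)).const_mul _
  have ib : Integrable (fun p : ℝ × ℝ => c * (√p.1 - s * √p.2) ^ 1 -
      c ^ 3 / 6 * (√p.1 - s * √p.2) ^ 3) ((chiSquared k).prod (chiSquared l)) :=
    (i1.const_mul _).sub (i3.const_mul _)
  have ic : Integrable (fun p : ℝ × ℝ => c * (√p.1 - s * √p.2) ^ 1 -
      c ^ 3 / 6 * (√p.1 - s * √p.2) ^ 3 + c ^ 5 / 40 * (√p.1 - s * √p.2) ^ 5)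
      ((chiSquared k).prod (chiSquared l)) := ib.add (i5.const_mul _)
  have eF : √(2 * Real.pi) * (mixture k l c (c * s) - 1 / 2) -
      c * chiMean l * (chiMean k / chiMean l - s -
        c ^ 2 / 6 * cubicMoment k l (chiMean k / chiMean l) s +
        c ^ 4 / 40 * quinticMoment k l (chiMean k / chiMean l) s) =
      ∫ p, (√(2 * Real.pi) * (Phi (c * √p.1 - c * s * √p.2) - 1 / 2) -
        (c * (√p.1 - s * √p.2) ^ 1 - c ^ 3 / 6 * (√p.1 - s * √p.2) ^ 3 +
          c ^ 5 / 40 * (√p.1 - s * √p.2) ^ 5)) ∂(chiSquared k).prod (chiSquared l) := by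
    rw [integral_sub ia ic, integral_add ib (i5.const_mul _),
      integral_sub (i1.const_mul _) (i3.const_mul _), integral_const_mul, integral_const_mul,
      integral_const_mul, integral_const_mul, integral_sub iΦ (integrable_const _), E1, E3, E5,
      integral_const, probReal_univ, one_smul, mixture]
    ring
  rw [eF, mul_comm _ (c ^ 7), ← integral_const_mul, ← Real.norm_eq_abs]
  refine norm_integral_le_of_norm_le (i7.const_mul _)
    ((ae_pos_chiSquared_prod k l).mono fun p hp => ?_)
  have hX : |√p.1 - s * √p.2| ≤ √p.1 - -B * √p.2 :=
    calc |√p.1 - s * √p.2| ≤ |√p.1| + |s * √p.2| := abs_sub _ _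
      _ = √p.1 + |s| * √p.2 := by
        rw [abs_mul, abs_of_nonneg (Real.sqrt_nonneg _), abs_of_nonneg (Real.sqrt_nonneg _)]
      _ ≤ √p.1 + B * √p.2 := by gcongr
      _ = _ := by ring
  have hT := Phi_taylor (c * (√p.1 - s * √p.2))
  rw [abs_mul, abs_of_pos hc] at hT
  rw [Real.norm_eq_abs]
  calc _ = _ := by
        congr 1
        ring_nf
    _ ≤ _ := hT
    _ ≤ (c * (√p.1 - -B * √p.2)) ^ 7 / 336 := by gcongr
    _ = _ := by ring

/-- For fixed `s` and small `c > 0`, `E Φ(c √χ²_k - c s √χ²_l) - 1/2` has the sign of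
`E √χ²_k - s E √χ²_l`. -/
lemma tendsto_mixture_sub_half_div (hk : 0 < k) (hl : 0 < l) (s : ℝ) :
    Tendsto (fun c => √(2 * Real.pi) * (mixture k l c (c * s) - 1 / 2) / c) (𝓝[>] 0)
      (𝓝 (chiMean l * (chiMean k / chiMean l - s))) := by
  obtain ⟨C, hC⟩ := mixture_expansion hk hl |s|
  have hid : Tendsto (fun c : ℝ => c) (𝓝[>] 0) (𝓝 0) := nhdsWithin_le_nhds
  have h1 : Tendsto (fun c : ℝ => chiMean l * (chiMean k / chiMean l - s -
        c ^ 2 / 6 * cubicMoment k l (chiMean k / chiMean l) s +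
        c ^ 4 / 40 * quinticMoment k l (chiMean k / chiMean l) s)) (𝓝[>] 0)
      (𝓝 (chiMean l * (chiMean k / chiMean l - s))) := by
    have : Continuous fun c : ℝ => chiMean l * (chiMean k / chiMean l - s -
        c ^ 2 / 6 * cubicMoment k l (chiMean k / chiMean l) s +
        c ^ 4 / 40 * quinticMoment k l (chiMean k / chiMean l) s) := by fun_prop
    simpa using (this.tendsto 0).mono_left nhdsWithin_le_nhds
  have h2 : Tendsto (fun c : ℝ => C * c ^ 6) (𝓝[>] 0) (𝓝 0) := by
    simpa using (hid.pow 6).const_mul C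
  refine tendsto_of_tendsto_of_dist h1 (squeeze_zero' (Eventually.of_forall fun _ => dist_nonneg)
    ?_ h2)
  filter_upwards [self_mem_nhdsWithin] with c (hc : 0 < c)
  have h := hC c s hc le_rfl
  rw [dist_comm, Real.dist_eq, ← mul_le_mul_iff_right₀ hc, ← abs_of_pos hc, ← abs_mul]
  rw [abs_of_pos hc]
  calc _ = _ := by
        congr 1
        field_simp
    _ ≤ _ := h
    _ = _ := by ring

variable {s : ℝ → ℝ}

/-- The median `c s` of the mixture is asymptotic to `c E √χ²_k / E √χ²_l` as `c → 0`. -/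
lemma tendsto_mixture_median (hk : 0 < k) (hl : 0 < l)
    (hs : ∀ c, 0 < c → mixture k l c (c * s c) = 1 / 2) :
    Tendsto s (𝓝[>] 0) (𝓝 (chiMean k / chiMean l)) := by
  have he := chiMean_pos hl
  have hpi : 0 < √(2 * Real.pi) := by positivity
  refine tendsto_order.2 ⟨fun t ht => ?_, fun t ht => ?_⟩
  · have h := (tendsto_mixture_sub_half_div hk hl t).eventually_const_lt
      (mul_pos he (sub_pos.2 ht))
    filter_upwards [h, self_mem_nhdsWithin] with c h (hc : 0 < c)
    have h' := pos_of_mul_pos_right ((div_pos_iff_of_pos_right hc).1 h) hpi.le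
    have h2 : mixture k l c (c * s c) < mixture k l c (c * t) := by
      rw [hs c hc]
      linarith
    exact lt_of_mul_lt_mul_left ((strictAnti_mixture hk hl c).lt_iff_gt.1 h2) hc.le
  · have h := (tendsto_mixture_sub_half_div hk hl t).eventually_lt_const
      (mul_neg_of_pos_of_neg he (sub_neg.2 ht))
    filter_upwards [h, self_mem_nhdsWithin] with c h (hc : 0 < c)
    have h' := neg_of_mul_neg_right ((div_lt_iff₀ hc).1 h |>.trans_eq (zero_mul c)) hpi.le
    have h2 : mixture k l c (c * t) < mixture k l c (c * s c) := by
      rw [hs c hc]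
      linarith
    exact lt_of_mul_lt_mul_left ((strictAnti_mixture hk hl c).lt_iff_gt.1 h2) hc.le

/-- The equation for the median of the mixture, up to `o(c⁴)`. -/
lemma tendsto_mixture_median_expansion (hk : 0 < k) (hl : 0 < l)
    (hs : ∀ c, 0 < c → mixture k l c (c * s c) = 1 / 2) :
    Tendsto (fun c => (s c - chiMean k / chiMean l +
        c ^ 2 / 6 * cubicMoment k l (chiMean k / chiMean l) (s c) -
        c ^ 4 / 40 * quinticMoment k l (chiMean k / chiMean l) (s c)) / c ^ 4)
      (𝓝[>] 0) (𝓝 0) := by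
  have he := chiMean_pos hl
  obtain ⟨C, hC⟩ := mixture_expansion hk hl (|chiMean k / chiMean l| + 1)
  have hid : Tendsto (fun c : ℝ => c) (𝓝[>] 0) (𝓝 0) := nhdsWithin_le_nhds
  have h2 : Tendsto (fun c : ℝ => C / chiMean l * c ^ 2) (𝓝[>] 0) (𝓝 0) := by
    simpa using (hid.pow 2).const_mul (C / chiMean l)
  have hb := (tendsto_mixture_median hk hl hs).abs.eventually_lt_const
    (lt_add_one |chiMean k / chiMean l|)
  refine squeeze_zero_norm' ?_ h2
  filter_upwards [self_mem_nhdsWithin, hb] with c (hc : 0 < c) hb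
  have h := hC c (s c) hc hb.le
  rw [hs c hc, sub_self, mul_zero, zero_sub, abs_neg, abs_mul, abs_of_pos (mul_pos hc he),
    ← le_div_iff₀' (mul_pos hc he)] at h
  rw [Real.norm_eq_abs, abs_div, abs_of_pos (pow_pos hc 4), div_le_iff₀ (pow_pos hc 4), ← abs_neg]
  calc _ = _ := by
        congr 1
        ring
    _ ≤ _ := h
    _ = _ := by
      field_simp

/-- At the median, the mixture for all `c > 0` determines the degrees of freedom, apart from one
exceptional relation. The first, second and third nonzero orders in `c` of the common root give one
equation each. -/
lemma eq_of_mixture_eq_half {k' l' : ℝ} (hk : 0 < k) (hl : 0 < l) (hk' : 0 < k') (hl' : 0 < l')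
    (hs : ∀ c, 0 < c → mixture k l c (c * s c) = 1 / 2)
    (hs' : ∀ c, 0 < c → mixture k' l' c (c * s c) = 1 / 2)
    (hne : (chiMean k' / chiMean l') ^ 2 * (2 * l' - 1) ≠ 2 * k' - 1) : k = k' ∧ l = l' := by
  have hq := tendsto_mixture_median hk hl hs
  have hq' := tendsto_mixture_median hk' hl' hs'
  have hqq := tendsto_nhds_unique hq hq'
  have h := tendsto_mixture_median_expansion hk hl hs
  have h' := tendsto_mixture_median_expansion hk' hl' hs'
  rw [hqq] at hq h
  have hq0 : 0 < chiMean k' / chiMean l' := div_pos (chiMean_pos hk') (chiMean_pos hl')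
  obtain ⟨q, hqe⟩ : ∃ q, chiMean k' / chiMean l' = q := ⟨_, rfl⟩
  rw [hqe] at hq h h' hne hq0
  have hid : Tendsto (fun c : ℝ => c) (𝓝[>] 0) (𝓝 0) := nhdsWithin_le_nhds
  have hpos : ∀ᶠ c : ℝ in 𝓝[>] 0, 0 < c := self_mem_nhdsWithin
  have c3 : Continuous (cubicMoment k l q) := by
    unfold cubicMoment
    fun_prop
  have c5 : Continuous (quinticMoment k l q) := by
    unfold quinticMoment
    fun_prop
  have c3' : Continuous (cubicMoment k' l' q) := by
    unfold cubicMoment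
    fun_prop
  have c5' : Continuous (quinticMoment k' l' q) := by
    unfold quinticMoment
    fun_prop
  have t3 := (c3.tendsto q).comp hq
  have t5 := (c5.tendsto q).comp hq
  have t3' := (c3'.tendsto q).comp hq
  have t5' := (c5'.tendsto q).comp hq
  have hd := h.sub h'
  -- the terms of order `c²` agree
  have hcub : cubicMoment k l q q = cubicMoment k' l' q q := by
    have h1 := ((hd.mul (hid.pow 2)).add (((t5.sub t5').mul (hid.pow 2)).div_const 40)).mul_const 6
    have h2 : Tendsto (fun c => cubicMoment k l q (s c) - cubicMoment k' l' q (s c)) (𝓝[>] 0)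
        (𝓝 0) := by
      refine Tendsto.congr' (hpos.mono fun c hc => ?_) (by simpa using h1)
      field_simp
      ring
    exact sub_eq_zero.1 (tendsto_nhds_unique (t3.sub t3') h2)
  have hΔ : k - k' = q ^ 2 * (l - l') := by
    unfold cubicMoment at hcub
    refine mul_left_cancel₀ hq0.ne' ?_
    linear_combination (-1 / 2 : ℝ) * hcub
  have hcube : ∀ x, cubicMoment k l q x - cubicMoment k' l' q x = (l - l') * (q - x) ^ 3 :=
    fun x => by
      unfold cubicMoment
      linear_combination (q - 3 * x) * hΔ
  -- hence the cubic terms differ by `O(c⁶)` only, and the terms of order `c⁴` agree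
  have hquin : quinticMoment k l q q = quinticMoment k' l' q q := by
    -- leading term of the deviation of the root from `q`
    have hδ : Tendsto (fun c => (s c - q) / c ^ 2) (𝓝[>] 0) (𝓝 (-(cubicMoment k l q q / 6))) := by
      have h1 := ((h.mul (hid.pow 2)).sub (t3.div_const 6)).add ((t5.mul (hid.pow 2)).div_const 40)
      refine Tendsto.congr' (hpos.mono fun c hc => ?_) (by simpa using h1)
      field_simp
      ring
    have h3 : Tendsto (fun c => (l - l') * (q - s c) ^ 2 * ((s c - q) / c ^ 2)) (𝓝[>] 0)
        (𝓝 0) := by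
      simpa using ((((tendsto_const_nhds (x := q)).sub hq).pow 2).const_mul (l - l')).mul hδ
    have h1 := (hd.mul_const 40).add (h3.mul_const (40 / 6))
    have h2 : Tendsto (fun c => quinticMoment k' l' q (s c) - quinticMoment k l q (s c)) (𝓝[>] 0)
        (𝓝 0) := by
      refine Tendsto.congr' (hpos.mono fun c hc => ?_) (by simpa using h1)
      have h4 := hcube (s c)
      field_simp
      linear_combination (40 * c ^ 2 : ℝ) * h4
    exact (sub_eq_zero.1 (tendsto_nhds_unique (t5'.sub t5) h2)).symm
  have hfin : (4 * q ^ 3) * (l - l') * (q ^ 2 * (2 * l' - 1) - (2 * k' - 1)) = 0 := by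
    obtain rfl : k = k' + q ^ 2 * (l - l') := by linarith
    unfold quinticMoment at hquin
    linear_combination hquin
  have hll : l - l' = 0 := by
    rcases mul_eq_zero.1 hfin with h0 | h0
    · exact (mul_eq_zero.1 h0).resolve_left (by positivity)
    · exact absurd (sub_eq_zero.1 h0) hne
  rw [hll, mul_zero] at hΔ
  exact ⟨sub_eq_zero.1 hΔ, sub_eq_zero.1 hll⟩

end

/-! ### Exact matching -/

/-- Two mixtures with a common `p`-level curve over all `c` have the same degrees of freedom, if one
of them has the degrees of freedom `l' + 1`, `l'`. -/
lemma eq_of_common_level {k l l' p : ℝ} (hk : 0 < k) (hl : 0 < l) (hl' : 1 ≤ l')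
    (h : ∀ c, ∃ t, mixture k l c t = p ∧ mixture (l' + 1) l' c t = p) : k = l' + 1 ∧ l = l' := by
  have hl0 : 0 < l' := by linarith
  have hk0 : 0 < l' + 1 := by linarith
  by_cases hp : p = 1 / 2
  · choose t ht ht' using h
    have e : ∀ c, 0 < c → c * (t c / c) = t c := fun c hc => mul_div_cancel₀ _ hc.ne'
    refine eq_of_mixture_eq_half (s := fun c => t c / c) hk hl hk0 hl0 (fun c hc => ?_)
      (fun c hc => ?_) (chiMean_ratio_ne hl')
    · rw [e c hc, ht, hp]
    · rw [e c hc, ht', hp]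
  · obtain ⟨t, h0, h0'⟩ := h 0
    obtain ⟨s, h1, h1'⟩ := h 1
    exact eq_of_mixture_eq_of_ne_half hk hl hk0 hl0 hp h0 h0' one_pos (h1.trans h1'.symm)

/-- The coverage in terms of mixtures. -/
lemma coverage_eq_mixture {n : ℕ} (hn : 3 ≤ n) {a b : ℝ} (ha : a < n) (hb : b < n) {α : ℝ}
    (hα : α ∈ Ioo (0 : ℝ) 1) (μ₁ μ₂ : ℝ) {σ₁ σ₂ ρ : ℝ} (h₁ : 0 < σ₁) (h₂ : 0 < σ₂)
    (hρ : ρ ∈ Ioo (-1 : ℝ) 1) :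
    coverage n a b α μ₁ μ₂ σ₁ σ₂ ρ = mixture (n - 1) (n - 2) (ρ / √(1 - ρ ^ 2))
      (quantile (ratioLaw ρ (n - a) (n - b)) α / √(1 - ρ ^ 2)) := by
  have h3 : (3 : ℝ) ≤ n := by exact_mod_cast hn
  rw [coverage_eq hn ha hb hα μ₁ μ₂ h₁ h₂ hρ,
    ratioLaw_real_Ioi (by linarith) (by linarith) hρ]

lemma coverage_eq_iff {n : ℕ} (hn : 3 ≤ n) {a b : ℝ} (ha : a < n) (hb : b < n) {α : ℝ}
    (hα : α ∈ Ioo (0 : ℝ) 1) (μ₁ μ₂ : ℝ) {σ₁ σ₂ : ℝ} (h₁ : 0 < σ₁) (h₂ : 0 < σ₂) :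
    (∀ ρ ∈ Ioo (-1 : ℝ) 1, coverage n a b α μ₁ μ₂ σ₁ σ₂ ρ = 1 - α) ↔ a = 1 ∧ b = 2 := by
  have h3 : (3 : ℝ) ≤ n := by exact_mod_cast hn
  have hk := sub_pos.2 ha
  have hl := sub_pos.2 hb
  constructor
  · intro h
    have hkl := eq_of_common_level (l' := n - 2) (p := 1 - α) hk hl (by linarith) fun c => by
      have hρ := psi_mem_Ioo c
      refine ⟨quantile (ratioLaw (psi c) (n - a) (n - b)) α / √(1 - psi c ^ 2), ?_, ?_⟩
      · simpa only [psi_div_sqrt_one_sub_sq] using mixture_quantile_ratioLaw hk hl hρ hα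
      · have := h _ hρ
        rw [coverage_eq_mixture hn ha hb hα μ₁ μ₂ h₁ h₂ hρ, psi_div_sqrt_one_sub_sq] at this
        rw [← this]
        congr 1
        ring
    constructor <;> linarith [hkl.1, hkl.2]
  · rintro ⟨rfl, rfl⟩ ρ hρ
    rw [coverage_eq_mixture hn ha hb hα μ₁ μ₂ h₁ h₂ hρ, mixture_quantile_ratioLaw hk hl hρ hα]

end BivariateNormal

end

theorem theorem2 (n : ℕ) (hn : 3 ≤ n) (a b : ℝ) (ha : a < n) (hb : b < n) :
    -- the posterior quantile of the correlation
    (∀ x : Fin n → ℝ × ℝ, Nondegenerate x →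
      IsProbabilityMeasure (posteriorLaw a b x) ∧
      ∀ α ∈ Set.Ioo (0 : ℝ) 1,
        quantile (posteriorRho a b x) (1 - α) =
          psi (quantile (yStarLaw n a b (sampleCorr x)) (1 - α)) ∧
        posteriorRho a b x (Set.Iio (quantile (posteriorRho a b x) (1 - α))) =
          ENNReal.ofReal (1 - α)) ∧
    -- the frequentist coverage
    (∀ α ∈ Set.Ioo (0 : ℝ) 1, ∀ μ₁ μ₂ σ₁ σ₂ : ℝ, 0 < σ₁ → 0 < σ₂ → ∀ ρ ∈ Set.Ioo (-1 : ℝ) 1,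
      coverage n a b α μ₁ μ₂ σ₁ σ₂ ρ =
        (ratioLaw ρ (n - 1) (n - 2)).real
          (Set.Ioi (quantile (ratioLaw ρ (n - a) (n - b)) α))) ∧
    -- exact matching holds for the right-Haar prior and for no other
    (∀ α ∈ Set.Ioo (0 : ℝ) 1, ∀ μ₁ μ₂ σ₁ σ₂ : ℝ, 0 < σ₁ → 0 < σ₂ →
      ((∀ ρ ∈ Set.Ioo (-1 : ℝ) 1, coverage n a b α μ₁ μ₂ σ₁ σ₂ ρ = 1 - α) ↔
        a = 1 ∧ b = 2)) ∧
    -- the right-Haar posterior of the correlation is its fiducial distribution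
    (∀ x : Fin n → ℝ × ℝ, Nondegenerate x →
      ∀ μ₁ μ₂ σ₁ σ₂ : ℝ, 0 < σ₁ → 0 < σ₂ → ∀ ρ ∈ Set.Ioo (-1 : ℝ) 1,
        (posteriorRho 1 2 x).real (Set.Iic ρ) =
          fiducialCDF n μ₁ μ₂ σ₁ σ₂ (sampleCorr x) ρ) := by
  have hn0 : n ≠ 0 := by omega
  refine ⟨fun x hx => ⟨isProbabilityMeasure_posteriorLaw hn0 ha hb hx, fun α hα => ?_⟩,
    fun α hα μ₁ μ₂ σ₁ σ₂ h₁ h₂ ρ hρ => coverage_eq hn ha hb hα μ₁ μ₂ h₁ h₂ hρ,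
    fun α hα μ₁ μ₂ σ₁ σ₂ h₁ h₂ => coverage_eq_iff hn ha hb hα μ₁ μ₂ h₁ h₂,
    fun x hx μ₁ μ₂ σ₁ σ₂ h₁ h₂ ρ hρ => posteriorRho_eq_fiducialCDF hn hx μ₁ μ₂ h₁ h₂ hρ⟩
  have hα' : 1 - α ∈ Set.Ioo (0 : ℝ) 1 := ⟨by linarith [hα.2], by linarith [hα.1]⟩
  exact ⟨quantile_posteriorRho hn0 ha hb hx hα', posteriorRho_Iio_quantile hn0 ha hb hx hα'⟩
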